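/- **Setting.** Let $n,m,q\in\mathbb N$, $L>0$, let $A_0,A_1,A_2:[0,L]\to\mathbb R^{n\times n}$, $B_1:[0,L]\to\mathbb R^{n\times m}$, $C_a,C_b:[0,L]\to\mathbb R^{q\times n}$ be measurable and essentially bounded, and let $C_1\in\mathbb R^{q\times 4n}$, $D_1\in\mathbb R^{q\times m}$, $B\in\mathbb R^{2n\times 4n}$ be such that $$B_2:=BK,\qquad K:=\begin{bmatrix}I&0\\ I&L\,I\\ 0&I\\ 0&I\end{bmatrix},$$ is invertible (in particular $B$ has row rank $2n$). Consider the PDE $$\dot x(s,t)=A_0(s)x+A_1(s)x_s+A_2(s)x_{ss}+B_1(s)w(t),\qquad Bz(t)=0,\quad x(s,0)=0,$$ $$y(t)=C_1z(t)+\int_0^L\big(C_a(s)x(s,t)+C_b(s)x_s(s,t)\big)ds+D_1w(t),\qquad z(t)=\begin{bmatrix}x(0,t)\\x(L,t)\\x_s(0,t)\\x_s(L,t)\end{bmatrix}.$$ A solution with input $w$ and output $y$ is a locally absolutely continuous $x:[0,\infty)\to L_2^n([0,L])$ (an integral of its locally Bochner integrable derivative) with $x(0)=0$ such that for a.e. $t$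 one has $x(t)\in X:=\{u\in W^{2,n}([0,L]): B[u(0);u(L);u_s(0);u_s(L)]=0\}$, where $W^{2,n}([0,L])$ consists of the $\mathbb R^n$-valued $u$ with $u,u_s,u_{ss}\in L_2$, and the two equations hold. **Kernels.** With $\mathcal I$ the indicator of $[0,\infty)$, put $$B_c(\eta)=-B_2^{-1}B\begin{bmatrix}0\\(L-\eta)I\\0\\I\end{bmatrix},\quad B_a(s,\eta)=[I\ \ sI]B_c(\eta),\quad B_b(\eta)=[0\ \ I]B_c(\eta),$$ $$G(s,\eta)=B_a(s,\eta)+\mathcal I(s-\eta)(s-\eta)I,\qquad G'(s,\eta)=B_b(\eta)+\mathcal I(s-\eta)I,$$ $$C_3(\theta)=C_1\Big(KB_c(\theta)+\begin{bmatrix}0\\(L-\theta)I\\0\\I\end{bmatrix}\Big)+\int_0^L\big(C_a(s)G(s,\theta)+C_b(s)G'(s,\theta)\big)ds.$$ **The maps $\mathcal L_1,\mathcal L_2,\mathcal L_3$.** For matrix functions $M(s)$, $N_1(s,\theta)$, $N_2(s,\theta)$ let $$Y_1(s,\eta)=B_a(\eta,s)^TM(\eta)+\int_\eta^LB_a(\theta,s)^TN_1(\theta,\eta)d\theta+\int_0^\eta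 B_a(\theta,s)^TN_2(\theta,\eta)d\theta,$$ $$Y_2(\zeta)=M(\zeta)+\int_0^\zeta N_1(\zeta,\theta)d\theta+\int_\zeta^LN_2(\zeta,\theta)d\theta,$$ $$Y_3(\zeta,\eta)=M(\zeta)B_a(\zeta,\eta)+\int_0^\zeta N_1(\zeta,\theta)B_a(\theta,\eta)d\theta+\int_\zeta^LN_2(\zeta,\theta)B_a(\theta,\eta)d\theta,$$ $$E_1(s,\theta)=\int_s^L(\eta-s)N_1(\eta,\theta)d\eta,\quad E_2(s,\theta)=(\theta-s)M(\theta)+\int_\theta^L(\eta-s)N_1(\eta,\theta)d\eta+\int_s^\theta(\eta-s)N_2(\eta,\theta)d\eta,$$ $$F_4(\theta,\eta)=M(\eta)+\int_\theta^\eta N_1(\eta,\zeta)d\zeta,\quad F_5(s,\eta)=\int_s^\eta(\zeta-s)N_2(\zeta,\eta)d\zeta,$$ $$F_1(s,\theta)=\int_s^L\big((\eta-s)F_4(\theta,\eta)+F_5(s,\eta)\big)d\eta,\quad F_2(s,\theta)=\int_\theta^L\big((\eta-s)F_4(\theta,\eta)+F_5(s,\eta)\big)d\eta,$$ $$F_3(s,\eta)=\int_0^LB_a(\zeta,s)^TY_2(\zeta)B_b(\eta)d\zeta+\int_\eta^LY_1(s,\zeta)d\zeta+\int_s^L(\zeta-s)Y_2(\zeta)d\zeta\,B_b(\eta),$$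 $$G_4(\theta,\eta)=(\eta-\theta)M(\eta)+\int_\theta^\eta(\zeta-\theta)N_1(\eta,\zeta)d\zeta,\quad G_5(s,\theta,\eta)=\int_s^\eta(\zeta-s)(\eta-\theta)N_2(\zeta,\eta)d\zeta,$$ $$G_1(s,\theta)=\int_s^L\big((\eta-s)G_4(\theta,\eta)+G_5(s,\theta,\eta)\big)d\eta,\quad G_2(s,\theta)=\int_\theta^L\big((\eta-s)G_4(\theta,\eta)+G_5(s,\theta,\eta)\big)d\eta,$$ $$G_3(s,\theta)=\int_0^LB_a(\eta,s)^TY_3(\eta,\theta)d\eta+\int_\theta^L(\eta-\theta)Y_1(s,\eta)d\eta+\int_s^L(\eta-s)Y_3(\eta,\theta)d\eta,$$ and $\mathcal L_1(M,N_1,N_2)=(E_1+Y_1,E_2+Y_1)$, $\mathcal L_2(M,N_1,N_2)=(F_1+F_3,F_2+F_3)$, $\mathcal L_3(M,N_1,N_2)=(G_1+G_3,G_2+G_3)$. **The maps $\mathcal L_4,\mathcal L_5$.** Let $V_i(s)=M(s)A_i(s)$, $W_{ij}(s,\theta)=N_j(s,\theta)A_i(\theta)$, $$(H_1,H_2)=\mathcal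 L_1(V_2,W_{21},W_{22})+\mathcal L_2(V_1,W_{11},W_{12})+\mathcal L_3(V_0,W_{01},W_{02}),$$ $$V(s,\eta)=\Big(G(\eta,s)^TM(\eta)+\int_\eta^LG(\beta,s)^TN_1(\beta,\eta)d\beta+\int_0^\eta G(\beta,s)^TN_2(\beta,\eta)d\beta\Big)B_1(\eta).$$ For $\gamma>0$, $\mathcal L_4(M,N_1,N_2)=\{P,Q,R_1,R_2\}$ with $$P=\tfrac1L(D_1^TD_1-\gamma^2I),\quad Q(s)=D_1^TC_3(s)+\int_0^LV(s,\theta)^Td\theta,$$ $$R_1(s,\theta)=H_1(s,\theta)+H_2(\theta,s)^T+C_3(s)^TC_3(\theta),\quad R_2(s,\theta)=R_1(\theta,s)^T.$$ If $m=q$, $\mathcal L_5(M,N_1,N_2)=\{P,Q,R_1,R_2\}$ with $$P=-\tfrac1L(D_1+D_1^T),\quad Q(s)=-C_3(s)+\int_0^LV(s,\theta)^Td\theta,$$ $$R_1(s,\theta)=H_1(s,\theta)+H_2(\theta,s)^T,\quad R_2(s,\theta)=R_1(\theta,s)^T.$$ **The sets $\Phi_1,\Phi_2$.** $\{P,Q,R_1,R_2\}\in\Phi_1$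 if there are $d\in\mathbb N$, a square integrable $Z:[0,L]^2\to\mathbb R^{d\times n}$ and a symmetric positive semidefinite $T=(T_{ij})_{i,j=1}^3$ with block sizes $m,d,d$ such that, for all $s,\theta\in[0,L]$, $$P=T_{11},\qquad Q(\theta)=\int_\theta^LT_{12}Z(s,\theta)ds+\int_0^\theta T_{13}Z(s,\theta)ds,$$ and, abbreviating $\Gamma_{ij}[a,b]:=\int_a^bZ(\beta,s)^TT_{ij}Z(\beta,\theta)d\beta$, $$R_1(s,\theta)=\Gamma_{22}[s,L]+\Gamma_{32}[\theta,s]+\Gamma_{33}[0,\theta]\ \ (\theta\le s),\qquad R_2(s,\theta)=\Gamma_{22}[\theta,L]+\Gamma_{23}[s,\theta]+\Gamma_{33}[0,s]\ \ (s\le\theta).$$ $(M,N_1,N_2)\in\Phi_2$ if there are $d_1,d_2\in\mathbb N$, square integrable $Z_1:[0,L]\to\mathbb R^{d_1\times n}$, $Z:[0,L]^2\to\mathbb R^{d_2\times n}$ and a symmetric positive semidefinite $T$ with block sizes $d_1,d_2,d_2$ such that on $[0,L]$ $$M(s)=Z_1(s)^TT_{11}Z_1(s),$$ $$N_1(s,\theta)=Z_1(s)^TT_{12}Z(s,\theta)+Z(\theta,s)^TT_{31}Z_1(\theta)+\Gamma_{22}[s,L]+\Gamma_{32}[\theta,s]+\Gamma_{33}[0,\theta]\quad(\theta\le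 s),$$ $$N_2(s,\theta)=N_1(\theta,s)^T\quad(s\le\theta).$$ **Theorem.** Let $\epsilon>0$, $\gamma>0$ and let $M:\mathbb R\to\mathbb R^{n\times n}$, $N_1,N_2:\mathbb R\times\mathbb R\to\mathbb R^{n\times n}$ be matrix-valued polynomials with $(M-\epsilon I,N_1,N_2)\in\Phi_2$. Then for all $w\in L_2^m([0,\infty))$ and $y\in L_2^q([0,\infty))$ which are the input and output of a solution $x$ of the PDE: 1. if $\{P,Q,R_1,R_2\}=\mathcal L_4(M,N_1,N_2)$ satisfies $\{-P,-Q,-R_1,-R_2\}\in\Phi_1$, then $\|y\|_{L_2}\le\gamma\|w\|_{L_2}$; 2. if $m=q$ and $\{P,Q,R_1,R_2\}=\mathcal L_5(M,N_1,N_2)$ satisfies $\{-P,-Q,-R_1,-R_2\}\in\Phi_1$, then $\langle y,w\rangle_{L_2}\ge0$. -/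

import Mathlib

open MeasureTheory Set
open scoped Matrix Polynomial

noncomputable section

namespace PDEGain

/-- `∫_a^b F(x) dx` for a matrix-valued `F`, entry by entry. -/
def mInt {ι κ : Type} (a b : ℝ) (F : ℝ → Matrix ι κ ℝ) : Matrix ι κ ℝ :=
  Matrix.of fun i j => ∫ x in a..b, F x i j

/-- The block column `[c₁ I; …; c_k I]` of `n × n` blocks. -/
def blockCol {k : ℕ} (n : ℕ) (c : Fin k → ℝ) : Matrix (Fin k × Fin n) (Fin n) ℝ :=
  Matrix.of fun p j => c p.1 * (1 : Matrix (Fin n) (Fin n) ℝ) p.2 j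

/-- The block row `[c₁ I, …, c_k I]` of `n × n` blocks. -/
def blockRow {k : ℕ} (n : ℕ) (c : Fin k → ℝ) : Matrix (Fin n) (Fin k × Fin n) ℝ :=
  Matrix.of fun i p => c p.1 * (1 : Matrix (Fin n) (Fin n) ℝ) i p.2

/-- The indicator of `[0, ∞)`. -/
def heav (r : ℝ) : ℝ := if 0 ≤ r then 1 else 0

/-- All entries of `F` are measurable and essentially bounded on `[0, L]`. -/
def EssBdd {ι κ : Type} (L : ℝ) (F : ℝ → Matrix ι κ ℝ) : Prop :=
  ∀ i j, MemLp (fun s => F s i j) ⊤ (volume.restrict (Icc 0 L))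

/-- `L₂ⁿ([0, L])`. -/
abbrev StateSpace (n : ℕ) (L : ℝ) : Type :=
  Lp (EuclideanSpace ℝ (Fin n)) 2 (volume.restrict (Icc (0 : ℝ) L))

/-- `u ∈ W^{2,n}([0, L])` with first and second derivatives `u'`, `u''`: `u''` is square integrable,
`u'` and `u` are (absolutely continuous) primitives of `u''` and `u'`. -/
structure IsSobolevTwo {n : ℕ} (L : ℝ) (u u' u'' : ℝ → EuclideanSpace ℝ (Fin n)) : Prop where
  memLp : MemLp u'' 2 (volume.restrict (Icc 0 L))
  deriv_eq : ∀ s ∈ Icc 0 L, u' s = u' 0 + ∫ r in (0 : ℝ)..s, u'' r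
  eq : ∀ s ∈ Icc 0 L, u s = u 0 + ∫ r in (0 : ℝ)..s, u' r

/-- The boundary vector `(u(0), u(L), u_s(0), u_s(L))`. -/
def boundaryVec {n : ℕ} (L : ℝ) (u u' : ℝ → EuclideanSpace ℝ (Fin n)) :
    EuclideanSpace ℝ (Fin 4 × Fin n) :=
  WithLp.toLp 2 fun p => (![u 0, u L, u' 0, u' L] p.1) p.2

/-- The data of the coupled linear PDE with `n` states, `m` inputs and `q` outputs on `[0, L]`
```
x_t(s,t) = A0(s) x + A1(s) x_s + A2(s) x_ss + B1(s) w(t),     B z(t) = 0,   x(s,0) = 0,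
y(t) = C1 z(t) + ∫_0^L (Ca(s) x(s,t) + Cb(s) x_s(s,t)) ds + D1 w(t),
z(t) = (x(0,t), x(L,t), x_s(0,t), x_s(L,t)).
``` -/
structure PDESystem (n m q : ℕ) where
  L : ℝ
  A0 : ℝ → Matrix (Fin n) (Fin n) ℝ
  A1 : ℝ → Matrix (Fin n) (Fin n) ℝ
  A2 : ℝ → Matrix (Fin n) (Fin n) ℝ
  B1 : ℝ → Matrix (Fin n) (Fin m) ℝ
  C1 : Matrix (Fin q) (Fin 4 × Fin n) ℝ
  Ca : ℝ → Matrix (Fin q) (Fin n) ℝ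
  Cb : ℝ → Matrix (Fin q) (Fin n) ℝ
  D1 : Matrix (Fin q) (Fin m) ℝ
  B : Matrix (Fin 2 × Fin n) (Fin 4 × Fin n) ℝ

namespace PDESystem

variable {n m q : ℕ} (S : PDESystem n m q)

/-- `u` (with derivatives `u'`, `u''`) belongs to the domain `X`. -/
def InDomain (u u' u'' : ℝ → EuclideanSpace ℝ (Fin n)) : Prop :=
  IsSobolevTwo S.L u u' u'' ∧ Matrix.toEuclideanLin S.B (boundaryVec S.L u u') = 0

/-- `(A0 u + A1 u_s + A2 u_ss + B1 w)(s)`. -/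
def rhs (u u' u'' : ℝ → EuclideanSpace ℝ (Fin n)) (w : EuclideanSpace ℝ (Fin m)) (s : ℝ) :
    EuclideanSpace ℝ (Fin n) :=
  Matrix.toEuclideanLin (S.A0 s) (u s) + Matrix.toEuclideanLin (S.A1 s) (u' s)
    + Matrix.toEuclideanLin (S.A2 s) (u'' s) + Matrix.toEuclideanLin (S.B1 s) w

/-- `C1 z + ∫_0^L (Ca u + Cb u_s) ds + D1 w`. -/
def output (u u' : ℝ → EuclideanSpace ℝ (Fin n)) (w : EuclideanSpace ℝ (Fin m)) :
    EuclideanSpace ℝ (Fin q) :=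
  Matrix.toEuclideanLin S.C1 (boundaryVec S.L u u')
    + (∫ s in (0 : ℝ)..S.L,
        (Matrix.toEuclideanLin (S.Ca s) (u s) + Matrix.toEuclideanLin (S.Cb s) (u' s)))
    + Matrix.toEuclideanLin S.D1 w

/-- `x` is a (strong) solution with input `w` and output `y`: `x : [0,∞) → L₂ⁿ([0,L])` is locally
absolutely continuous with `x(0) = 0`, and for almost every `t` one has `x(t) ∈ X`, the time
derivative `x'` of `x` at `t` is `A0 x + A1 x_s + A2 x_ss + B1 w`, and the output equation holds. -/
def IsSolution (w : ℝ → EuclideanSpace ℝ (Fin m)) (y : ℝ → EuclideanSpace ℝ (Fin q))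
    (x : ℝ → StateSpace n S.L) : Prop :=
  x 0 = 0 ∧ ∃ x' : ℝ → StateSpace n S.L,
    (∀ t, 0 ≤ t → IntervalIntegrable x' volume 0 t) ∧
    (∀ t, 0 ≤ t → x t = x 0 + ∫ τ in (0 : ℝ)..t, x' τ) ∧
    ∀ᵐ t ∂(volume.restrict (Ioi (0 : ℝ))), ∃ u u' u'' : ℝ → EuclideanSpace ℝ (Fin n),
      S.InDomain u u' u'' ∧
      (x t =ᵐ[volume.restrict (Icc 0 S.L)] u) ∧
      (x' t =ᵐ[volume.restrict (Icc 0 S.L)] S.rhs u u' u'' (w t)) ∧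
      y t = S.output u u' (w t)

/-- The block matrix `[I 0; I L·I; 0 I; 0 I]`, which sends `(x(0), x_s(0))` to the boundary vector
of the affine function with these data. -/
def bdryLift : Matrix (Fin 4 × Fin n) (Fin 2 × Fin n) ℝ :=
  Matrix.kroneckerMap (· * ·) !![1, 0; 1, S.L; 0, 1; 0, 1] (1 : Matrix (Fin n) (Fin n) ℝ)

/-- `B [I 0; I L·I; 0 I; 0 I]`. -/
def B2 : Matrix (Fin 2 × Fin n) (Fin 2 × Fin n) ℝ := S.B * S.bdryLift

/-- `B_c(η) = -(B [I 0; I L; 0 I; 0 I])⁻¹ B [0; L-η; 0; I]`. -/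
def Bc (η : ℝ) : Matrix (Fin 2 × Fin n) (Fin n) ℝ :=
  -(S.B2⁻¹ * S.B * blockCol n ![0, S.L - η, 0, 1])

/-- `B_a(s,η) = [I sI] B_c(η)`. -/
def Ba (s η : ℝ) : Matrix (Fin n) (Fin n) ℝ := blockRow n ![1, s] * S.Bc η

/-- `B_b(η) = [0 I] B_c(η)`. -/
def Bb (η : ℝ) : Matrix (Fin n) (Fin n) ℝ := blockRow n ![0, 1] * S.Bc η

/-- `G₁(s,η) = G(s,η) = [I sI] B_c(η) + 𝓘(s-η)(s-η) I`, so that `x(s) = ∫ G(s,η) x_ss(η) dη`. -/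
def G1 (s η : ℝ) : Matrix (Fin n) (Fin n) ℝ := S.Ba s η + (heav (s - η) * (s - η)) • 1

/-- `G₂(s,η) = [0 I] B_c(η) + 𝓘(s-η) I`, so that `x_s(s) = ∫ G₂(s,η) x_ss(η) dη`. -/
def G2 (s η : ℝ) : Matrix (Fin n) (Fin n) ℝ := S.Bb η + heav (s - η) • 1

/-- The kernel of the output operator, `C x = ∫_0^L C₃(θ) x_ss(θ) dθ`. -/
def C3 (θ : ℝ) : Matrix (Fin q) (Fin n) ℝ :=
  S.C1 * (S.bdryLift * S.Bc θ + blockCol n ![0, S.L - θ, 0, 1])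
    + mInt 0 S.L fun s => S.Ca s * S.G1 s θ + S.Cb s * S.G2 s θ

section Maps

variable (M : ℝ → Matrix (Fin n) (Fin n) ℝ) (N₁ N₂ : ℝ → ℝ → Matrix (Fin n) (Fin n) ℝ)

def Y1 (s η : ℝ) : Matrix (Fin n) (Fin n) ℝ :=
  (S.Ba η s)ᵀ * M η + mInt η S.L (fun θ => (S.Ba θ s)ᵀ * N₁ θ η)
    + mInt 0 η (fun θ => (S.Ba θ s)ᵀ * N₂ θ η)

def Y2 (ζ : ℝ) : Matrix (Fin n) (Fin n) ℝ :=
  M ζ + mInt 0 ζ (fun θ => N₁ ζ θ) + mInt ζ S.L (fun θ => N₂ ζ θ)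

def Y3 (ζ η : ℝ) : Matrix (Fin n) (Fin n) ℝ :=
  M ζ * S.Ba ζ η + mInt 0 ζ (fun θ => N₁ ζ θ * S.Ba θ η)
    + mInt ζ S.L (fun θ => N₂ ζ θ * S.Ba θ η)

def E1 (s θ : ℝ) : Matrix (Fin n) (Fin n) ℝ := mInt s S.L fun η => (η - s) • N₁ η θ

def E2 (s θ : ℝ) : Matrix (Fin n) (Fin n) ℝ :=
  (θ - s) • M θ + mInt θ S.L (fun η => (η - s) • N₁ η θ) + mInt s θ (fun η => (η - s) • N₂ η θ)

def E3 (s θ : ℝ) : Matrix (Fin n) (Fin n) ℝ := S.Y1 M N₁ N₂ s θ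

def F4 (θ η : ℝ) : Matrix (Fin n) (Fin n) ℝ := M η + mInt θ η fun ζ => N₁ η ζ

def F5 (s η : ℝ) : Matrix (Fin n) (Fin n) ℝ := mInt s η fun ζ => (ζ - s) • N₂ ζ η

def F1 (s θ : ℝ) : Matrix (Fin n) (Fin n) ℝ :=
  mInt s S.L fun η => (η - s) • F4 M N₁ θ η + F5 N₂ s η

def F2 (s θ : ℝ) : Matrix (Fin n) (Fin n) ℝ :=
  mInt θ S.L fun η => (η - s) • F4 M N₁ θ η + F5 N₂ s η

def F3 (s η : ℝ) : Matrix (Fin n) (Fin n) ℝ :=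
  mInt 0 S.L (fun ζ => (S.Ba ζ s)ᵀ * S.Y2 M N₁ N₂ ζ * S.Bb η)
    + mInt η S.L (fun ζ => S.Y1 M N₁ N₂ s ζ)
    + mInt s S.L (fun ζ => (ζ - s) • S.Y2 M N₁ N₂ ζ) * S.Bb η

def G4 (θ η : ℝ) : Matrix (Fin n) (Fin n) ℝ :=
  (η - θ) • M η + mInt θ η fun ζ => (ζ - θ) • N₁ η ζ

def G5 (s θ η : ℝ) : Matrix (Fin n) (Fin n) ℝ :=
  mInt s η fun ζ => ((ζ - s) * (η - θ)) • N₂ ζ η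

/-- The function called `G₁` in the definition of the third linear map (not the kernel `G1`). -/
def GI (s θ : ℝ) : Matrix (Fin n) (Fin n) ℝ :=
  mInt s S.L fun η => (η - s) • G4 M N₁ θ η + G5 N₂ s θ η

/-- The function called `G₂` in the definition of the third linear map (not the kernel `G2`). -/
def GII (s θ : ℝ) : Matrix (Fin n) (Fin n) ℝ :=
  mInt θ S.L fun η => (η - s) • G4 M N₁ θ η + G5 N₂ s θ η

def GIII (s θ : ℝ) : Matrix (Fin n) (Fin n) ℝ :=
  mInt 0 S.L (fun η => (S.Ba η s)ᵀ * S.Y3 M N₁ N₂ η θ)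
    + mInt θ S.L (fun η => (η - θ) • S.Y1 M N₁ N₂ s η)
    + mInt s S.L (fun η => (η - s) • S.Y3 M N₁ N₂ η θ)

/-- The linear map `𝓛₁`: `⟨x, P_{M,N₁,N₂} x_ss⟩ = ⟨x_ss, P_{0,R₁,R₂} x_ss⟩`. -/
def calL1 : (ℝ → ℝ → Matrix (Fin n) (Fin n) ℝ) × (ℝ → ℝ → Matrix (Fin n) (Fin n) ℝ) :=
  (fun s θ => S.E1 N₁ s θ + S.E3 M N₁ N₂ s θ, fun s θ => S.E2 M N₁ N₂ s θ + S.E3 M N₁ N₂ s θ)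

/-- The linear map `𝓛₂`: `⟨x, P_{M,N₁,N₂} x_s⟩ = ⟨x_ss, P_{0,Q₁,Q₂} x_ss⟩`. -/
def calL2 : (ℝ → ℝ → Matrix (Fin n) (Fin n) ℝ) × (ℝ → ℝ → Matrix (Fin n) (Fin n) ℝ) :=
  (fun s θ => S.F1 M N₁ N₂ s θ + S.F3 M N₁ N₂ s θ,
   fun s θ => S.F2 M N₁ N₂ s θ + S.F3 M N₁ N₂ s θ)

/-- The linear map `𝓛₃`: `⟨x, P_{M,N₁,N₂} x⟩ = ⟨x_ss, P_{0,T₁,T₂} x_ss⟩`. -/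
def calL3 : (ℝ → ℝ → Matrix (Fin n) (Fin n) ℝ) × (ℝ → ℝ → Matrix (Fin n) (Fin n) ℝ) :=
  (fun s θ => S.GI M N₁ N₂ s θ + S.GIII M N₁ N₂ s θ,
   fun s θ => S.GII M N₁ N₂ s θ + S.GIII M N₁ N₂ s θ)

/-- `(H₁, H₂)`: `⟨x, P_{M,N₁,N₂} 𝓐 x⟩ = ⟨x_ss, P_{0,H₁,H₂} x_ss⟩`. -/
def H : (ℝ → ℝ → Matrix (Fin n) (Fin n) ℝ) × (ℝ → ℝ → Matrix (Fin n) (Fin n) ℝ) :=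
  S.calL1 (fun s => M s * S.A2 s) (fun s θ => N₁ s θ * S.A2 θ) (fun s θ => N₂ s θ * S.A2 θ)
    + S.calL2 (fun s => M s * S.A1 s) (fun s θ => N₁ s θ * S.A1 θ) (fun s θ => N₂ s θ * S.A1 θ)
    + S.calL3 (fun s => M s * S.A0 s) (fun s θ => N₁ s θ * S.A0 θ) (fun s θ => N₂ s θ * S.A0 θ)

def V (s η : ℝ) : Matrix (Fin n) (Fin m) ℝ :=
  ((S.G1 η s)ᵀ * M η + mInt η S.L (fun β => (S.G1 β s)ᵀ * N₁ β η)
    + mInt 0 η (fun β => (S.G1 β s)ᵀ * N₂ β η)) * S.B1 η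

/-- `𝓛₄(M,N₁,N₂) = {P,Q,R₁,R₂}` (for the gain bound `γ`). -/
def calL4 (γ : ℝ) : Matrix (Fin m) (Fin m) ℝ × (ℝ → Matrix (Fin m) (Fin n) ℝ) ×
    (ℝ → ℝ → Matrix (Fin n) (Fin n) ℝ) × (ℝ → ℝ → Matrix (Fin n) (Fin n) ℝ) :=
  let R₁ : ℝ → ℝ → Matrix (Fin n) (Fin n) ℝ := fun s θ =>
    (S.H M N₁ N₂).1 s θ + ((S.H M N₁ N₂).2 θ s)ᵀ + (S.C3 s)ᵀ * S.C3 θ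
  ((1 / S.L) • (S.D1ᵀ * S.D1 - γ ^ 2 • (1 : Matrix (Fin m) (Fin m) ℝ)),
   fun s => S.D1ᵀ * S.C3 s + mInt 0 S.L (fun θ => (S.V M N₁ N₂ s θ)ᵀ),
   R₁,
   fun s θ => (R₁ θ s)ᵀ)

/-- `𝓛₅(M,N₁,N₂) = {P,Q,R₁,R₂}` for a system with as many inputs as outputs. -/
def calL5 (h : m = q) : Matrix (Fin m) (Fin m) ℝ × (ℝ → Matrix (Fin m) (Fin n) ℝ) ×
    (ℝ → ℝ → Matrix (Fin n) (Fin n) ℝ) × (ℝ → ℝ → Matrix (Fin n) (Fin n) ℝ) :=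
  let D : Matrix (Fin m) (Fin m) ℝ := S.D1.submatrix (Fin.cast h) id
  let R₁ : ℝ → ℝ → Matrix (Fin n) (Fin n) ℝ := fun s θ =>
    (S.H M N₁ N₂).1 s θ + ((S.H M N₁ N₂).2 θ s)ᵀ
  (-((1 / S.L) • (D + Dᵀ)),
   fun s => -((S.C3 s).submatrix (Fin.cast h) id) + mInt 0 S.L (fun θ => (S.V M N₁ N₂ s θ)ᵀ),
   R₁,
   fun s θ => (R₁ θ s)ᵀ)

end Maps

end PDESystem

/-- The three blocks of rows/columns of the partitioned matrix `T`. -/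
abbrev blk1 {d₁ d₂ : ℕ} : Fin d₁ → Fin d₁ ⊕ Fin d₂ ⊕ Fin d₂ := Sum.inl
abbrev blk2 {d₁ d₂ : ℕ} : Fin d₂ → Fin d₁ ⊕ Fin d₂ ⊕ Fin d₂ := fun i => Sum.inr (Sum.inl i)
abbrev blk3 {d₁ d₂ : ℕ} : Fin d₂ → Fin d₁ ⊕ Fin d₂ ⊕ Fin d₂ := fun i => Sum.inr (Sum.inr i)

/-- Square integrability on `[0,L]²` of every entry of `Z`. -/
def SqInt2 {ι κ : Type} (L : ℝ) (Z : ℝ → ℝ → Matrix ι κ ℝ) : Prop :=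
  ∀ i j, MemLp (fun p : ℝ × ℝ => Z p.1 p.2 i j) 2 (volume.restrict (Icc 0 L ×ˢ Icc 0 L))

/-- `∫_a^b Z(β,s)ᵀ T Z(β,θ) dβ`. -/
def gramInt {n d : ℕ} (T : Matrix (Fin d) (Fin d) ℝ) (Z : ℝ → ℝ → Matrix (Fin d) (Fin n) ℝ)
    (s θ a b : ℝ) : Matrix (Fin n) (Fin n) ℝ :=
  mInt a b fun β => (Z β s)ᵀ * T * Z β θ

/-- The set `Φ₁`. The kernel `R₁` is only used for `θ ≤ s`, the kernel `R₂` only for `s ≤ θ`. -/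
def Phi1 (n m : ℕ) (L : ℝ) : Set (Matrix (Fin m) (Fin m) ℝ × (ℝ → Matrix (Fin m) (Fin n) ℝ) ×
    (ℝ → ℝ → Matrix (Fin n) (Fin n) ℝ) × (ℝ → ℝ → Matrix (Fin n) (Fin n) ℝ)) :=
  {K | ∃ (d : ℕ) (Z : ℝ → ℝ → Matrix (Fin d) (Fin n) ℝ)
      (T : Matrix (Fin m ⊕ Fin d ⊕ Fin d) (Fin m ⊕ Fin d ⊕ Fin d) ℝ),
    SqInt2 L Z ∧ T.PosSemidef ∧
    K.1 = T.submatrix blk1 blk1 ∧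
    (∀ θ ∈ Icc 0 L, K.2.1 θ = mInt θ L (fun s => T.submatrix blk1 blk2 * Z s θ)
      + mInt 0 θ (fun s => T.submatrix blk1 blk3 * Z s θ)) ∧
    (∀ s θ, 0 ≤ θ → θ ≤ s → s ≤ L →
      K.2.2.1 s θ = gramInt (T.submatrix blk2 blk2) Z s θ s L
        + gramInt (T.submatrix blk3 blk2) Z s θ θ s
        + gramInt (T.submatrix blk3 blk3) Z s θ 0 θ) ∧
    (∀ s θ, 0 ≤ s → s ≤ θ → θ ≤ L →
      K.2.2.2 s θ = gramInt (T.submatrix blk2 blk2) Z s θ θ L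
        + gramInt (T.submatrix blk2 blk3) Z s θ s θ
        + gramInt (T.submatrix blk3 blk3) Z s θ 0 s)}

/-- The set `Φ₂`. The kernel `N₁` is only used for `θ ≤ s`, the kernel `N₂` only for `s ≤ θ`. -/
def Phi2 (n : ℕ) (L : ℝ) : Set ((ℝ → Matrix (Fin n) (Fin n) ℝ) ×
    (ℝ → ℝ → Matrix (Fin n) (Fin n) ℝ) × (ℝ → ℝ → Matrix (Fin n) (Fin n) ℝ)) :=
  {K | ∃ (d₁ d₂ : ℕ) (Z₁ : ℝ → Matrix (Fin d₁) (Fin n) ℝ) (Z : ℝ → ℝ → Matrix (Fin d₂) (Fin n) ℝ)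
      (T : Matrix (Fin d₁ ⊕ Fin d₂ ⊕ Fin d₂) (Fin d₁ ⊕ Fin d₂ ⊕ Fin d₂) ℝ),
    (∀ i j, MemLp (fun s => Z₁ s i j) 2 (volume.restrict (Icc 0 L))) ∧
    SqInt2 L Z ∧ T.PosSemidef ∧
    (∀ s ∈ Icc 0 L, K.1 s = (Z₁ s)ᵀ * T.submatrix blk1 blk1 * Z₁ s) ∧
    (∀ s θ, 0 ≤ θ → θ ≤ s → s ≤ L →
      K.2.1 s θ = (Z₁ s)ᵀ * T.submatrix blk1 blk2 * Z s θ
        + (Z θ s)ᵀ * T.submatrix blk3 blk1 * Z₁ θ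
        + gramInt (T.submatrix blk2 blk2) Z s θ s L
        + gramInt (T.submatrix blk3 blk2) Z s θ θ s
        + gramInt (T.submatrix blk3 blk3) Z s θ 0 θ) ∧
    (∀ s θ, 0 ≤ s → s ≤ θ → θ ≤ L → K.2.2 s θ = (K.2.1 θ s)ᵀ)}

/-- The function `s ↦ M(s)` of a matrix-valued polynomial in one variable. -/
def evalM {n : ℕ} (M : Matrix (Fin n) (Fin n) ℝ[X]) (s : ℝ) : Matrix (Fin n) (Fin n) ℝ :=
  M.map (Polynomial.eval s)

/-- The function `(s, θ) ↦ N(s, θ)` of a matrix-valued polynomial in two variables. -/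
def evalN {n : ℕ} (N : Matrix (Fin n) (Fin n) (MvPolynomial (Fin 2) ℝ)) (s θ : ℝ) :
    Matrix (Fin n) (Fin n) ℝ :=
  N.map (MvPolynomial.eval ![s, θ])

end PDEGain

end

/-! The proof is a dissipation argument. Let `P` be the operator with multiplier `M` and with kernel
`N₁` below and `N₂` above the diagonal. The storage functional ⟨x, P x⟩ is symmetric and nonnegative
because of `Phi2`, and it vanishes at time 0. Its rate along a solution is 2⟨x, P x_t⟩. If this rate
is at most a supply rate g(t), with g = γ²|w|² - |y|² for the gain bound and g = 2⟨y, w⟩ for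
passivity, then integration over time gives ∫ g ≥ 0, which is the claim. The integration is
`bilin_primitive` and `integral_supply_nonneg`.

The pointwise inequality is obtained by passing from x, which is tied by boundary conditions, to
x_ss. Taylor's formula expresses u and u_s through u(0), u_s(0) and u_ss. The boundary conditions
then form a linear system with the invertible matrix `B2`, so the two initial values are themselves
linear in u_ss (`initCol_eq`). Hence u = ∫ G u_ss, u_s = ∫ G' u_ss and y = ∫ C₃ u_ss + D₁ w
(`col_eq_mI_G1`, `col_deriv_eq_mI_G2`, `col_output`), and 2⟨x, P x_t⟩ - g becomes a quadratic form
in w and x_ss.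

All kernels of this form come from one object, the kernel κ of G*P (`kap`): the three parts of the
right-hand side contribute κA₂, κA₁G' and κA₀G. Splitting G and G' into the boundary part and the
truncated power (s - η)₊, respectively its derivative, shows that the explicit maps 𝓛₁, 𝓛₂, 𝓛₃ are
these compositions (`calL1_eq`, `calL2_eq`, `calL3_eq`). After symmetrization (`mI_symm_kernel`),
`calL4_form` and `calL5_form` identify the form of 𝓛₄ or 𝓛₅ with 2⟨x, P x_t⟩ - g.

Its sign comes from a factorization T = RᵀR: the form of an element of `Phi1` is ∫ |R(E₁w + ∫ Ψ(β,θ)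
v(θ) dθ)|² dβ, where E₁ embeds the first block and Ψ puts Z into the second or third block according
to the side of the diagonal (`Phi1.form_nonneg`). The same computation with a first component
depending on β treats `Phi2` (`Phi2.form_nonneg`). -/

noncomputable section

namespace PDEGain

/-! ### Entrywise integrals of matrix-valued functions -/

section MatrixIntegral

variable {α β : Type*} [MeasurableSpace α] [MeasurableSpace β] {μ : Measure α} {ν : Measure β}
  {ι κ l : Type}

/-- The entrywise integral of a matrix-valued function. -/
def mI (μ : Measure α) (F : α → Matrix ι κ ℝ) : Matrix ι κ ℝ :=
  Matrix.of fun i j => ∫ x, F x i j ∂μ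

/-- Entrywise integrability of a matrix-valued function. -/
def MIntegrable (μ : Measure α) (F : α → Matrix ι κ ℝ) : Prop :=
  ∀ i j, Integrable (fun x => F x i j) μ

lemma mI_apply (F : α → Matrix ι κ ℝ) (i : ι) (j : κ) : mI μ F i j = ∫ x, F x i j ∂μ := rfl

namespace MIntegrable

variable {F G : α → Matrix ι κ ℝ}

lemma add (hF : MIntegrable μ F) (hG : MIntegrable μ G) : MIntegrable μ fun x => F x + G x :=
  fun i j => (hF i j).add (hG i j)

lemma neg (hF : MIntegrable μ F) : MIntegrable μ fun x => -F x := fun i j => (hF i j).neg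

lemma smul (c : ℝ) (hF : MIntegrable μ F) : MIntegrable μ fun x => c • F x :=
  fun i j => (hF i j).const_mul c

lemma transpose (hF : MIntegrable μ F) : MIntegrable μ fun x => (F x)ᵀ := fun i j => hF j i

lemma congr (hF : MIntegrable μ F) (h : F =ᵐ[μ] G) : MIntegrable μ G :=
  fun i j => (hF i j).congr (h.mono fun _ hx => by simp only [hx])

lemma const [IsFiniteMeasure μ] (C : Matrix ι κ ℝ) : MIntegrable μ fun _ => C :=
  fun _ _ => integrable_const _

lemma mul_left [Fintype ι] (C : Matrix l ι ℝ) (hF : MIntegrable μ F) : MIntegrable μ fun x => C * F x :=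
  fun i j => by
    simp only [Matrix.mul_apply]
    exact integrable_finsetSum _ fun k _ => (hF k j).const_mul _

lemma mul_right [Fintype κ] (C : Matrix κ l ℝ) (hF : MIntegrable μ F) : MIntegrable μ fun x => F x * C :=
  fun i j => by
    simp only [Matrix.mul_apply]
    exact integrable_finsetSum _ fun k _ => (hF i k).mul_const _

lemma mI_right [SFinite μ] [SFinite ν] {F : α → β → Matrix ι κ ℝ}
    (hF : MIntegrable (μ.prod ν) fun p => F p.1 p.2) :
    MIntegrable μ fun x => mI ν fun y => F x y :=
  fun i j => (hF i j).integral_prod_left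

lemma mI_left [SFinite μ] [SFinite ν] {F : α → β → Matrix ι κ ℝ}
    (hF : MIntegrable (μ.prod ν) fun p => F p.1 p.2) :
    MIntegrable ν fun y => mI μ fun x => F x y :=
  fun i j => (hF i j).integral_prod_right

end MIntegrable

lemma mI_congr_ae {F G : α → Matrix ι κ ℝ} (h : F =ᵐ[μ] G) : mI μ F = mI μ G := by
  ext i j
  exact integral_congr_ae (h.mono fun _ hx => by simp only [hx])

lemma mI_add {F G : α → Matrix ι κ ℝ} (hF : MIntegrable μ F) (hG : MIntegrable μ G) :
    mI μ (fun x => F x + G x) = mI μ F + mI μ G := by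
  ext i j
  exact integral_add (hF i j) (hG i j)

lemma mI_neg (F : α → Matrix ι κ ℝ) : mI μ (fun x => -F x) = -mI μ F := by
  ext i j
  exact integral_neg _

lemma mI_smul (c : ℝ) (F : α → Matrix ι κ ℝ) : mI μ (fun x => c • F x) = c • mI μ F := by
  ext i j
  exact integral_const_mul c _

lemma mI_transpose (F : α → Matrix ι κ ℝ) : mI μ (fun x => (F x)ᵀ) = (mI μ F)ᵀ := rfl

lemma mI_zero : mI μ (fun _ => (0 : Matrix ι κ ℝ)) = 0 := by
  ext i j
  simp [mI_apply]

lemma mI_mul_left [Fintype ι] (C : Matrix l ι ℝ) {F : α → Matrix ι κ ℝ} (hF : MIntegrable μ F) :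
    mI μ (fun x => C * F x) = C * mI μ F := by
  ext i j
  simp only [mI_apply, Matrix.mul_apply]
  rw [integral_finsetSum _ fun k _ => (hF k j).const_mul _]
  simp only [integral_const_mul]

lemma mI_mul_right [Fintype κ] (C : Matrix κ l ℝ) {F : α → Matrix ι κ ℝ} (hF : MIntegrable μ F) :
    mI μ (fun x => F x * C) = mI μ F * C := by
  ext i j
  simp only [mI_apply, Matrix.mul_apply]
  rw [integral_finsetSum _ fun k _ => (hF i k).mul_const _]
  simp only [integral_mul_const]

/-- Fubini's theorem for entrywise integrals. -/
lemma mI_swap [SFinite μ] [SFinite ν] {F : α → β → Matrix ι κ ℝ}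
    (hF : MIntegrable (μ.prod ν) fun p => F p.1 p.2) :
    mI μ (fun x => mI ν fun y => F x y) = mI ν fun y => mI μ fun x => F x y := by
  ext i j
  exact integral_integral_swap (hF i j)

end MatrixIntegral

/-! ### Bounded kernels on a square -/

/-- Lebesgue measure on `[0, L]`. -/
abbrev segMeasure (L : ℝ) : Measure ℝ := volume.restrict (Icc 0 L)

/-- Joint measurability together with boundedness on `[0, L]²`. -/
def BddMeas (L : ℝ) (k : ℝ → ℝ → ℝ) : Prop :=
  Measurable (fun p : ℝ × ℝ => k p.1 p.2) ∧
    ∃ C, ∀ s ∈ Icc 0 L, ∀ θ ∈ Icc 0 L, |k s θ| ≤ C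

lemma ae_prod_mem (L : ℝ) :
    ∀ᵐ p ∂((segMeasure L).prod (segMeasure L)), p ∈ Icc 0 L ×ˢ Icc 0 L := by
  rw [Measure.prod_restrict]
  exact ae_restrict_mem (measurableSet_Icc.prod measurableSet_Icc)

namespace BddMeas

variable {L : ℝ} {k k' : ℝ → ℝ → ℝ}

lemma add (hk : BddMeas L k) (hk' : BddMeas L k') : BddMeas L fun s θ => k s θ + k' s θ := by
  obtain ⟨hm, C, hC⟩ := hk
  obtain ⟨hm', C', hC'⟩ := hk'
  exact ⟨hm.add hm', C + C', fun s hs θ hθ =>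
    (abs_add_le _ _).trans (add_le_add (hC s hs θ hθ) (hC' s hs θ hθ))⟩

lemma mul (hk : BddMeas L k) (hk' : BddMeas L k') : BddMeas L fun s θ => k s θ * k' s θ := by
  obtain ⟨hm, C, hC⟩ := hk
  obtain ⟨hm', C', hC'⟩ := hk'
  refine ⟨hm.mul hm', C * C', fun s hs θ hθ => ?_⟩
  rw [abs_mul]
  exact mul_le_mul (hC s hs θ hθ) (hC' s hs θ hθ) (abs_nonneg _)
    ((abs_nonneg _).trans (hC s hs θ hθ))

lemma const (c : ℝ) : BddMeas L fun _ _ => c :=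
  ⟨measurable_const, |c|, fun _ _ _ _ => le_rfl⟩

lemma sum {ι : Type*} (t : Finset ι) {f : ι → ℝ → ℝ → ℝ} (h : ∀ i ∈ t, BddMeas L (f i)) :
    BddMeas L fun s θ => ∑ i ∈ t, f i s θ := by
  classical
  induction t using Finset.induction_on with
  | empty => simpa using const 0
  | insert a t ha ih =>
    simp only [Finset.sum_insert ha]
    exact (h a (by simp)).add (ih fun i hi => h i (by simp [hi]))

lemma flip (hk : BddMeas L k) : BddMeas L fun s θ => k θ s :=
  ⟨hk.1.comp measurable_swap, hk.2.imp fun _ hC s hs θ hθ => hC θ hθ s hs⟩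

lemma of_continuous (h : Continuous fun p : ℝ × ℝ => k p.1 p.2) : BddMeas L k := by
  refine ⟨h.measurable, ?_⟩
  obtain ⟨C, hC⟩ := (isCompact_Icc.prod isCompact_Icc : IsCompact (Icc 0 L ×ˢ Icc 0 L)
    ).exists_bound_of_continuousOn h.continuousOn
  exact ⟨C, fun s hs θ hθ => hC (s, θ) ⟨hs, hθ⟩⟩

lemma ite {P : ℝ → ℝ → Prop} [∀ s θ, Decidable (P s θ)]
    (hP : MeasurableSet {p : ℝ × ℝ | P p.1 p.2}) (hk : BddMeas L k) (hk' : BddMeas L k') :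
    BddMeas L fun s θ => if P s θ then k s θ else k' s θ := by
  obtain ⟨hm, C, hC⟩ := hk
  obtain ⟨hm', C', hC'⟩ := hk'
  refine ⟨hm.ite hP hm', max C C', fun s hs θ hθ => ?_⟩
  beta_reduce
  split_ifs
  · exact (hC s hs θ hθ).trans (le_max_left _ _)
  · exact (hC' s hs θ hθ).trans (le_max_right _ _)

lemma mul_integrable_prod (hk : BddMeas L k) {f : ℝ × ℝ → ℝ}
    (hf : Integrable f ((segMeasure L).prod (segMeasure L))) :
    Integrable (fun p => k p.1 p.2 * f p) ((segMeasure L).prod (segMeasure L)) := by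
  obtain ⟨hm, C, hC⟩ := hk
  refine hf.bdd_mul (c := C) hm.aestronglyMeasurable ?_
  filter_upwards [ae_prod_mem L] with p hp using hC _ hp.1 _ hp.2

lemma mul_integrable (hk : BddMeas L k) {s : ℝ} (hs : s ∈ Icc 0 L) {f : ℝ → ℝ}
    (hf : Integrable f (segMeasure L)) :
    Integrable (fun θ => k s θ * f θ) (segMeasure L) := by
  obtain ⟨hm, C, hC⟩ := hk
  refine hf.bdd_mul (c := C) (hm.comp measurable_prodMk_left).aestronglyMeasurable ?_
  filter_upwards [ae_restrict_mem measurableSet_Icc] with p hp using hC _ hs _ hp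

lemma comp (hk : BddMeas L k) (hk' : BddMeas L k') :
    BddMeas L fun s θ => ∫ η, k s η * k' η θ ∂(segMeasure L) := by
  obtain ⟨hm, C, hC⟩ := hk
  obtain ⟨hm', C', hC'⟩ := hk'
  constructor
  · have : Measurable fun p : (ℝ × ℝ) × ℝ => k p.1.1 p.2 * k' p.2 p.1.2 :=
      (hm.comp ((measurable_fst.comp measurable_fst).prodMk measurable_snd)).mul
        (hm'.comp (measurable_snd.prodMk (measurable_snd.comp measurable_fst)))
    exact (this.stronglyMeasurable.integral_prod_right' (ν := segMeasure L)).measurable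
  · refine ⟨C * C' * (segMeasure L).real univ, fun s hs θ hθ => ?_⟩
    refine (norm_integral_le_of_norm_le_const (μ := segMeasure L)
      (f := fun η => k s η * k' η θ) ?_)
    filter_upwards [ae_restrict_mem measurableSet_Icc] with η hη
    rw [norm_mul]
    exact mul_le_mul (hC s hs η hη) (hC' η hη θ hθ) (norm_nonneg _)
      ((abs_nonneg _).trans (hC s hs η hη))

end BddMeas

/-- A matrix-valued kernel whose entries are measurable and bounded on `[0, L]²`. -/
def BddKernel {ι κ : Type} (L : ℝ) (K : ℝ → ℝ → Matrix ι κ ℝ) : Prop :=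
  ∀ i j, BddMeas L fun s θ => K s θ i j

namespace BddKernel

variable {ι κ l r : Type} {L : ℝ} {K K' : ℝ → ℝ → Matrix ι κ ℝ}

lemma add (hK : BddKernel L K) (hK' : BddKernel L K') : BddKernel L fun s θ => K s θ + K' s θ :=
  fun i j => (hK i j).add (hK' i j)

lemma transpose (hK : BddKernel L K) : BddKernel L fun s θ => (K s θ)ᵀ := fun i j => hK j i

lemma flip (hK : BddKernel L K) : BddKernel L fun s θ => K θ s := fun i j => (hK i j).flip

lemma const (C : Matrix ι κ ℝ) : BddKernel L fun _ _ => C := fun _ _ => .const _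

lemma smul {k : ℝ → ℝ → ℝ} (hk : BddMeas L k) (hK : BddKernel L K) :
    BddKernel L fun s θ => k s θ • K s θ := fun i j => hk.mul (hK i j)

lemma mul [Fintype κ] {K' : ℝ → ℝ → Matrix κ l ℝ} (hK : BddKernel L K) (hK' : BddKernel L K') :
    BddKernel L fun s θ => K s θ * K' s θ := fun i j => by
  simp only [Matrix.mul_apply]
  exact .sum _ fun k _ => (hK i k).mul (hK' k j)

lemma of_continuous (h : Continuous fun p : ℝ × ℝ => K p.1 p.2) : BddKernel L K :=
  fun i j => .of_continuous (h.matrix_elem i j)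

lemma ite {P : ℝ → ℝ → Prop} [∀ s θ, Decidable (P s θ)]
    (hP : MeasurableSet {p : ℝ × ℝ | P p.1 p.2}) (hK : BddKernel L K) (hK' : BddKernel L K') :
    BddKernel L fun s θ => if P s θ then K s θ else K' s θ := fun i j => by
  have h := (hK i j).ite hP (hK' i j)
  have e (s θ : ℝ) : (if P s θ then K s θ else K' s θ) i j
      = if P s θ then K s θ i j else K' s θ i j := by
    split_ifs <;> rfl
  simpa only [e] using h

lemma mul_mIntegrable [Fintype κ] (hK : BddKernel L K) {s : ℝ} (hs : s ∈ Icc 0 L)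
    {B : ℝ → Matrix κ l ℝ} (hB : MIntegrable (segMeasure L) B) :
    MIntegrable (segMeasure L) fun θ => K s θ * B θ := fun i j => by
  simp only [Matrix.mul_apply]
  exact integrable_finsetSum _ fun k _ => (hK i k).mul_integrable hs (hB k j)

lemma mIntegrable (hK : BddKernel L K) {s : ℝ} (hs : s ∈ Icc 0 L) :
    MIntegrable (segMeasure L) fun θ => K s θ := fun i j => by
  simpa using (hK i j).mul_integrable hs (integrable_const (1 : ℝ))

lemma mul_mul_mIntegrable_prod [Fintype ι] [Fintype κ] (hK : BddKernel L K)
    {A : ℝ → Matrix r ι ℝ} (hA : MIntegrable (segMeasure L) A)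
    {B : ℝ → Matrix κ l ℝ} (hB : MIntegrable (segMeasure L) B) :
    MIntegrable ((segMeasure L).prod (segMeasure L)) fun p => A p.1 * K p.1 p.2 * B p.2 :=
  fun i j => by
    simp only [Matrix.mul_apply, Finset.sum_mul]
    refine integrable_finsetSum _ fun k _ => integrable_finsetSum _ fun k' _ => ?_
    refine ((hK k' k).mul_integrable_prod ((hA i k').mul_prod (hB k j))).congr
      (.of_forall fun p => ?_)
    simp only
    ring

lemma mul_mIntegrable_prod [Fintype κ] (hK : BddKernel L K)
    {B : ℝ → Matrix κ l ℝ} (hB : MIntegrable (segMeasure L) B) :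
    MIntegrable ((segMeasure L).prod (segMeasure L)) fun p => K p.1 p.2 * B p.2 :=
  fun i j => by
    simp only [Matrix.mul_apply]
    refine integrable_finsetSum _ fun k _ => ?_
    exact (hK i k).mul_integrable_prod ((hB k j).comp_snd _)

lemma comp [Fintype κ] {K' : ℝ → ℝ → Matrix κ l ℝ} (hK : BddKernel L K) (hK' : BddKernel L K') :
    BddKernel L fun s θ => mI (segMeasure L) fun η => K s η * K' η θ := fun i j => by
  have h : BddMeas L fun s θ => ∑ k, ∫ η, K s η i k * K' η θ k j ∂(segMeasure L) :=
    .sum _ fun k _ => (hK i k).comp (hK' k j)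
  have hsec (s θ : ℝ) (hs : s ∈ Icc 0 L) (hθ : θ ∈ Icc 0 L) :
      (mI (segMeasure L) fun η => K s η * K' η θ) i j
        = ∑ k, ∫ η, K s η i k * K' η θ k j ∂(segMeasure L) := by
    simp only [mI_apply, Matrix.mul_apply]
    refine integral_finsetSum _ fun k _ => (hK i k).mul_integrable hs ?_
    simpa using (hK' k j).flip.mul_integrable hθ (integrable_const (1 : ℝ))
  refine ⟨?_, h.2.imp fun C hC s hs θ hθ => (congrArg abs (hsec s θ hs hθ)).trans_le (hC s hs θ hθ)⟩
  -- Off the square the entries may fail to be integrable, so sum and integral need not commute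
  -- there; global measurability is therefore proved for the integral of the sum itself.
  have hm : Measurable fun p : (ℝ × ℝ) × ℝ => (K p.1.1 p.2 * K' p.2 p.1.2) i j := by
    simp only [Matrix.mul_apply]
    exact Finset.measurable_fun_sum _ fun k _ =>
      ((hK i k).1.comp ((measurable_fst.comp measurable_fst).prodMk measurable_snd)).mul
        ((hK' k j).1.comp (measurable_snd.prodMk (measurable_snd.comp measurable_fst)))
  exact (hm.stronglyMeasurable.integral_prod_right' (ν := segMeasure L)).measurable

end BddKernel

/-! ### Interval integrals as integrals over `[0, L]` -/

section IntervalIntegral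

variable {ι κ : Type} {L : ℝ}

lemma mInt_eq_indicator {a b : ℝ} (ha : 0 ≤ a) (hab : a ≤ b) (hb : b ≤ L)
    (F : ℝ → Matrix ι κ ℝ) :
    mInt a b F = mI (segMeasure L) ((Ioc a b).indicator F) := by
  ext i j
  have h (x : ℝ) : (Ioc a b).indicator F x i j = (Ioc a b).indicator (fun x => F x i j) x := by
    by_cases hx : x ∈ Ioc a b <;> simp [hx]
  simp only [mI_apply, mInt, Matrix.of_apply, h]
  rw [intervalIntegral.integral_of_le hab, integral_indicator measurableSet_Ioc,
    Measure.restrict_restrict measurableSet_Ioc, inter_eq_self_of_subset_left]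
  exact fun x hx => ⟨ha.trans hx.1.le, hx.2.trans hb⟩

lemma mInt_eq_mI (hL : 0 ≤ L) (F : ℝ → Matrix ι κ ℝ) : mInt 0 L F = mI (segMeasure L) F := by
  ext i j
  simp only [mI_apply, mInt, Matrix.of_apply]
  rw [intervalIntegral.integral_of_le hL, restrict_Ioc_eq_restrict_Icc]

/-- An interval integral agrees with the integral over `[0, L]` of any function which equals the
integrand on the interval and vanishes elsewhere. -/
lemma mInt_eq_mI_of {a b : ℝ} (ha : 0 ≤ a) (hab : a ≤ b) (hb : b ≤ L) {F G : ℝ → Matrix ι κ ℝ}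
    (h : ∀ x ∈ Icc 0 L, x ≠ a → x ≠ b → G x = if a < x ∧ x ≤ b then F x else 0) :
    mInt a b F = mI (segMeasure L) G := by
  rw [mInt_eq_indicator ha hab hb]
  refine mI_congr_ae ?_
  have hne (c : ℝ) : ∀ᵐ x ∂(segMeasure L), x ≠ c :=
    ae_restrict_of_ae (Measure.ae_ne volume c)
  filter_upwards [ae_restrict_mem measurableSet_Icc, hne a, hne b] with x hx hxa hxb
  rw [h x hx hxa hxb, indicator_apply]
  rfl

end IntervalIntegral

/-! ### Heaviside factors and kernels given by separate formulas on the two triangles. -/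

section

variable {ι κ : Type} {L : ℝ}

lemma mInt_congr_Ioo {a b : ℝ} (hab : a ≤ b) {F G : ℝ → Matrix ι κ ℝ}
    (h : ∀ x ∈ Ioo a b, F x = G x) : mInt a b F = mInt a b G := by
  ext i j
  simp only [mInt, Matrix.of_apply]
  rw [intervalIntegral.integral_of_le hab, intervalIntegral.integral_of_le hab,
    integral_Ioc_eq_integral_Ioo, integral_Ioc_eq_integral_Ioo]
  exact setIntegral_congr_fun measurableSet_Ioo fun x hx => by simp only [h x hx]

lemma MIntegrable.intervalIntegrable {F : ℝ → Matrix ι κ ℝ} (hF : MIntegrable (segMeasure L) F)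
    {a b : ℝ} (ha : a ∈ Icc 0 L) (hb : b ∈ Icc 0 L) (i : ι) (j : κ) :
    IntervalIntegrable (fun x => F x i j) volume a b := by
  have h : IntegrableOn (fun x => F x i j) (Icc 0 L) volume := hF i j
  exact (h.mono_set (uIcc_subset_Icc ha hb)).intervalIntegrable

lemma mI_eq_mInt_add {F : ℝ → Matrix ι κ ℝ} (hF : MIntegrable (segMeasure L) F) {c : ℝ}
    (hc : c ∈ Icc 0 L) : mI (segMeasure L) F = mInt c L F + mInt 0 c F := by
  have h0 : (0 : ℝ) ∈ Icc 0 L := ⟨le_rfl, hc.1.trans hc.2⟩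
  have hL : L ∈ Icc 0 L := ⟨hc.1.trans hc.2, le_rfl⟩
  rw [← mInt_eq_mI (hc.1.trans hc.2), add_comm]
  ext i j
  exact (intervalIntegral.integral_add_adjacent_intervals (hF.intervalIntegrable h0 hc i j)
    (hF.intervalIntegrable hc hL i j)).symm

lemma MIntegrable.bdd_smul {k : ℝ → ℝ} (hk : BddMeas L fun _ η => k η) (hL : 0 ≤ L)
    {F : ℝ → Matrix ι κ ℝ} (hF : MIntegrable (segMeasure L) F) :
    MIntegrable (segMeasure L) fun η => k η • F η :=
  fun i j => hk.mul_integrable (s := 0) ⟨le_rfl, hL⟩ (hF i j)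

lemma measurable_heav : Measurable heav :=
  Measurable.ite measurableSet_Ici measurable_const measurable_const

lemma abs_heav_le (r : ℝ) : |heav r| ≤ 1 := by
  unfold heav
  split_ifs <;> simp

lemma bddMeas_heav : BddMeas L fun s θ => heav (s - θ) :=
  ⟨measurable_heav.comp (measurable_fst.sub measurable_snd), 1, fun _ _ _ _ => abs_heav_le _⟩

lemma bddMeas_sub : BddMeas L fun s θ => s - θ :=
  .of_continuous (continuous_fst.sub continuous_snd)

/-- The kernel which is `N₁` below the diagonal and `N₂` above it. -/
def joinKernel (N₁ N₂ : ℝ → ℝ → Matrix ι κ ℝ) (s θ : ℝ) : Matrix ι κ ℝ :=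
  if θ ≤ s then N₁ s θ else N₂ s θ

lemma BddKernel.join {N₁ N₂ : ℝ → ℝ → Matrix ι κ ℝ} (h₁ : BddKernel L N₁) (h₂ : BddKernel L N₂) :
    BddKernel L (joinKernel N₁ N₂) :=
  .ite (measurableSet_le measurable_snd measurable_fst) h₁ h₂

/-- An integral over `[0, L]` of a function defined by different formulas on both sides of `c`. -/
lemma mInt_add_mInt_eq_mI {F F₁ F₂ : ℝ → Matrix ι κ ℝ} (hF : MIntegrable (segMeasure L) F) {c : ℝ}
    (hc : c ∈ Icc 0 L) (h₁ : ∀ x, c ≤ x → F x = F₁ x) (h₂ : ∀ x, x < c → F x = F₂ x) :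
    mInt c L F₁ + mInt 0 c F₂ = mI (segMeasure L) F := by
  rw [mI_eq_mInt_add hF hc, mInt_congr_Ioo hc.2 fun x hx => h₁ x hx.1.le,
    mInt_congr_Ioo hc.1 fun x hx => h₂ x hx.2]

end

/-! ### Composition with a primitive on the left -/

section LeftKernel

variable {ι κ l r : Type} [Fintype ι] {L : ℝ} {g g' : ℝ → ℝ → Matrix ι r ℝ}
  {M : ℝ → Matrix ι κ ℝ} {N : ℝ → ℝ → Matrix ι κ ℝ}

/-- The kernel of `G* P`, where `G` has kernel `g` and `P f = M f + ∫ N(·,θ) f(θ) dθ`. -/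
def leftKernel (L : ℝ) (g : ℝ → ℝ → Matrix ι r ℝ) (M : ℝ → Matrix ι κ ℝ)
    (N : ℝ → ℝ → Matrix ι κ ℝ) (s η : ℝ) : Matrix r κ ℝ :=
  (g η s)ᵀ * M η + mI (segMeasure L) fun ζ => (g ζ s)ᵀ * N ζ η

lemma BddKernel.leftKernel (hg : BddKernel L g) (hM : BddKernel L fun _ η => M η)
    (hN : BddKernel L N) : BddKernel L (leftKernel L g M N) :=
  (hg.flip.transpose.mul hM).add (hg.flip.transpose.comp hN)

lemma leftKernel_add (hg : BddKernel L g) (hg' : BddKernel L g') (hN : BddKernel L N) {s η : ℝ}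
    (hs : s ∈ Icc 0 L) (hη : η ∈ Icc 0 L) :
    leftKernel L (fun ζ s => g ζ s + g' ζ s) M N s η
      = leftKernel L g M N s η + leftKernel L g' M N s η := by
  have h := mI_add (hg.flip.transpose.mul_mIntegrable hs (hN.flip.mIntegrable hη))
    (hg'.flip.transpose.mul_mIntegrable hs (hN.flip.mIntegrable hη))
  simp only [leftKernel, Matrix.transpose_add, Matrix.add_mul, h]
  abel

/-- This is associativity, (G*P)B = G*(PB); its analytic content is Fubini's theorem for g(ζ,s)ᵀ
N(ζ,η) B(η). -/
lemma mI_leftKernel_mul [Fintype κ] (hg : BddKernel L g)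
    (hM : BddKernel L fun _ η => M η) (hN : BddKernel L N) {B : ℝ → Matrix κ l ℝ}
    (hB : MIntegrable (segMeasure L) B) {s : ℝ} (hs : s ∈ Icc 0 L) :
    mI (segMeasure L) (fun η => leftKernel L g M N s η * B η)
      = mI (segMeasure L) fun ζ =>
        (g ζ s)ᵀ * (M ζ * B ζ + mI (segMeasure L) fun η => N ζ η * B η) := by
  -- With `s` frozen, the left factor is a kernel constant in its second variable, so its product
  -- with `N` is again a bounded kernel.
  have hgs : BddKernel L fun ζ _ => (g ζ s)ᵀ := fun i j =>
    ⟨((hg j i).1.comp (measurable_id.prodMk measurable_const)).comp measurable_fst,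
      (hg j i).2.imp fun C hC ζ hζ _ _ => hC ζ hζ s hs⟩
  have hprod : MIntegrable ((segMeasure L).prod (segMeasure L))
      fun p => (g p.1 s)ᵀ * N p.1 p.2 * B p.2 :=
    (hgs.mul hN).mul_mIntegrable_prod hB
  have hMB : MIntegrable (segMeasure L) fun ζ => (g ζ s)ᵀ * (M ζ * B ζ) :=
    hgs.flip.mul_mIntegrable hs (hM.mul_mIntegrable hs hB)
  have hNB : ∀ ζ ∈ Icc 0 L, MIntegrable (segMeasure L) fun η => N ζ η * B η :=
    fun ζ hζ => hN.mul_mIntegrable hζ hB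
  have e1 : mI (segMeasure L) (fun η => leftKernel L g M N s η * B η)
      = mI (segMeasure L) fun η => (g η s)ᵀ * (M η * B η)
        + mI (segMeasure L) fun ζ => (g ζ s)ᵀ * N ζ η * B η := by
    refine mI_congr_ae ?_
    filter_upwards [ae_restrict_mem measurableSet_Icc] with η hη
    rw [leftKernel, Matrix.add_mul, Matrix.mul_assoc,
      mI_mul_right _ (hgs.flip.mul_mIntegrable hs (hN.flip.mIntegrable hη))]
  have e2 : mI (segMeasure L) (fun ζ =>
        (g ζ s)ᵀ * (M ζ * B ζ + mI (segMeasure L) fun η => N ζ η * B η))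
      = mI (segMeasure L) fun ζ => (g ζ s)ᵀ * (M ζ * B ζ)
        + mI (segMeasure L) fun η => (g ζ s)ᵀ * N ζ η * B η := by
    refine mI_congr_ae ?_
    filter_upwards [ae_restrict_mem measurableSet_Icc] with ζ hζ
    simp only [Matrix.mul_add, Matrix.mul_assoc, mI_mul_left _ (hNB ζ hζ)]
  rw [e1, e2, mI_add hMB hprod.mI_left, mI_add hMB hprod.mI_right, ← mI_swap hprod]

end LeftKernel

/-! ### Composition of the kernels `(s - θ)₊` with an operator `P` on both sides -/

section PosKernel

variable {n : ℕ} {L : ℝ} {M A : ℝ → Matrix (Fin n) (Fin n) ℝ}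
  {N₁ N₂ : ℝ → ℝ → Matrix (Fin n) (Fin n) ℝ}

/-- The kernel `(s - θ)₊ I`. -/
def posKernel (n : ℕ) (s θ : ℝ) : Matrix (Fin n) (Fin n) ℝ := (heav (s - θ) * (s - θ)) • 1

lemma posKernel_of_le {s θ : ℝ} (h : θ ≤ s) : posKernel n s θ = (s - θ) • 1 := by
  simp [posKernel, heav, h]

lemma posKernel_of_ge {s θ : ℝ} (h : s ≤ θ) : posKernel n s θ = 0 := by
  rcases h.lt_or_eq with h | h <;> simp [posKernel, heav, h]

lemma bddKernel_posKernel : BddKernel L (posKernel n) :=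
  .smul (bddMeas_heav.mul bddMeas_sub) (.const 1)

lemma mInt_sub_smul {s : ℝ} (hs : s ∈ Icc 0 L) (X : ℝ → Matrix (Fin n) (Fin n) ℝ) :
    mInt s L (fun ζ => (ζ - s) • X ζ) = mI (segMeasure L) fun ζ => (posKernel n ζ s)ᵀ * X ζ := by
  refine mInt_eq_mI_of hs.1 hs.2 le_rfl fun x hx hxs _ => ?_
  rcases lt_or_gt_of_ne hxs with h | h
  · simp [posKernel_of_ge h.le, not_lt.2 h.le]
  · simp [posKernel_of_le h.le, h, hx.2]

/-- The weight (ζ - s)₊ kills the multiplier term and leaves only ζ ≥ s ≥ θ, where the joined kernel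
is `N₁`. This is the term `E1`. -/
lemma leftKernel_posKernel_mul_of_le (hN₁ : BddKernel L N₁) (hN₂ : BddKernel L N₂) {s θ : ℝ}
    (hs : s ∈ Icc 0 L) (hθ : θ ∈ Icc 0 L) (h : θ ≤ s) :
    leftKernel L (posKernel n) M (joinKernel N₁ N₂) s θ * A θ
      = mInt s L fun η => (η - s) • (N₁ η θ * A θ) := by
  rw [leftKernel, posKernel_of_ge h, Matrix.transpose_zero, Matrix.zero_mul, zero_add,
    ← mI_mul_right _ (bddKernel_posKernel.flip.transpose.mul_mIntegrable hs
      ((hN₁.join hN₂).flip.mIntegrable hθ)), mInt_sub_smul hs]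
  congr 1
  funext ζ
  rcases lt_or_ge ζ s with hζ | hζ
  · simp [posKernel_of_ge hζ.le]
  · simp [joinKernel, h.trans hζ, Matrix.mul_assoc]

/-- Now the diagonal point θ lies in the range ζ ≥ s of the weight, so all three parts of `P`
contribute. This is the term `E2`. -/
lemma leftKernel_posKernel_mul_of_ge (hN₁ : BddKernel L N₁) (hN₂ : BddKernel L N₂) {s θ : ℝ}
    (hs : s ∈ Icc 0 L) (hθ : θ ∈ Icc 0 L) (h : s ≤ θ) :
    leftKernel L (posKernel n) M (joinKernel N₁ N₂) s θ * A θ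
      = (θ - s) • (M θ * A θ) + mInt θ L (fun η => (η - s) • (N₁ η θ * A θ))
        + mInt s θ (fun η => (η - s) • (N₂ η θ * A θ)) := by
  have hint : MIntegrable (segMeasure L)
      fun ζ => (posKernel n ζ s)ᵀ * joinKernel N₁ N₂ ζ θ * A θ :=
    (bddKernel_posKernel.flip.transpose.mul_mIntegrable hs
      ((hN₁.join hN₂).flip.mIntegrable hθ)).mul_right _
  have e : mInt 0 θ (fun ζ => if s ≤ ζ then (ζ - s) • (N₂ ζ θ * A θ) else 0)
      = mInt s θ (fun η => (η - s) • (N₂ η θ * A θ)) := by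
    rw [mInt_eq_indicator le_rfl hθ.1 hθ.2]
    refine (mInt_eq_mI_of hs.1 h hθ.2 fun x hx hxs _ => ?_).symm
    by_cases hxθ : x ≤ θ
    · rcases lt_or_gt_of_ne hxs with h' | h'
      · simp [h', not_lt.2 h'.le, ]
      · have : 0 < x := hs.1.trans_lt h'
        simp [h', h'.le, this, hxθ]
    · simp [hxθ]
  rw [leftKernel, posKernel_of_le h, Matrix.add_mul,
    ← mI_mul_right _ (bddKernel_posKernel.flip.transpose.mul_mIntegrable hs
      ((hN₁.join hN₂).flip.mIntegrable hθ)), ← e, add_assoc]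
  congr 1
  · simp
  · refine (mInt_add_mInt_eq_mI hint hθ (fun x hx => ?_) fun x hx => ?_).symm
    · simp [joinKernel, hx, posKernel_of_le (h.trans hx)]
    · rcases le_total s x with hsx | hsx
      · simp [joinKernel, hx, posKernel_of_le hsx, hsx]
      · rcases hsx.lt_or_eq with hsx | rfl
        · simp [posKernel_of_ge hsx.le, not_le.2 hsx]
        · simp [posKernel_of_ge]

/-- Composition of `P` with `(s - θ)₊` on the left and with `𝓘(η - θ) ρ(η)` on the right. -/
lemma mI_heav_smul_leftKernel_posKernel (hM : BddKernel L fun _ η => M η)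
    (hN₁ : BddKernel L N₁) (hN₂ : BddKernel L N₂) (hA : MIntegrable (segMeasure L) A)
    {ρ : ℝ → ℝ} (hρ : Continuous ρ) {s θ : ℝ} (hs : s ∈ Icc 0 L) (hθ : θ ∈ Icc 0 L) :
    (mI (segMeasure L) fun η => (heav (η - θ) * ρ η) •
        (leftKernel L (posKernel n) M (joinKernel N₁ N₂) s η * A η))
      = mInt (max s θ) L fun η =>
        (η - s) • (ρ η • (M η * A η) + mInt θ η fun ζ => ρ ζ • (N₁ η ζ * A ζ))
          + mInt s η fun ζ => ((ζ - s) * ρ η) • (N₂ ζ η * A η) := by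
  have hL : 0 ≤ L := hs.1.trans hs.2
  have hk : BddMeas L fun _ η => heav (η - θ) * ρ η :=
    .mul ⟨measurable_heav.comp (measurable_snd.sub_const θ), 1, fun _ _ _ _ => abs_heav_le _⟩
      (.of_continuous (hρ.comp continuous_snd))
  -- The right-hand factor is absorbed into `A`, so that associativity applies to it.
  set B : ℝ → Matrix (Fin n) (Fin n) ℝ := fun η => (heav (η - θ) * ρ η) • A η with hBdef
  have hB : MIntegrable (segMeasure L) B := hA.bdd_smul hk hL
  have hN := hN₁.join hN₂
  have hpos : BddKernel L (posKernel n) := bddKernel_posKernel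
  have hP₁ : BddKernel L fun ζ η => if η ≤ ζ then N₁ ζ η else 0 :=
    .ite (measurableSet_le measurable_snd measurable_fst) hN₁ (.const 0)
  have hP₂ : BddKernel L fun ζ η => if η ≤ ζ then 0 else N₂ ζ η :=
    .ite (measurableSet_le measurable_snd measurable_fst) (.const 0) hN₂
  have hps : BddKernel L fun ζ _ => (posKernel n ζ s)ᵀ := fun i j =>
    ⟨((hpos j i).1.comp (measurable_id.prodMk measurable_const)).comp measurable_fst,
      (hpos j i).2.imp fun C hC ζ hζ _ _ => hC ζ hζ s hs⟩
  have hI₁ : MIntegrable ((segMeasure L).prod (segMeasure L)) fun p =>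
      (posKernel n p.1 s)ᵀ * (if p.2 ≤ p.1 then N₁ p.1 p.2 else 0) * B p.2 :=
    (hps.mul hP₁).mul_mIntegrable_prod hB
  have hI₂ : MIntegrable ((segMeasure L).prod (segMeasure L)) fun p =>
      (posKernel n p.1 s)ᵀ * (if p.2 ≤ p.1 then 0 else N₂ p.1 p.2) * B p.2 :=
    (hps.mul hP₂).mul_mIntegrable_prod hB
  have hI₀ : MIntegrable (segMeasure L) fun ζ => (posKernel n ζ s)ᵀ * (M ζ * B ζ) :=
    hps.flip.mul_mIntegrable hs (hM.mul_mIntegrable hs hB)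
  have e1 : (mI (segMeasure L) fun η => (heav (η - θ) * ρ η) •
        (leftKernel L (posKernel n) M (joinKernel N₁ N₂) s η * A η))
      = mI (segMeasure L) fun ζ => (posKernel n ζ s)ᵀ * (M ζ * B ζ)
        + (mI (segMeasure L) fun η =>
            (posKernel n ζ s)ᵀ * (if η ≤ ζ then N₁ ζ η else 0) * B η)
        + mI (segMeasure L) fun η =>
            (posKernel n ζ s)ᵀ * (if η ≤ ζ then 0 else N₂ ζ η) * B η := by
    simp only [← Matrix.mul_smul]
    rw [mI_leftKernel_mul hpos hM hN hB hs]
    refine mI_congr_ae ?_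
    filter_upwards [ae_restrict_mem measurableSet_Icc] with ζ hζ
    have e : (fun η => joinKernel N₁ N₂ ζ η * B η) = fun η =>
        (if η ≤ ζ then N₁ ζ η else 0) * B η + (if η ≤ ζ then 0 else N₂ ζ η) * B η := by
      funext η
      by_cases h : η ≤ ζ <;> simp [joinKernel, h]
    rw [e, mI_add (hP₁.mul_mIntegrable hζ hB) (hP₂.mul_mIntegrable hζ hB)]
    simp only [Matrix.mul_add, Matrix.mul_assoc]
    rw [mI_mul_left _ (hP₁.mul_mIntegrable hζ hB), mI_mul_left _ (hP₂.mul_mIntegrable hζ hB)]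
    abel
  -- Only the `N₂` term changes its order of integration. Then the outer variable is the larger of
  -- the two in both triangles, as in the definitions of `F4`, `F5`, `G4`, `G5`.
  rw [e1, mI_add (hI₀.add hI₁.mI_right) hI₂.mI_right, mI_swap hI₂,
    ← mI_add (hI₀.add hI₁.mI_right) hI₂.mI_left]
  refine (mInt_eq_mI_of (hs.1.trans (le_max_left _ _)) (max_le hs.2 hθ.2) le_rfl
    fun η hη hne _ => ?_).symm
  -- The left weight requires its variable to exceed s and `B` requires its variable to be at least
  -- θ. Since η is the larger variable, it must satisfy both bounds, whence the lower limit `max s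
  -- θ`.
  simp only [max_lt_iff, hη.2, and_true]
  have hB₀ {x : ℝ} (hx : x < θ) : B x = 0 := by simp [hBdef, heav, hx]
  have hB₁ {x : ℝ} (hx : θ ≤ x) : B x = ρ x • A x := by simp [hBdef, heav, hx]
  split_ifs with hlt
  · obtain ⟨hsη, hθη⟩ := hlt
    have e₁ : mInt θ η (fun ζ => ρ ζ • (N₁ η ζ * A ζ))
        = mI (segMeasure L) fun ζ => (if ζ ≤ η then N₁ η ζ else 0) * B ζ := by
      refine mInt_eq_mI_of hθ.1 hθη.le hη.2 fun x _ hxθ _ => ?_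
      rcases lt_or_gt_of_ne hxθ with h | h
      · simp [hB₀ h, not_lt.2 h.le]
      · by_cases hxη : x ≤ η <;> simp [hB₁ h.le, h, hxη]
    have e₂ : mInt s η (fun ζ => ((ζ - s) * ρ η) • (N₂ ζ η * A η))
        = mI (segMeasure L) fun ζ =>
          (posKernel n ζ s)ᵀ * (if η ≤ ζ then 0 else N₂ ζ η) * B η := by
      refine mInt_eq_mI_of hs.1 hsη.le hη.2 fun x _ hxs hxη => ?_
      rcases lt_or_gt_of_ne hxs with h | h
      · simp [posKernel_of_ge h.le, not_lt.2 h.le]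
      · rcases lt_or_gt_of_ne hxη with h' | h'
        · simp [posKernel_of_le h.le, h, not_le.2 h', h'.le, hB₁ hθη.le, smul_smul, mul_comm]
        · simp [h, h'.le, not_le.2 h']
    rw [smul_add, e₁, e₂, ← mI_smul]
    simp [posKernel_of_le hsη.le, hB₁ hθη.le, smul_comm (ρ η)]
  · have hz (F : ℝ → Matrix (Fin n) (Fin n) ℝ) (h : ∀ x, F x = 0) : mI (segMeasure L) F = 0 := by
      rw [funext h, mI_zero]
    rcases lt_or_ge θ η with hθη | hθη
    · have hηs : η ≤ s := not_lt.1 fun h => hlt ⟨h, hθη⟩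
      rw [hz _ fun x => ?_, hz _ fun x => ?_]
      · simp [posKernel_of_ge hηs]
      · rcases le_total η x with h | h
        · simp [h]
        · simp [posKernel_of_ge (h.trans hηs)]
      · simp [posKernel_of_ge hηs]
    · rcases hθη.lt_or_eq with hθη | rfl
      · rw [hz _ fun x => ?_, hz _ fun x => ?_]
        · simp [hB₀ hθη]
        · simp [hB₀ hθη]
        · rcases le_or_gt x η with h | h
          · simp [hB₀ (h.trans_lt hθη)]
          · simp [not_le.2 h]
      -- At η = θ the factor `B` need not vanish; but the excluded point is `max s θ`, so θ < s here
      -- and the left weight vanishes.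
      · have hηs : η < s := lt_of_le_of_ne (not_lt.1 fun h => hne (max_eq_right h.le).symm)
          fun h => hne (by simp [h])
        rw [hz _ fun x => ?_, hz _ fun x => ?_]
        · simp [posKernel_of_ge hηs.le]
        · rcases le_total η x with h | h
          · simp [h]
          · simp [posKernel_of_ge (h.trans hηs.le)]
        · simp [posKernel_of_ge hηs.le]

end PosKernel

/-! ### The kernels of the system -/

lemma EssBdd.mIntegrable {ι κ : Type} {L : ℝ} {F : ℝ → Matrix ι κ ℝ} (h : EssBdd L F) :
    MIntegrable (segMeasure L) F := fun i j => (h i j).integrable le_top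

section

variable {ι κ : Type} {L : ℝ}

lemma mInt_smul_eq_mI_heav {θ : ℝ} (hθ : θ ∈ Icc 0 L) (ρ : ℝ → ℝ) (X : ℝ → Matrix ι κ ℝ) :
    mInt θ L (fun η => ρ η • X η)
      = mI (segMeasure L) fun η => (heav (η - θ) * ρ η) • X η := by
  refine mInt_eq_mI_of hθ.1 hθ.2 le_rfl fun x hx hxθ _ => ?_
  rcases lt_or_gt_of_ne hxθ with h | h
  · simp [heav, h, not_lt.2 h.le]
  · simp [heav, h, h.le, hx.2]

lemma mInt_mul_right {l : Type} [Fintype κ] {F : ℝ → Matrix ι κ ℝ}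
    (hF : MIntegrable (segMeasure L) F) (C : Matrix κ l ℝ) {a b : ℝ} (ha : a ∈ Icc 0 L)
    (hb : b ∈ Icc 0 L) : mInt a b F * C = mInt a b fun x => F x * C := by
  ext i j
  simp only [mInt, Matrix.mul_apply, Matrix.of_apply]
  rw [intervalIntegral.integral_finsetSum fun k _ =>
    (hF.intervalIntegrable ha hb i k).mul_const _]
  simp only [intervalIntegral.integral_mul_const]

lemma continuous_blockCol {k : ℕ} {n : ℕ} {X : Type*} [TopologicalSpace X] {c : X → Fin k → ℝ}
    (hc : ∀ i, Continuous fun x => c x i) : Continuous fun x => blockCol n (c x) :=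
  continuous_matrix fun p _ => (hc p.1).mul continuous_const

lemma continuous_blockRow {k : ℕ} {n : ℕ} {X : Type*} [TopologicalSpace X] {c : X → Fin k → ℝ}
    (hc : ∀ i, Continuous fun x => c x i) : Continuous fun x => blockRow n (c x) :=
  continuous_matrix fun _ p => (hc p.1).mul continuous_const

end

namespace PDESystem

variable {n m q : ℕ} (S : PDESystem n m q)

lemma continuous_Bc : Continuous S.Bc := by
  refine (continuous_const.matrix_mul (continuous_blockCol fun i => ?_)).neg
  fin_cases i <;> simp <;> fun_prop

lemma bddKernel_Ba {L : ℝ} : BddKernel L S.Ba := by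
  refine .of_continuous ((continuous_blockRow fun i => ?_).matrix_mul
    (S.continuous_Bc.comp continuous_snd))
  fin_cases i <;> simp <;> fun_prop

lemma bddKernel_Bb {L : ℝ} : BddKernel L fun _ θ => S.Bb θ :=
  .of_continuous (continuous_const.matrix_mul (S.continuous_Bc.comp continuous_snd))

lemma bddKernel_G1 {L : ℝ} : BddKernel L S.G1 := S.bddKernel_Ba.add bddKernel_posKernel

lemma bddKernel_G2 {L : ℝ} : BddKernel L S.G2 := S.bddKernel_Bb.add (.smul bddMeas_heav (.const 1))

section

variable {M A : ℝ → Matrix (Fin n) (Fin n) ℝ} {N₁ N₂ : ℝ → ℝ → Matrix (Fin n) (Fin n) ℝ}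

variable (M N₁ N₂) in
/-- The kernel `κ` with `⟨x, P f⟩ = ∫∫ x_ss(s)ᵀ κ(s,η) f(η)`. -/
def kap : ℝ → ℝ → Matrix (Fin n) (Fin n) ℝ := leftKernel S.L S.G1 M (joinKernel N₁ N₂)

lemma bddKernel_kap (hM : BddKernel S.L fun _ η => M η) (hN₁ : BddKernel S.L N₁)
    (hN₂ : BddKernel S.L N₂) : BddKernel S.L (S.kap M N₁ N₂) :=
  S.bddKernel_G1.leftKernel hM (hN₁.join hN₂)

/-- G = `Ba` + `posKernel`: the first summand produces the term `Y1` shared by both triangles, the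
second the terms that differ between them. -/
lemma kap_eq (hN₁ : BddKernel S.L N₁) (hN₂ : BddKernel S.L N₂) {s η : ℝ}
    (hs : s ∈ Icc 0 S.L) (hη : η ∈ Icc 0 S.L) :
    S.kap M N₁ N₂ s η = leftKernel S.L S.Ba M (joinKernel N₁ N₂) s η
      + leftKernel S.L (posKernel n) M (joinKernel N₁ N₂) s η :=
  leftKernel_add S.bddKernel_Ba bddKernel_posKernel (hN₁.join hN₂) hs hη

lemma V_eq (hN₁ : BddKernel S.L N₁) (hN₂ : BddKernel S.L N₂) {s η : ℝ}
    (hs : s ∈ Icc 0 S.L) (hη : η ∈ Icc 0 S.L) :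
    S.V M N₁ N₂ s η = S.kap M N₁ N₂ s η * S.B1 η := by
  rw [V, kap, leftKernel, add_assoc, mInt_add_mInt_eq_mI
    (S.bddKernel_G1.flip.transpose.mul_mIntegrable hs ((hN₁.join hN₂).flip.mIntegrable hη)) hη]
  · intro x hx
    simp [joinKernel, hx]
  · intro x hx
    simp [joinKernel, hx]

lemma Y1_eq (hN₁ : BddKernel S.L N₁) (hN₂ : BddKernel S.L N₂) {s η : ℝ}
    (hs : s ∈ Icc 0 S.L) (hη : η ∈ Icc 0 S.L) :
    S.Y1 (fun s => M s * A s) (fun s θ => N₁ s θ * A θ) (fun s θ => N₂ s θ * A θ) s η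
      = leftKernel S.L S.Ba M (joinKernel N₁ N₂) s η * A η := by
  have h := S.bddKernel_Ba.flip.transpose.mul_mIntegrable hs ((hN₁.join hN₂).flip.mIntegrable hη)
  rw [Y1, leftKernel, add_assoc, Matrix.add_mul, ← mI_mul_right _ h,
    mInt_add_mInt_eq_mI (h.mul_right (A η)) hη, Matrix.mul_assoc]
  · intro x hx
    simp [joinKernel, hx, Matrix.mul_assoc]
  · intro x hx
    simp [joinKernel, hx, Matrix.mul_assoc]

/-- `Y1` is the boundary part of κA, while `E1` and `E2` are its truncated-power part in the two
triangles. -/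
lemma calL1_eq (hN₁ : BddKernel S.L N₁) (hN₂ : BddKernel S.L N₂) {s θ : ℝ}
    (hs : s ∈ Icc 0 S.L) (hθ : θ ∈ Icc 0 S.L) :
    joinKernel
      (S.calL1 (fun s => M s * A s) (fun s θ => N₁ s θ * A θ) (fun s θ => N₂ s θ * A θ)).1
      (S.calL1 (fun s => M s * A s) (fun s θ => N₁ s θ * A θ) (fun s θ => N₂ s θ * A θ)).2 s θ
      = S.kap M N₁ N₂ s θ * A θ := by
  rw [S.kap_eq hN₁ hN₂ hs hθ, Matrix.add_mul, ← S.Y1_eq hN₁ hN₂ hs hθ, add_comm]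
  unfold joinKernel
  split_ifs with h
  · exact congrArg (· + _) (leftKernel_posKernel_mul_of_le hN₁ hN₂ hs hθ h).symm
  · exact congrArg (· + _) (leftKernel_posKernel_mul_of_ge hN₁ hN₂ hs hθ (not_le.1 h).le).symm

lemma mInt_add_mInt_eq_mI_joinKernel {l : Type} (hN₁ : BddKernel S.L N₁) (hN₂ : BddKernel S.L N₂)
    {B : ℝ → Matrix (Fin n) l ℝ} (hB : MIntegrable (segMeasure S.L) B) {ζ : ℝ}
    (hζ : ζ ∈ Icc 0 S.L) :
    mInt 0 ζ (fun θ => N₁ ζ θ * B θ) + mInt ζ S.L (fun θ => N₂ ζ θ * B θ)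
      = mI (segMeasure S.L) fun θ => joinKernel N₁ N₂ ζ θ * B θ := by
  rw [mI_eq_mInt_add ((hN₁.join hN₂).mul_mIntegrable hζ hB) hζ, add_comm]
  congr 1
  · exact mInt_congr_Ioo hζ.2 fun x hx => by simp [joinKernel, not_le.2 hx.1]
  · exact mInt_congr_Ioo hζ.1 fun x hx => by simp [joinKernel, hx.2.le]

/-- Here `Y` is `P B`, so the right side is G*Y; the transpose of `Ba` integrates over all of `[0,
L]`, that of `posKernel` only over `[s, L]`. This accounts for the terms of `F3` with `Y2` and of
`GIII` with `Y3`. -/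
lemma mI_Ba_add_mInt_eq (hM : BddKernel S.L fun _ η => M η) (hN₁ : BddKernel S.L N₁)
    (hN₂ : BddKernel S.L N₂) {B Y : ℝ → Matrix (Fin n) (Fin n) ℝ}
    (hB : MIntegrable (segMeasure S.L) B) {s : ℝ} (hs : s ∈ Icc 0 S.L)
    (hY : ∀ ζ ∈ Icc 0 S.L, Y ζ = M ζ * B ζ + mInt 0 ζ (fun θ => N₁ ζ θ * B θ)
      + mInt ζ S.L (fun θ => N₂ ζ θ * B θ)) :
    mInt 0 S.L (fun ζ => (S.Ba ζ s)ᵀ * Y ζ) + mInt s S.L (fun ζ => (ζ - s) • Y ζ)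
      = mI (segMeasure S.L) fun η => S.kap M N₁ N₂ s η * B η := by
  have hYI : MIntegrable (segMeasure S.L) Y := by
    have h : MIntegrable (segMeasure S.L) fun ζ => M ζ * B ζ
        + mI (segMeasure S.L) fun θ => joinKernel N₁ N₂ ζ θ * B θ :=
      (hM.mul_mIntegrable hs hB).add ((hN₁.join hN₂).mul_mIntegrable_prod hB).mI_right
    refine h.congr ?_
    filter_upwards [ae_restrict_mem measurableSet_Icc] with ζ hζ
    rw [hY ζ hζ, add_assoc, S.mInt_add_mInt_eq_mI_joinKernel hN₁ hN₂ hB hζ]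
  rw [kap, mI_leftKernel_mul S.bddKernel_G1 hM (hN₁.join hN₂) hB hs, mInt_sub_smul hs,
    mInt_eq_mI (hs.1.trans hs.2), ← mI_add (S.bddKernel_Ba.flip.transpose.mul_mIntegrable hs hYI)
      (bddKernel_posKernel.flip.transpose.mul_mIntegrable hs hYI)]
  refine mI_congr_ae ?_
  filter_upwards [ae_restrict_mem measurableSet_Icc] with ζ hζ
  rw [← S.mInt_add_mInt_eq_mI_joinKernel hN₁ hN₂ hB hζ, ← add_assoc, ← hY ζ hζ, ← Matrix.add_mul]
  rfl

/-- The common part of the second and the third linear map. -/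
lemma mI_kap_mul_heav (hM : BddKernel S.L fun _ η => M η) (hN₁ : BddKernel S.L N₁)
    (hN₂ : BddKernel S.L N₂) (hA : MIntegrable (segMeasure S.L) A) {ρ : ℝ → ℝ}
    (hρ : Continuous ρ) {s θ : ℝ} (hs : s ∈ Icc 0 S.L) (hθ : θ ∈ Icc 0 S.L) :
    mInt θ S.L (fun η => ρ η • S.Y1 (fun s => M s * A s) (fun s θ => N₁ s θ * A θ)
        (fun s θ => N₂ s θ * A θ) s η)
      + (mInt (max s θ) S.L fun η =>
        (η - s) • (ρ η • (M η * A η) + mInt θ η fun ζ => ρ ζ • (N₁ η ζ * A ζ))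
          + mInt s η fun ζ => ((ζ - s) * ρ η) • (N₂ ζ η * A η))
      = mI (segMeasure S.L) fun η => (heav (η - θ) * ρ η) • (S.kap M N₁ N₂ s η * A η) := by
  have hL : 0 ≤ S.L := hs.1.trans hs.2
  have hk : BddMeas S.L fun _ η => heav (η - θ) * ρ η :=
    .mul ⟨measurable_heav.comp (measurable_snd.sub_const θ), 1, fun _ _ _ _ => abs_heav_le _⟩
      (.of_continuous (hρ.comp continuous_snd))
  have h₁ : MIntegrable (segMeasure S.L) fun η => (heav (η - θ) * ρ η) •
      (leftKernel S.L S.Ba M (joinKernel N₁ N₂) s η * A η) :=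
    ((S.bddKernel_Ba.leftKernel hM (hN₁.join hN₂)).mul_mIntegrable hs hA).bdd_smul hk hL
  have h₂ : MIntegrable (segMeasure S.L) fun η => (heav (η - θ) * ρ η) •
      (leftKernel S.L (posKernel n) M (joinKernel N₁ N₂) s η * A η) :=
    ((bddKernel_posKernel.leftKernel hM (hN₁.join hN₂)).mul_mIntegrable hs hA).bdd_smul hk hL
  have e : mI (segMeasure S.L) (fun η => (heav (η - θ) * ρ η) •
        S.Y1 (fun s => M s * A s) (fun s θ => N₁ s θ * A θ) (fun s θ => N₂ s θ * A θ) s η)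
      = mI (segMeasure S.L) fun η => (heav (η - θ) * ρ η) •
      (leftKernel S.L S.Ba M (joinKernel N₁ N₂) s η * A η) := by
    refine mI_congr_ae ?_
    filter_upwards [ae_restrict_mem measurableSet_Icc] with η hη
    rw [S.Y1_eq hN₁ hN₂ hs hη]
  rw [← mI_heav_smul_leftKernel_posKernel hM hN₁ hN₂ hA hρ hs hθ, mInt_smul_eq_mI_heav hθ, e,
    ← mI_add h₁ h₂]
  refine mI_congr_ae ?_
  filter_upwards [ae_restrict_mem measurableSet_Icc] with η hη
  rw [S.kap_eq hN₁ hN₂ hs hη, Matrix.add_mul, smul_add]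

/-- G' = `Bb` + Heaviside. The `Bb` part gives the `Y2` terms of `F3`. The Heaviside part gives the
tail integral of `Y1` and an integral from `max s θ`, which is `F1` or `F2` according to the
triangle. -/
lemma calL2_eq (hM : BddKernel S.L fun _ η => M η) (hN₁ : BddKernel S.L N₁)
    (hN₂ : BddKernel S.L N₂) (hA : MIntegrable (segMeasure S.L) A) {s θ : ℝ}
    (hs : s ∈ Icc 0 S.L) (hθ : θ ∈ Icc 0 S.L) :
    joinKernel
      (S.calL2 (fun s => M s * A s) (fun s θ => N₁ s θ * A θ) (fun s θ => N₂ s θ * A θ)).1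
      (S.calL2 (fun s => M s * A s) (fun s θ => N₁ s θ * A θ) (fun s θ => N₂ s θ * A θ)).2 s θ
      = mI (segMeasure S.L) fun η => S.kap M N₁ N₂ s η * (A η * S.G2 η θ) := by
  have hL : S.L ∈ Icc 0 S.L := ⟨hs.1.trans hs.2, le_rfl⟩
  have h0 : 0 ∈ Icc 0 S.L := ⟨le_rfl, hL.1⟩
  have hAB : MIntegrable (segMeasure S.L) fun η => A η * S.Bb θ := hA.mul_right _
  have hk := S.bddKernel_kap hM hN₁ hN₂
  have hY₂ : MIntegrable (segMeasure S.L) (S.Y2 (fun s => M s * A s) (fun s θ => N₁ s θ * A θ)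
      (fun s θ => N₂ s θ * A θ)) := by
    have h : MIntegrable (segMeasure S.L) fun ζ => M ζ * A ζ
        + mI (segMeasure S.L) fun θ => joinKernel N₁ N₂ ζ θ * A θ :=
      (hM.mul_mIntegrable hs hA).add ((hN₁.join hN₂).mul_mIntegrable_prod hA).mI_right
    refine h.congr ?_
    filter_upwards [ae_restrict_mem measurableSet_Icc] with ζ hζ
    rw [Y2, add_assoc, S.mInt_add_mInt_eq_mI_joinKernel hN₁ hN₂ hA hζ]
  have h₁ := S.mI_Ba_add_mInt_eq hM hN₁ hN₂ hAB hs
    (Y := fun ζ => S.Y2 (fun s => M s * A s) (fun s θ => N₁ s θ * A θ)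
      (fun s θ => N₂ s θ * A θ) ζ * S.Bb θ) fun ζ hζ => by
        simp only [Y2, Matrix.add_mul, ← Matrix.mul_assoc]
        rw [mInt_mul_right (hN₁.mul_mIntegrable hζ hA) _ h0 hζ,
          mInt_mul_right (hN₂.mul_mIntegrable hζ hA) _ hζ hL]
  -- The weight ρ = 1 corresponds to the jump in G'.
  have h₂ := S.mI_kap_mul_heav hM hN₁ hN₂ hA (ρ := fun _ => 1) continuous_const hs hθ
  have hP : MIntegrable (segMeasure S.L) fun η => heav (η - θ) • A η :=
    hA.bdd_smul (k := fun η => heav (η - θ))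
      ⟨measurable_heav.comp (measurable_snd.sub_const θ), 1,
      fun _ _ _ _ => abs_heav_le _⟩ hL.1
  have e : (fun η => S.kap M N₁ N₂ s η * (A η * S.G2 η θ)) = fun η =>
      S.kap M N₁ N₂ s η * (A η * S.Bb θ) + S.kap M N₁ N₂ s η * (heav (η - θ) • A η) := by
    funext η
    simp [G2, Matrix.mul_add]
  have e' : (fun η => (heav (η - θ) * 1) • (S.kap M N₁ N₂ s η * A η))
      = fun η => S.kap M N₁ N₂ s η * (heav (η - θ) • A η) := by
    funext η
    simp
  have e₃ : mInt s S.L (fun ζ => (ζ - s) • S.Y2 (fun s => M s * A s) (fun s θ => N₁ s θ * A θ)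
        (fun s θ => N₂ s θ * A θ) ζ) * S.Bb θ
      = mInt s S.L (fun ζ => (ζ - s) • (S.Y2 (fun s => M s * A s) (fun s θ => N₁ s θ * A θ)
        (fun s θ => N₂ s θ * A θ) ζ * S.Bb θ)) := by
    rw [mInt_mul_right (hY₂.bdd_smul (k := fun ζ => ζ - s)
      (.of_continuous (continuous_snd.sub continuous_const)) hL.1) _ hs hL]
    simp only [Matrix.smul_mul]
  rw [e, mI_add (hk.mul_mIntegrable hs hAB) (hk.mul_mIntegrable hs hP), ← h₁, ← e', ← h₂, ← e₃]
  unfold joinKernel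
  split_ifs with h
  · rw [max_eq_left h]
    simp only [calL2, F1, F3, F4, F5, one_smul, mul_one, Matrix.mul_assoc]
    abel
  · rw [max_eq_right (not_le.1 h).le]
    simp only [calL2, F2, F3, F4, F5, one_smul, mul_one, Matrix.mul_assoc]
    abel

/-- The pattern of `calL2_eq` with G in place of G': `Ba` produces `Y3`, and the truncated power is
the Heaviside function times ρ(η) = η - θ. -/
lemma calL3_eq (hM : BddKernel S.L fun _ η => M η) (hN₁ : BddKernel S.L N₁)
    (hN₂ : BddKernel S.L N₂) (hA : MIntegrable (segMeasure S.L) A) {s θ : ℝ}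
    (hs : s ∈ Icc 0 S.L) (hθ : θ ∈ Icc 0 S.L) :
    joinKernel
      (S.calL3 (fun s => M s * A s) (fun s θ => N₁ s θ * A θ) (fun s θ => N₂ s θ * A θ)).1
      (S.calL3 (fun s => M s * A s) (fun s θ => N₁ s θ * A θ) (fun s θ => N₂ s θ * A θ)).2 s θ
      = mI (segMeasure S.L) fun η => S.kap M N₁ N₂ s η * (A η * S.G1 η θ) := by
  have hAB : MIntegrable (segMeasure S.L) fun η => A η * S.Ba η θ := by
    -- Multiplication by a bounded kernel on the right is reduced by transposition to multiplication
    -- on the left.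
    simpa using ((S.bddKernel_Ba.flip.transpose.mul_mIntegrable hθ hA.transpose)).transpose
  have h₁ := S.mI_Ba_add_mInt_eq hM hN₁ hN₂ hAB hs
    (Y := fun ζ => S.Y3 (fun s => M s * A s) (fun s θ => N₁ s θ * A θ)
      (fun s θ => N₂ s θ * A θ) ζ θ) fun ζ hζ => by simp only [Y3, Matrix.mul_assoc]
  have h₂ := S.mI_kap_mul_heav hM hN₁ hN₂ hA (ρ := fun η => η - θ) (by fun_prop) hs hθ
  have hk := S.bddKernel_kap hM hN₁ hN₂
  have hP : MIntegrable (segMeasure S.L) fun η => A η * posKernel n η θ := by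
    simpa using ((bddKernel_posKernel.flip.transpose.mul_mIntegrable hθ hA.transpose)).transpose
  have e : (fun η => S.kap M N₁ N₂ s η * (A η * S.G1 η θ)) = fun η =>
      S.kap M N₁ N₂ s η * (A η * S.Ba η θ) + S.kap M N₁ N₂ s η * (A η * posKernel n η θ) := by
    funext η
    rw [← Matrix.mul_add, ← Matrix.mul_add]
    rfl
  have e' : (fun η => (heav (η - θ) * (η - θ)) • (S.kap M N₁ N₂ s η * A η))
      = fun η => S.kap M N₁ N₂ s η * (A η * posKernel n η θ) := by
    funext η
    simp [posKernel]
  rw [e, mI_add (hk.mul_mIntegrable hs hAB) (hk.mul_mIntegrable hs hP), ← h₁, ← e', ← h₂]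
  unfold joinKernel
  split_ifs with h
  · rw [max_eq_left h]
    simp only [calL3, GI, GIII, G4, G5]
    abel
  · rw [max_eq_right (not_le.1 h).le]
    simp only [calL3, GII, GIII, G4, G5]
    abel

variable (M N₁ N₂) in
/-- The kernel of `x_ss ↦ G₁* P 𝓐 x`. -/
def formKernel (s θ : ℝ) : Matrix (Fin n) (Fin n) ℝ :=
  S.kap M N₁ N₂ s θ * S.A2 θ
    + mI (segMeasure S.L) (fun η => S.kap M N₁ N₂ s η * (S.A1 η * S.G2 η θ))
    + mI (segMeasure S.L) fun η => S.kap M N₁ N₂ s η * (S.A0 η * S.G1 η θ)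

/-- This is the bridge from the explicit formulas to compositions of operators; from here on (H₁,
H₂) is handled only through `formKernel`. -/
lemma joinKernel_H (hA0 : EssBdd S.L S.A0) (hA1 : EssBdd S.L S.A1)
    (hM : BddKernel S.L fun _ η => M η)
    (hN₁ : BddKernel S.L N₁) (hN₂ : BddKernel S.L N₂) {s θ : ℝ} (hs : s ∈ Icc 0 S.L)
    (hθ : θ ∈ Icc 0 S.L) :
    joinKernel (S.H M N₁ N₂).1 (S.H M N₁ N₂).2 s θ = S.formKernel M N₁ N₂ s θ := by
  rw [formKernel, ← S.calL1_eq hN₁ hN₂ hs hθ, ← S.calL2_eq hM hN₁ hN₂ hA1.mIntegrable hs hθ,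
    ← S.calL3_eq hM hN₁ hN₂ hA0.mIntegrable hs hθ]
  unfold joinKernel H
  split_ifs <;> rfl

end

end PDESystem

/-! ### Vectors as columns -/

section Col

variable {ι κ : Type} {L : ℝ}

/-- A vector as a matrix with one column. -/
def col (x : EuclideanSpace ℝ ι) : Matrix ι Unit ℝ := Matrix.of fun i _ => x i

lemma col_apply (x : EuclideanSpace ℝ ι) (i : ι) (j : Unit) : col x i j = x i := rfl

lemma col_add (x y : EuclideanSpace ℝ ι) : col (x + y) = col x + col y := rfl

lemma col_zero : col (0 : EuclideanSpace ℝ ι) = 0 := rfl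

lemma col_toEuclideanLin [Fintype κ] [DecidableEq κ] (A : Matrix ι κ ℝ) (x : EuclideanSpace ℝ κ) :
    col (Matrix.toEuclideanLin A x) = A * col x := rfl

variable [Fintype ι]

lemma mIntegrable_col {α : Type*} [MeasurableSpace α] {μ : Measure α}
    {f : α → EuclideanSpace ℝ ι} :
    MIntegrable μ (fun x => col (f x)) ↔ Integrable f μ :=
  ⟨fun h => .of_eval_piLp fun i => h i (), fun h i _ => h.eval_piLp i⟩

lemma col_intervalIntegral {f : ℝ → EuclideanSpace ℝ ι} (hf : Integrable f (segMeasure L)) {a b : ℝ}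
    (ha : 0 ≤ a) (hab : a ≤ b) (hb : b ≤ L) :
    col (∫ x in a..b, f x) = mInt a b fun x => col (f x) := by
  have h : IntegrableOn f (Ioc a b) :=
    IntegrableOn.mono_set (t := Icc 0 L) hf fun x hx => ⟨ha.trans hx.1.le, hx.2.trans hb⟩
  ext i j
  simp only [col_apply, mInt, Matrix.of_apply]
  rw [intervalIntegral.integral_of_le hab, intervalIntegral.integral_of_le hab,
    eval_integral_piLp fun i => Integrable.eval_piLp h i]

end Col

/-! ### Taylor's formula for functions in W². -/

section Sobolev

variable {n : ℕ} {L : ℝ}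

/-- `(s - η)₊` as an integral. -/
lemma integral_heav_mul_heav {s η : ℝ} (hs : s ∈ Icc 0 L) (hη : η ∈ Icc 0 L) :
    ∫ r, heav (s - r) * heav (r - η) ∂(segMeasure L) = heav (s - η) * (s - η) := by
  have e : (fun r => heav (s - r) * heav (r - η)) = (Icc η s).indicator fun _ => (1 : ℝ) := by
    funext r
    by_cases h₁ : r ≤ s <;> by_cases h₂ : η ≤ r <;> simp [heav, h₁, h₂]
  rw [e, integral_indicator measurableSet_Icc, Measure.restrict_restrict measurableSet_Icc,
    inter_eq_self_of_subset_left (Icc_subset_Icc hη.1 hs.2)]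
  rcases le_or_gt η s with h | h
  · simp [heav, h]
  · simp [heav, h]

lemma mInt_zero_eq_mI_heav {ι κ : Type} {s : ℝ} (hs : s ∈ Icc 0 L) (X : ℝ → Matrix ι κ ℝ) :
    mInt 0 s X = mI (segMeasure L) fun η => heav (s - η) • X η := by
  refine mInt_eq_mI_of le_rfl hs.1 hs.2 fun x hx hx0 _ => ?_
  have : 0 < x := lt_of_le_of_ne hx.1 (Ne.symm hx0)
  by_cases h : x ≤ s <;> simp [heav, h, this]

variable {u u' u'' : ℝ → EuclideanSpace ℝ (Fin n)}

lemma IsSobolevTwo.mIntegrable (h : IsSobolevTwo L u u' u'') :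
    MIntegrable (segMeasure L) fun s => col (u'' s) :=
  mIntegrable_col.2 (h.memLp.integrable one_le_two)

lemma IsSobolevTwo.col_deriv (h : IsSobolevTwo L u u' u'') {s : ℝ} (hs : s ∈ Icc 0 L) :
    col (u' s) = col (u' 0) + mI (segMeasure L) fun η => heav (s - η) • col (u'' η) := by
  rw [h.deriv_eq s hs, col_add, col_intervalIntegral (h.memLp.integrable one_le_two) le_rfl hs.1 hs.2,
    mInt_zero_eq_mI_heav hs]

lemma bddKernel_heav : BddKernel L fun s η => heav (s - η) • (1 : Matrix (Fin n) (Fin n) ℝ) :=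
  .smul bddMeas_heav (.const 1)

/-- The definition only asks for integrability of the second derivative; that of the first is read
off from its representation as a primitive. -/
lemma IsSobolevTwo.mIntegrable_deriv (h : IsSobolevTwo L u u' u'') :
    MIntegrable (segMeasure L) fun s => col (u' s) := by
  have h' : MIntegrable (segMeasure L) fun s => col (u' 0) + mI (segMeasure L) fun η =>
      (heav (s - η) • (1 : Matrix (Fin n) (Fin n) ℝ)) * col (u'' η) :=
    (MIntegrable.const _).add (bddKernel_heav.mul_mIntegrable_prod h.mIntegrable).mI_right
  refine h'.congr ?_
  filter_upwards [ae_restrict_mem measurableSet_Icc] with s hs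
  rw [h.col_deriv hs]
  simp

/-- Taylor's formula with integral remainder: the double primitive is put in the other order by
Fubini, and the inner integral of the two Heaviside factors is (s - η)₊. -/
lemma IsSobolevTwo.col_eq (h : IsSobolevTwo L u u' u'') {s : ℝ} (hs : s ∈ Icc 0 L) :
    col (u s) = col (u 0) + s • col (u' 0)
      + mI (segMeasure L) fun η => posKernel n s η * col (u'' η) := by
  have hL : 0 ≤ L := hs.1.trans hs.2
  have hk : BddMeas L fun _ r => heav (s - r) :=
    ⟨measurable_heav.comp (measurable_snd.const_sub s), 1, fun _ _ _ _ => abs_heav_le _⟩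
  have hK : BddKernel L fun r η => (heav (s - r) * heav (r - η)) •
      (1 : Matrix (Fin n) (Fin n) ℝ) := .smul (hk.flip.mul bddMeas_heav) (.const 1)
  have hI := hK.mul_mIntegrable_prod h.mIntegrable
  have e₁ : mI (segMeasure L) (fun r => heav (s - r) • col (u' r))
      = mI (segMeasure L) fun r => heav (s - r) • col (u' 0)
        + mI (segMeasure L) fun η => ((heav (s - r) * heav (r - η)) •
          (1 : Matrix (Fin n) (Fin n) ℝ)) * col (u'' η) := by
    refine mI_congr_ae ?_
    filter_upwards [ae_restrict_mem measurableSet_Icc] with r hr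
    rw [h.col_deriv hr, smul_add, ← mI_smul]
    simp [smul_smul]
  have e₂ : mInt 0 s (fun _ => col (u' 0)) = s • col (u' 0) := by
    ext i j
    simp [mInt]
  rw [h.eq s hs, col_add, col_intervalIntegral (mIntegrable_col.1 h.mIntegrable_deriv) le_rfl hs.1
    hs.2, mInt_zero_eq_mI_heav hs, e₁, mI_add ((MIntegrable.const _).bdd_smul hk hL) hI.mI_right,
    ← mInt_zero_eq_mI_heav hs, e₂, mI_swap hI, add_assoc]
  congr 2
  refine mI_congr_ae ?_
  filter_upwards [ae_restrict_mem measurableSet_Icc] with η hη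
  ext i j
  simp only [mI_apply, posKernel, Matrix.smul_mul, Matrix.one_mul, Matrix.smul_apply, smul_eq_mul]
  rw [integral_mul_const, integral_heav_mul_heav hs hη]

end Sobolev

/-! ### Recovery of the state from its second derivative. -/

namespace PDESystem

variable {n m q : ℕ} (S : PDESystem n m q) {u u' u'' : ℝ → EuclideanSpace ℝ (Fin n)}

/-- The column `(u(0), u_s(0))`. -/
def initCol (u u' : ℝ → EuclideanSpace ℝ (Fin n)) : Matrix (Fin 2 × Fin n) Unit ℝ :=
  Matrix.of fun p _ => (![u 0, u' 0] p.1) p.2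

lemma blockRow_mul_initCol (c : Fin 2 → ℝ) :
    blockRow n c * initCol u u' = c 0 • col (u 0) + c 1 • col (u' 0) := by
  ext i j
  simp [blockRow, initCol, Matrix.mul_apply, Fintype.sum_prod_type, Matrix.one_apply, col_apply]

/-- Taylor's formula at s = L, where both Heaviside factors equal 1 on the whole interval. -/
lemma col_boundaryVec (hL : 0 ≤ S.L) (h : IsSobolevTwo S.L u u' u'') :
    col (boundaryVec S.L u u') = S.bdryLift * initCol u u'
      + mI (segMeasure S.L) fun η => blockCol n ![0, S.L - η, 0, 1] * col (u'' η) := by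
  have hLm : S.L ∈ Icc 0 S.L := ⟨hL, le_rfl⟩
  have h₁ := h.col_eq hLm
  have h₂ := h.col_deriv hLm
  have e (c : ℝ → Fin 4 → ℝ) (p : Fin 4 × Fin n) (j : Unit) :
      (mI (segMeasure S.L) fun η => blockCol n (c η) * col (u'' η)) p j
        = ∫ η, c η p.1 * u'' η p.2 ∂(segMeasure S.L) := by
    simp [mI_apply, Matrix.mul_apply, blockCol, Matrix.one_apply, col_apply]
  have hh : ∀ η ∈ Icc 0 S.L, heav (S.L - η) = 1 := fun η hη => by simp [heav, hη.2]
  ext ⟨k, i⟩ j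
  rw [Matrix.add_apply, e]
  have e₁ := congrFun (congrFun h₁ i) j
  have e₂ := congrFun (congrFun h₂ i) j
  simp only [Matrix.add_apply, mI_apply, col_apply, Matrix.smul_apply, posKernel, Matrix.smul_mul,
    Matrix.one_mul, smul_eq_mul] at e₁ e₂
  have e₃ : ∫ η, heav (S.L - η) * u'' η i ∂(segMeasure S.L)
      = ∫ η, u'' η i ∂(segMeasure S.L) :=
    setIntegral_congr_fun measurableSet_Icc fun η hη => by simp [hh η hη]
  have e₄ : ∫ η, heav (S.L - η) * (S.L - η) * u'' η i ∂(segMeasure S.L)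
      = ∫ η, (S.L - η) * u'' η i ∂(segMeasure S.L) :=
    setIntegral_congr_fun measurableSet_Icc fun η hη => by simp [hh η hη]
  rw [e₃] at e₂
  rw [e₄] at e₁
  fin_cases k <;>
    simp [boundaryVec, col_apply, bdryLift, initCol, Matrix.mul_apply, Fintype.sum_prod_type,
      Matrix.one_apply, e₁, e₂]

lemma continuous_blockCol_sub {L : ℝ} : Continuous fun η : ℝ => blockCol n ![0, L - η, 0, 1] := by
  refine continuous_blockCol fun i => ?_
  fin_cases i <;> simp <;> fun_prop

/-- Inserting Taylor's formula into the boundary condition gives `B2` (u(0), u_s(0)) = -B ∫ [0; L-η;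
0; I] u_ss(η) dη, and `B2` is invertible. -/
lemma initCol_eq (hB : IsUnit S.B2.det) (hL : 0 ≤ S.L) (h : S.InDomain u u' u'') :
    initCol u u' = mI (segMeasure S.L) fun η => S.Bc η * col (u'' η) := by
  have h0 : (0 : ℝ) ∈ Icc 0 S.L := ⟨le_rfl, hL⟩
  have hc : BddKernel S.L fun _ η => blockCol n ![0, S.L - η, 0, 1] :=
    .of_continuous (continuous_blockCol_sub.comp continuous_snd)
  have hI := hc.mul_mIntegrable h0 h.1.mIntegrable
  have h₁ : S.B * col (boundaryVec S.L u u') = 0 := by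
    rw [← col_toEuclideanLin, h.2, col_zero]
  rw [S.col_boundaryVec hL h.1, Matrix.mul_add, ← Matrix.mul_assoc] at h₁
  have h₂ : initCol u u' = S.B2⁻¹ * (S.B2 * initCol u u') := by
    rw [← Matrix.mul_assoc, Matrix.nonsing_inv_mul _ hB, Matrix.one_mul]
  rw [h₂, B2, eq_neg_of_add_eq_zero_left h₁, ← B2]
  have e : (fun η => S.Bc η * col (u'' η))
      = fun η => -(S.B2⁻¹ * S.B) * (blockCol n ![0, S.L - η, 0, 1] * col (u'' η)) := by
    funext η
    simp [Bc, Matrix.mul_assoc]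
  rw [e, mI_mul_left _ hI]
  simp [Matrix.mul_assoc]

lemma mIntegrable_Bc_mul (hL : 0 ≤ S.L) {l : Type} {v : ℝ → Matrix (Fin n) l ℝ}
    (hv : MIntegrable (segMeasure S.L) v) : MIntegrable (segMeasure S.L) fun η => S.Bc η * v η :=
  (BddKernel.of_continuous (K := fun _ η => S.Bc η)
    (S.continuous_Bc.comp continuous_snd)).mul_mIntegrable (s := 0) ⟨le_rfl, hL⟩ hv

/-- Taylor's formula after elimination of the initial data: [I sI] applied to (u(0), u_s(0)) becomes
the `Ba` part of G. -/
lemma col_eq_mI_G1 (hB : IsUnit S.B2.det) (h : S.InDomain u u' u'') {s : ℝ}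
    (hs : s ∈ Icc 0 S.L) :
    col (u s) = mI (segMeasure S.L) fun η => S.G1 s η * col (u'' η) := by
  have hL : 0 ≤ S.L := hs.1.trans hs.2
  have e : blockRow n ![1, s] * initCol u u' = col (u 0) + s • col (u' 0) := by
    simp [blockRow_mul_initCol]
  have e' : (fun η => S.G1 s η * col (u'' η)) = fun η =>
      blockRow n ![1, s] * (S.Bc η * col (u'' η)) + posKernel n s η * col (u'' η) := by
    funext η
    simp [G1, Ba, posKernel, Matrix.add_mul, Matrix.mul_assoc]
  rw [h.1.col_eq hs, e', mI_add ((S.mIntegrable_Bc_mul hL h.1.mIntegrable).mul_left _)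
    (bddKernel_posKernel.mul_mIntegrable hs h.1.mIntegrable),
    mI_mul_left _ (S.mIntegrable_Bc_mul hL h.1.mIntegrable), ← S.initCol_eq hB hL h, e]

lemma col_deriv_eq_mI_G2 (hB : IsUnit S.B2.det) (h : S.InDomain u u' u'') {s : ℝ}
    (hs : s ∈ Icc 0 S.L) :
    col (u' s) = mI (segMeasure S.L) fun η => S.G2 s η * col (u'' η) := by
  have hL : 0 ≤ S.L := hs.1.trans hs.2
  have e : blockRow n ![0, 1] * initCol u u' = col (u' 0) := by
    simp [blockRow_mul_initCol]
  have hI := bddKernel_heav.mul_mIntegrable hs h.1.mIntegrable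
  simp only [Matrix.smul_mul, Matrix.one_mul] at hI
  have e' : (fun η => S.G2 s η * col (u'' η)) = fun η =>
      blockRow n ![0, 1] * (S.Bc η * col (u'' η)) + heav (s - η) • col (u'' η) := by
    funext η
    simp [G2, Bb, Matrix.add_mul, Matrix.mul_assoc]
  rw [h.1.col_deriv hs, e', mI_add ((S.mIntegrable_Bc_mul hL h.1.mIntegrable).mul_left _) hI,
    mI_mul_left _ (S.mIntegrable_Bc_mul hL h.1.mIntegrable), ← S.initCol_eq hB hL h, e]

end PDESystem

/-! ### Square integrable matrix-valued functions and Gram kernels -/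

section SquareIntegrable

variable {α β : Type*} [MeasurableSpace α] [MeasurableSpace β] {μ : Measure α} {ν : Measure β}
  {ι κ l : Type}

/-- Entrywise square integrability of a matrix-valued function. -/
def MSqIntegrable (μ : Measure α) (F : α → Matrix ι κ ℝ) : Prop :=
  ∀ i j, MemLp (fun x => F x i j) 2 μ

lemma MSqIntegrable.mIntegrable [IsFiniteMeasure μ] {F : α → Matrix ι κ ℝ}
    (hF : MSqIntegrable μ F) : MIntegrable μ F := fun i j => (hF i j).integrable one_le_two

lemma MSqIntegrable.transpose {F : α → Matrix ι κ ℝ} (hF : MSqIntegrable μ F) :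
    MSqIntegrable μ fun x => (F x)ᵀ := fun i j => hF j i

lemma MSqIntegrable.add {F G : α → Matrix ι κ ℝ} (hF : MSqIntegrable μ F)
    (hG : MSqIntegrable μ G) : MSqIntegrable μ fun x => F x + G x :=
  fun i j => (hF i j).add (hG i j)

lemma MSqIntegrable.mul_left [Fintype ι] (C : Matrix l ι ℝ) {F : α → Matrix ι κ ℝ}
    (hF : MSqIntegrable μ F) : MSqIntegrable μ fun x => C * F x := fun i j => by
  simp only [Matrix.mul_apply]
  exact memLp_finsetSum _ fun k _ => (hF k j).const_mul _

lemma MSqIntegrable.mul [Fintype κ] {F : α → Matrix ι κ ℝ} {G : α → Matrix κ l ℝ}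
    (hF : MSqIntegrable μ F) (hG : MSqIntegrable μ G) : MIntegrable μ fun x => F x * G x :=
  fun i j => by
    simp only [Matrix.mul_apply]
    exact integrable_finsetSum _ fun k _ => (hF i k).integrable_mul (hG k j)

lemma memLp_two_mul_prod [SFinite μ] [SFinite ν] {f : α → ℝ} {g : β → ℝ} (hf : MemLp f 2 μ)
    (hg : MemLp g 2 ν) : MemLp (fun p : α × β => f p.1 * g p.2) 2 (μ.prod ν) := by
  have hm : AEStronglyMeasurable (fun p : α × β => f p.1 * g p.2) (μ.prod ν) :=
    hf.1.comp_fst.mul hg.1.comp_snd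
  rw [memLp_two_iff_integrable_sq hm]
  simp only [mul_pow]
  exact hf.integrable_sq.mul_prod hg.integrable_sq

lemma MSqIntegrable.ae_right [SFinite μ] [SFinite ν] {F : α → β → Matrix ι κ ℝ} [Countable ι]
    [Countable κ] (hF : MSqIntegrable (μ.prod ν) fun p => F p.1 p.2) :
    ∀ᵐ x ∂μ, MSqIntegrable ν (F x) := by
  simp only [MSqIntegrable, ae_all_iff]
  intro i j
  filter_upwards [(hF i j).1.prodMk_left, (hF i j).integrable_sq.prod_right_ae] with x h₁ h₂
  exact (memLp_two_iff_integrable_sq h₁).2 h₂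

lemma MSqIntegrable.ae_left [SFinite μ] [SFinite ν] {F : α → β → Matrix ι κ ℝ} [Countable ι]
    [Countable κ] (hF : MSqIntegrable (μ.prod ν) fun p => F p.1 p.2) :
    ∀ᵐ y ∂ν, MSqIntegrable μ fun x => F x y := by
  refine MSqIntegrable.ae_right (F := fun y x => F x y) fun i j => ?_
  exact (hF i j).comp_measurePreserving Measure.measurePreserving_swap

lemma MIntegrable.ae_right [SFinite μ] [SFinite ν] {F : α → β → Matrix ι κ ℝ} [Countable ι]
    [Countable κ] (hF : MIntegrable (μ.prod ν) fun p => F p.1 p.2) :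
    ∀ᵐ x ∂μ, MIntegrable ν (F x) := by
  simp only [MIntegrable, ae_all_iff]
  exact fun i j => (hF i j).prod_right_ae

lemma mI_prod [SFinite μ] [SFinite ν] {F : α → β → Matrix ι κ ℝ}
    (hF : MIntegrable (μ.prod ν) fun p => F p.1 p.2) :
    mI (μ.prod ν) (fun p => F p.1 p.2) = mI μ fun x => mI ν fun y => F x y := by
  ext i j
  exact integral_prod _ (hF i j)

lemma MSqIntegrable.mul_snd [IsFiniteMeasure μ] [SFinite ν] {D n : Type} [Fintype n]
    {Ψ : α → β → Matrix D n ℝ} {v : β → Matrix n Unit ℝ}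
    (hΨ : MSqIntegrable (μ.prod ν) fun p => Ψ p.1 p.2)
    (hv : MSqIntegrable ν v) : MIntegrable (μ.prod ν) fun p => Ψ p.1 p.2 * v p.2 :=
  hΨ.mul fun i j => (hv i j).comp_snd μ

variable [IsFiniteMeasure μ] {D n : Type} [Fintype D] [Fintype n]
  {Ψ : α → β → Matrix D n ℝ} {v : β → Matrix n Unit ℝ}

/-- The integrand of `|∫ Ψ(x,y) v(y) dy|²`, written as a double integral. -/
def gramIntegrand (Ψ : α → β → Matrix D n ℝ) (v : β → Matrix n Unit ℝ) (x : α) (p : β × β) :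
    Matrix Unit Unit ℝ :=
  (v p.1)ᵀ * ((Ψ x p.1)ᵀ * Ψ x p.2) * v p.2

/-- Ψ is only square integrable on the product, so Ψ(x,y)v(y) need not be. Pairing crosswise,
Ψ(x,y)v(y') and Ψ(x,y')v(y) are square integrable in (x,y,y'), and the integrand is a sum of
products of such functions. -/
lemma MSqIntegrable.gram_integrable [SFinite ν] (hΨ : MSqIntegrable (μ.prod ν) fun p => Ψ p.1 p.2)
    (hv : MSqIntegrable ν v) :
    MIntegrable (μ.prod (ν.prod ν)) fun p => gramIntegrand Ψ v p.1 p.2 := by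
  -- The two regroupings ((x,y),y') and ((x,y'),y) under which the crosswise factors are tensor
  -- products.
  have T₁ : MeasurePreserving (fun p : α × β × β => ((p.1, p.2.1), p.2.2))
      (μ.prod (ν.prod ν)) ((μ.prod ν).prod ν) :=
    (measurePreserving_prodAssoc μ ν ν).symm
  have T₂ : MeasurePreserving (fun p : α × β × β => ((p.1, p.2.2), p.2.1))
      (μ.prod (ν.prod ν)) ((μ.prod ν).prod ν) :=
    T₁.comp ((MeasurePreserving.id μ).prod Measure.measurePreserving_swap)
  intro a b
  have key (k k' : n) (d : D) : Integrable (fun p : α × β × β =>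
      (Ψ p.1 p.2.1 d k * v p.2.2 k' b) * (Ψ p.1 p.2.2 d k' * v p.2.1 k a))
      (μ.prod (ν.prod ν)) :=
    ((memLp_two_mul_prod (hΨ d k) (hv k' b)).comp_measurePreserving T₁).integrable_mul
      ((memLp_two_mul_prod (hΨ d k') (hv k a)).comp_measurePreserving T₂)
  refine (integrable_finsetSum Finset.univ fun k' _ => integrable_finsetSum Finset.univ fun k _ =>
    integrable_finsetSum Finset.univ fun d _ => key k k' d).congr (.of_forall fun p => ?_)
  simp only [gramIntegrand, Matrix.mul_apply, Matrix.transpose_apply, Finset.sum_mul,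
    Finset.mul_sum]
  refine Finset.sum_congr rfl fun k' _ => Finset.sum_congr rfl fun k _ =>
    Finset.sum_congr rfl fun d _ => ?_
  ring

lemma mI_transpose_mul_mI_ae [SFinite ν] (hΨ : MSqIntegrable (μ.prod ν) fun p => Ψ p.1 p.2)
    (hv : MSqIntegrable ν v) :
    ∀ᵐ x ∂μ, (mI ν fun y => Ψ x y * v y)ᵀ * (mI ν fun y => Ψ x y * v y)
      = mI (ν.prod ν) (gramIntegrand Ψ v x) := by
  filter_upwards [MIntegrable.ae_right (F := fun x y => Ψ x y * v y) (hΨ.mul_snd hv), (hΨ.gram_integrable hv).ae_right] with x h₁ h₂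
  rw [mI_prod (F := fun s θ => gramIntegrand Ψ v x (s, θ)) h₂, ← mI_transpose,
    ← mI_mul_right _ h₁.transpose]
  congr 1
  funext s
  rw [← mI_mul_left _ h₁]
  simp [gramIntegrand, Matrix.mul_assoc]

/-- The integral of the square of an integral operator, as a quadratic form. -/
lemma mI_transpose_mul_mI [SFinite ν] (hΨ : MSqIntegrable (μ.prod ν) fun p => Ψ p.1 p.2)
    (hv : MSqIntegrable ν v) :
    mI μ (fun x => (mI ν fun y => Ψ x y * v y)ᵀ * (mI ν fun y => Ψ x y * v y))
      = mI ν fun s => mI ν fun θ =>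
        (v s)ᵀ * (mI μ fun x => (Ψ x s)ᵀ * Ψ x θ) * v θ := by
  have hG := hΨ.gram_integrable hv
  have e₁ := mI_congr_ae (mI_transpose_mul_mI_ae hΨ hv)
  have e₃ := mI_prod (F := fun s θ => mI μ fun x => gramIntegrand Ψ v x (s, θ)) hG.mI_left
  rw [e₁, mI_swap hG, e₃]
  refine mI_congr_ae ?_
  filter_upwards [hΨ.ae_left] with s hs
  refine mI_congr_ae ?_
  filter_upwards [hΨ.ae_left] with θ hθ
  have h := hs.transpose.mul hθ
  rw [← mI_mul_left _ h, ← mI_mul_right _ (h.mul_left _)]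
  rfl

lemma mIntegrable_transpose_mul_mI [SFinite ν] (hΨ : MSqIntegrable (μ.prod ν) fun p => Ψ p.1 p.2)
    (hv : MSqIntegrable ν v) :
    MIntegrable μ fun x => (mI ν fun y => Ψ x y * v y)ᵀ * (mI ν fun y => Ψ x y * v y) := by
  have hG := hΨ.gram_integrable hv
  refine hG.mI_right.congr ?_
  filter_upwards [mI_transpose_mul_mI_ae hΨ hv] with x hx using hx.symm

/-- A Hilbert–Schmidt operator maps L₂ to L₂: each squared entry of the image is at most a diagonal
entry of the Gram expression already known to be integrable. -/
lemma mSqIntegrable_mI [SFinite ν] (hΨ : MSqIntegrable (μ.prod ν) fun p => Ψ p.1 p.2)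
    (hv : MSqIntegrable ν v) : MSqIntegrable μ fun x => mI ν fun y => Ψ x y * v y := by
  intro d b
  have hm := (hΨ.mul_snd hv).mI_right (F := fun x y => Ψ x y * v y) d b
  rw [memLp_two_iff_integrable_sq hm.1]
  refine ((mIntegrable_transpose_mul_mI hΨ hv) b b).mono' (hm.1.pow 2) (.of_forall fun x => ?_)
  simp only [Matrix.mul_apply, Matrix.transpose_apply, Real.norm_eq_abs, abs_pow, sq_abs, ← pow_two]
  exact Finset.single_le_sum (f := fun d => (mI ν (fun y => Ψ x y * v y) d b) ^ 2)
    (fun _ _ => sq_nonneg _) (Finset.mem_univ d)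

/-- Expansion of the nonnegative quantity `∫ |U + ∫ Ψ v|²`. -/
lemma mI_sq_add_nonneg [SFinite ν] {U : α → Matrix D Unit ℝ} (hU : MSqIntegrable μ U)
    (hΨ : MSqIntegrable (μ.prod ν) fun p => Ψ p.1 p.2) (hv : MSqIntegrable ν v) :
    0 ≤ (mI μ (fun x => (U x)ᵀ * U x)
      + (2 : ℝ) • mI μ (fun x => (U x)ᵀ * mI ν fun y => Ψ x y * v y)
      + mI ν fun s => mI ν fun θ => (v s)ᵀ * (mI μ fun x => (Ψ x s)ᵀ * Ψ x θ) * v θ) () () := by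
  have hg := mSqIntegrable_mI hΨ hv
  set g : α → Matrix D Unit ℝ := fun x => mI ν fun y => Ψ x y * v y with hgdef
  have h₁ := hU.transpose.mul hU
  have h₂ := (hU.transpose.mul hg).smul 2
  have h₃ := hg.transpose.mul hg
  rw [← mI_transpose_mul_mI hΨ hv, ← mI_smul, ← mI_add h₁ h₂, ← mI_add (h₁.add h₂) h₃, mI_apply]
  refine integral_nonneg fun x => ?_
  have e : ((U x)ᵀ * U x + (2 : ℝ) • ((U x)ᵀ * g x) + (g x)ᵀ * g x) () ()
      = ∑ d, (U x d () + g x d ()) ^ 2 := by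
    simp only [Matrix.add_apply, Matrix.smul_apply, Matrix.mul_apply, Matrix.transpose_apply,
      smul_eq_mul, Finset.mul_sum, ← Finset.sum_add_distrib]
    exact Finset.sum_congr rfl fun d _ => by ring
  exact e.symm ▸ Finset.sum_nonneg fun d _ => sq_nonneg _

end SquareIntegrable

/-! ### Factorization of positive semidefinite matrices and auxiliary integrability. -/

section

-- Positive elements of a C*-algebra have the form b*b, and for real matrices the star is the
-- transpose.
open scoped MatrixOrder Matrix.Norms.L2Operator in
lemma exists_eq_transpose_mul_self {ι : Type} [Fintype ι] [DecidableEq ι] {T : Matrix ι ι ℝ}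
    (hT : T.PosSemidef) : ∃ R : Matrix ι ι ℝ, T = Rᵀ * R :=
  CStarAlgebra.nonneg_iff_eq_star_mul_self.mp hT.nonneg

variable {ι κ l : Type}

lemma MSqIntegrable.ite {α : Type*} [MeasurableSpace α] {μ : Measure α} {P : α → Prop}
    [DecidablePred P] (hP : MeasurableSet {x | P x}) {F G : α → Matrix ι κ ℝ}
    (hF : MSqIntegrable μ F) (hG : MSqIntegrable μ G) :
    MSqIntegrable μ fun x => if P x then F x else G x := fun i j => by
  refine (((hF i j).indicator hP).add ((hG i j).indicator hP.compl)).ae_eq (.of_forall fun x => ?_)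
  by_cases h : P x <;> simp [h]

lemma mInt_add_adjacent {L : ℝ} {F : ℝ → Matrix ι κ ℝ} (hF : MIntegrable (segMeasure L) F)
    {a b c : ℝ} (ha : a ∈ Icc 0 L) (hb : b ∈ Icc 0 L) (hc : c ∈ Icc 0 L) :
    mInt a c F = mInt b c F + mInt a b F := by
  rw [add_comm]
  ext i j
  exact (intervalIntegral.integral_add_adjacent_intervals (hF.intervalIntegrable ha hb i j)
    (hF.intervalIntegrable hb hc i j)).symm

lemma mI_const {L : ℝ} (hL : 0 ≤ L) (C : Matrix ι κ ℝ) : mI (segMeasure L) (fun _ => C) = L • C := by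
  ext i j
  simp [mI_apply, hL]

lemma MSqIntegrable.bilin_mIntegrable {α β : Type*} [MeasurableSpace α] [MeasurableSpace β]
    {μ : Measure α} {ν : Measure β} [SFinite μ] [SFinite ν] [Fintype ι] [Fintype κ]
    {Ψ : α → β → Matrix ι κ ℝ} (hΨ : MSqIntegrable (μ.prod ν) fun p => Ψ p.1 p.2)
    {a : α → Matrix ι Unit ℝ} (ha : MSqIntegrable μ a) {b : β → Matrix κ Unit ℝ}
    (hb : MSqIntegrable ν b) :
    MIntegrable (μ.prod ν) fun p => (a p.1)ᵀ * Ψ p.1 p.2 * b p.2 := fun i j => by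
  simp only [Matrix.mul_apply, Finset.sum_mul]
  refine integrable_finsetSum _ fun k _ => integrable_finsetSum _ fun k' _ => ?_
  refine ((hΨ k' k).integrable_mul (memLp_two_mul_prod (ha k' i) (hb k j))).congr
    (.of_forall fun p => ?_)
  simp only [Pi.mul_apply, Matrix.transpose_apply]
  ring

lemma mIntegrable_gram {α β : Type*} [MeasurableSpace α] [MeasurableSpace β]
    {μ : Measure α} {ν : Measure β} [IsFiniteMeasure μ] [SFinite ν] [Fintype ι] [Fintype κ]
    {Ψ : α → β → Matrix ι κ ℝ} (hΨ : MSqIntegrable (μ.prod ν) fun p => Ψ p.1 p.2)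
    {v : β → Matrix κ Unit ℝ} (hv : MSqIntegrable ν v) :
    MIntegrable (ν.prod ν) fun p =>
      (v p.1)ᵀ * (mI μ fun x => (Ψ x p.1)ᵀ * Ψ x p.2) * v p.2 := by
  refine (hΨ.gram_integrable hv).mI_left.congr ?_
  filter_upwards [Measure.quasiMeasurePreserving_fst.ae hΨ.ae_left,
    Measure.quasiMeasurePreserving_snd.ae hΨ.ae_left] with p h₁ h₂
  have h := h₁.transpose.mul h₂
  rw [← mI_mul_left _ h, ← mI_mul_right _ (h.mul_left _)]
  rfl

end

/-! ### Positivity of the forms defined by `Φ₁` and `Φ₂` -/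

section Phi

variable {n d₁ d₂ : ℕ} {L : ℝ}

/-- The embeddings of the three blocks as matrices. -/
def emb1 (d₁ d₂ : ℕ) : Matrix (Fin d₁ ⊕ Fin d₂ ⊕ Fin d₂) (Fin d₁) ℝ :=
  (1 : Matrix (Fin d₁ ⊕ Fin d₂ ⊕ Fin d₂) (Fin d₁ ⊕ Fin d₂ ⊕ Fin d₂) ℝ).submatrix id blk1

def emb2 (d₁ d₂ : ℕ) : Matrix (Fin d₁ ⊕ Fin d₂ ⊕ Fin d₂) (Fin d₂) ℝ :=
  (1 : Matrix (Fin d₁ ⊕ Fin d₂ ⊕ Fin d₂) (Fin d₁ ⊕ Fin d₂ ⊕ Fin d₂) ℝ).submatrix id blk2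

def emb3 (d₁ d₂ : ℕ) : Matrix (Fin d₁ ⊕ Fin d₂ ⊕ Fin d₂) (Fin d₂) ℝ :=
  (1 : Matrix (Fin d₁ ⊕ Fin d₂ ⊕ Fin d₂) (Fin d₁ ⊕ Fin d₂ ⊕ Fin d₂) ℝ).submatrix id blk3

lemma submatrix_one_transpose_mul_mul {ι κ l : Type} [Fintype ι] [DecidableEq ι] (T : Matrix ι ι ℝ)
    (e : κ → ι) (f : l → ι) :
    ((1 : Matrix ι ι ℝ).submatrix id e)ᵀ * T * (1 : Matrix ι ι ℝ).submatrix id f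
      = T.submatrix e f := by
  ext i j
  simp [Matrix.mul_apply, Matrix.one_apply]

variable {T : Matrix (Fin d₁ ⊕ Fin d₂ ⊕ Fin d₂) (Fin d₁ ⊕ Fin d₂ ⊕ Fin d₂) ℝ}
  {Z : ℝ → ℝ → Matrix (Fin d₂) (Fin n) ℝ}

variable (d₁) in
/-- The kernel which puts `Z(β,θ)` into the second block for `θ ≤ β` and into the third block for
`β < θ`. -/
def splitKernel (Z : ℝ → ℝ → Matrix (Fin d₂) (Fin n) ℝ) (β θ : ℝ) :
    Matrix (Fin d₁ ⊕ Fin d₂ ⊕ Fin d₂) (Fin n) ℝ :=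
  if θ ≤ β then emb2 d₁ d₂ * Z β θ else emb3 d₁ d₂ * Z β θ

lemma splitKernel_of_le {β θ : ℝ} (h : θ ≤ β) : splitKernel d₁ Z β θ = emb2 d₁ d₂ * Z β θ :=
  if_pos h

lemma splitKernel_of_lt {β θ : ℝ} (h : β < θ) : splitKernel d₁ Z β θ = emb3 d₁ d₂ * Z β θ :=
  if_neg (not_le.2 h)

lemma SqInt2.mSqIntegrable (hZ : SqInt2 L Z) :
    MSqIntegrable ((segMeasure L).prod (segMeasure L)) fun p => Z p.1 p.2 := fun i j => by
  rw [Measure.prod_restrict]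
  exact hZ i j

lemma mSqIntegrable_splitKernel (hZ : SqInt2 L Z) :
    MSqIntegrable ((segMeasure L).prod (segMeasure L)) fun p => splitKernel d₁ Z p.1 p.2 :=
  .ite (measurableSet_le measurable_snd measurable_fst) (hZ.mSqIntegrable.mul_left _)
    (hZ.mSqIntegrable.mul_left _)

lemma transpose_mul_emb {κ l r t : Type} [Fintype κ] [Fintype l] (X : Matrix κ r ℝ)
    (Y : Matrix l t ℝ) (e : κ → Fin d₁ ⊕ Fin d₂ ⊕ Fin d₂) (f : l → Fin d₁ ⊕ Fin d₂ ⊕ Fin d₂) :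
    ((1 : Matrix (Fin d₁ ⊕ Fin d₂ ⊕ Fin d₂) (Fin d₁ ⊕ Fin d₂ ⊕ Fin d₂) ℝ).submatrix id e * X)ᵀ
        * T * ((1 : Matrix (Fin d₁ ⊕ Fin d₂ ⊕ Fin d₂) (Fin d₁ ⊕ Fin d₂ ⊕ Fin d₂) ℝ).submatrix id f
          * Y) = Xᵀ * T.submatrix e f * Y := by
  rw [← submatrix_one_transpose_mul_mul T e f, Matrix.transpose_mul]
  simp only [Matrix.mul_assoc]

variable (T Z L) in
/-- The kernel of `Ψ* T Ψ` for `Ψ = splitKernel Z`. -/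
def splitGram (s θ : ℝ) : Matrix (Fin n) (Fin n) ℝ :=
  mI (segMeasure L) fun β => (splitKernel d₁ Z β s)ᵀ * T * splitKernel d₁ Z β θ

/-- For θ ≤ s the variable β meets three ranges: above s both factors use the second block, between
θ and s the left one uses the third and the right one the second, below θ both use the third. The
sections are assumed square integrable because this holds only for almost every parameter. -/
lemma splitGram_of_le {s θ : ℝ} (hs : s ∈ Icc 0 L) (hθ : θ ∈ Icc 0 L) (h : θ ≤ s)
    (h₁ : MSqIntegrable (segMeasure L) fun β => splitKernel d₁ Z β s)
    (h₂ : MSqIntegrable (segMeasure L) fun β => splitKernel d₁ Z β θ) :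
    splitGram L T Z s θ = gramInt (T.submatrix blk2 blk2) Z s θ s L
      + gramInt (T.submatrix blk3 blk2) Z s θ θ s + gramInt (T.submatrix blk3 blk3) Z s θ 0 θ := by
  have h0 : 0 ∈ Icc 0 L := ⟨le_rfl, hs.1.trans hs.2⟩
  have hI : MIntegrable (segMeasure L)
      fun β => (splitKernel d₁ Z β s)ᵀ * T * splitKernel d₁ Z β θ := by
    simpa only [Matrix.mul_assoc] using h₁.transpose.mul (h₂.mul_left T)
  rw [splitGram, mI_eq_mInt_add hI hs, mInt_add_adjacent hI h0 hθ hs, ← add_assoc]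
  congr 1
  · congr 1
    · refine mInt_congr_Ioo hs.2 fun x hx => ?_
      rw [splitKernel_of_le hx.1.le, splitKernel_of_le (h.trans hx.1.le)]
      exact transpose_mul_emb _ _ blk2 blk2
    · refine mInt_congr_Ioo h fun x hx => ?_
      rw [splitKernel_of_lt hx.2, splitKernel_of_le hx.1.le]
      exact transpose_mul_emb _ _ blk3 blk2
  · refine mInt_congr_Ioo hθ.1 fun x hx => ?_
    rw [splitKernel_of_lt (hx.2.trans_le h), splitKernel_of_lt hx.2]
    exact transpose_mul_emb _ _ blk3 blk3

lemma splitGram_of_ge {s θ : ℝ} (hs : s ∈ Icc 0 L) (hθ : θ ∈ Icc 0 L) (h : s ≤ θ)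
    (h₁ : MSqIntegrable (segMeasure L) fun β => splitKernel d₁ Z β s)
    (h₂ : MSqIntegrable (segMeasure L) fun β => splitKernel d₁ Z β θ) :
    splitGram L T Z s θ = gramInt (T.submatrix blk2 blk2) Z s θ θ L
      + gramInt (T.submatrix blk2 blk3) Z s θ s θ + gramInt (T.submatrix blk3 blk3) Z s θ 0 s := by
  have h0 : 0 ∈ Icc 0 L := ⟨le_rfl, hs.1.trans hs.2⟩
  have hI : MIntegrable (segMeasure L)
      fun β => (splitKernel d₁ Z β s)ᵀ * T * splitKernel d₁ Z β θ := by
    simpa only [Matrix.mul_assoc] using h₁.transpose.mul (h₂.mul_left T)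
  rw [splitGram, mI_eq_mInt_add hI hθ, mInt_add_adjacent hI h0 hs hθ, ← add_assoc]
  congr 1
  · congr 1
    · refine mInt_congr_Ioo hθ.2 fun x hx => ?_
      rw [splitKernel_of_le hx.1.le, splitKernel_of_le (h.trans hx.1.le)]
      exact transpose_mul_emb _ _ blk2 blk2
    · refine mInt_congr_Ioo h fun x hx => ?_
      rw [splitKernel_of_lt hx.2, splitKernel_of_le hx.1.le]
      exact transpose_mul_emb _ _ blk2 blk3
  · refine mInt_congr_Ioo hs.1 fun x hx => ?_
    rw [splitKernel_of_lt (hx.2.trans_le h), splitKernel_of_lt hx.2]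
    exact transpose_mul_emb _ _ blk3 blk3

lemma mI_transpose_mul_splitKernel
    {R : Matrix (Fin d₁ ⊕ Fin d₂ ⊕ Fin d₂) (Fin d₁ ⊕ Fin d₂ ⊕ Fin d₂) ℝ}
    (hR : T = Rᵀ * R) (s θ : ℝ) :
    mI (segMeasure L) (fun x => (R * splitKernel d₁ Z x s)ᵀ * (R * splitKernel d₁ Z x θ))
      = splitGram L T Z s θ := by
  rw [splitGram, hR]
  simp only [Matrix.transpose_mul, Matrix.mul_assoc]

/-- The quadratic form of an element of `Φ₁` is nonnegative. -/
lemma Phi1.form_nonneg {m : ℕ} (hL : 0 ≤ L) {K} (hK : K ∈ Phi1 n m L) (W : Matrix (Fin m) Unit ℝ)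
    {v : ℝ → Matrix (Fin n) Unit ℝ} (hv : MSqIntegrable (segMeasure L) v) :
    0 ≤ (L • (Wᵀ * K.1 * W) + (2 : ℝ) • mI (segMeasure L) (fun θ => Wᵀ * K.2.1 θ * v θ)
      + mI (segMeasure L) fun s => mI (segMeasure L) fun θ =>
        (v s)ᵀ * joinKernel K.2.2.1 K.2.2.2 s θ * v θ) () () := by
  obtain ⟨d, Z, T, hZ, hT, h₁, h₂, h₃, h₄⟩ := hK
  -- With T = RᵀR the form is the integral over β of |R(E₁W + ∫ Ψ(β,θ) v(θ) dθ)|²; the three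
  -- identities below match its square, cross and Gram terms with P, Q and the kernels.
  obtain ⟨R, hR⟩ := exists_eq_transpose_mul_self hT
  have hS := mSqIntegrable_splitKernel (d₁ := m) hZ
  have hΨ : MSqIntegrable ((segMeasure L).prod (segMeasure L))
    fun p => R * splitKernel m Z p.1 p.2 := hS.mul_left R
  -- The `W` component does not depend on β, so its square integrates to `L` times a constant.
  have hU : MSqIntegrable (segMeasure L) fun _ => R * (emb1 m d * W) :=
    fun i j => memLp_const _
  have key := mI_sq_add_nonneg (Ψ := fun β θ => R * splitKernel m Z β θ) hU hΨ hv
  have e₁ : mI (segMeasure L) (fun _ => (R * (emb1 m d * W))ᵀ * (R * (emb1 m d * W)))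
      = L • (Wᵀ * K.1 * W) := by
    rw [mI_const hL, h₁, ← transpose_mul_emb W W blk1 blk1, hR, Matrix.transpose_mul R]
    simp only [Matrix.mul_assoc]
    rfl
  have e₂ : mI (segMeasure L) (fun x => (R * (emb1 m d * W))ᵀ *
        mI (segMeasure L) fun y => R * splitKernel m Z x y * v y)
      = mI (segMeasure L) fun θ => Wᵀ * K.2.1 θ * v θ := by
    have hI₀ := hΨ.mul_snd (Ψ := fun β θ => R * splitKernel m Z β θ) hv
    have hI : MIntegrable ((segMeasure L).prod (segMeasure L)) fun p =>
        (R * (emb1 m d * W))ᵀ * (R * splitKernel m Z p.1 p.2 * v p.2) := hI₀.mul_left _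
    have e : mI (segMeasure L) (fun x => (R * (emb1 m d * W))ᵀ *
          mI (segMeasure L) fun y => R * splitKernel m Z x y * v y)
        = mI (segMeasure L) fun x => mI (segMeasure L) fun y =>
          (R * (emb1 m d * W))ᵀ * (R * splitKernel m Z x y * v y) := by
      refine mI_congr_ae ?_
      filter_upwards [MIntegrable.ae_right (F := fun x y => R * splitKernel m Z x y * v y) hI₀]
        with x hx
      rw [mI_mul_left _ hx]
    rw [e, mI_swap (F := fun x y => (R * (emb1 m d * W))ᵀ * (R * splitKernel m Z x y * v y)) hI]
    refine mI_congr_ae ?_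
    filter_upwards [hS.ae_left, ae_restrict_mem measurableSet_Icc] with θ hθ hθI
    have hF : MIntegrable (segMeasure L) fun β => (emb1 m d)ᵀ * T * splitKernel m Z β θ :=
      hθ.mIntegrable.mul_left _
    have eQ : K.2.1 θ = mI (segMeasure L) fun β => (emb1 m d)ᵀ * T * splitKernel m Z β θ := by
      rw [h₂ θ hθI]
      refine mInt_add_mInt_eq_mI hF hθI (fun x hx => ?_) fun x hx => ?_
      · rw [splitKernel_of_le hx, ← submatrix_one_transpose_mul_mul T, Matrix.mul_assoc,
          Matrix.mul_assoc, Matrix.mul_assoc]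
        rfl
      · rw [splitKernel_of_lt hx, ← submatrix_one_transpose_mul_mul T, Matrix.mul_assoc,
          Matrix.mul_assoc, Matrix.mul_assoc]
        rfl
    rw [eQ, ← mI_mul_left _ hF, ← mI_mul_right _ (hF.mul_left _), hR]
    simp only [Matrix.transpose_mul, Matrix.mul_assoc]
  have e₃ : (mI (segMeasure L) fun s => mI (segMeasure L) fun θ =>
        (v s)ᵀ * (mI (segMeasure L) fun x =>
          (R * splitKernel m Z x s)ᵀ * (R * splitKernel m Z x θ)) * v θ)
      = mI (segMeasure L) fun s => mI (segMeasure L) fun θ =>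
        (v s)ᵀ * joinKernel K.2.2.1 K.2.2.2 s θ * v θ := by
    refine mI_congr_ae ?_
    filter_upwards [hS.ae_left, ae_restrict_mem measurableSet_Icc] with s hs hsI
    refine mI_congr_ae ?_
    filter_upwards [hS.ae_left, ae_restrict_mem measurableSet_Icc] with θ hθ hθI
    rw [mI_transpose_mul_splitKernel hR]
    unfold joinKernel
    split_ifs with h
    · rw [h₃ s θ hθI.1 h hsI.2, splitGram_of_le hsI hθI h hs hθ]
    · have h' := (not_le.1 h).le
      rw [h₄ s θ hsI.1 h' hθI.2, splitGram_of_ge hsI hθI h' hs hθ]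
  rwa [e₁, e₂, e₃] at key

/-- A diagonal entry of UᵀU is the sum of the squares of a column, and t² ≤ C implies t ≤ C + 1. It
turns boundedness of the multiplier into boundedness of its factor. -/
lemma abs_le_of_transpose_mul_self_le {D : Type} [Fintype D] {U : Matrix D (Fin n) ℝ} {i : Fin n}
    {C : ℝ} (hC : |(Uᵀ * U) i i| ≤ C) (d : D) : |U d i| ≤ C + 1 := by
  have h : U d i ^ 2 ≤ (Uᵀ * U) i i := by
    simp only [Matrix.mul_apply, Matrix.transpose_apply, ← pow_two]
    exact Finset.single_le_sum (f := fun d => U d i ^ 2) (fun _ _ => sq_nonneg _)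
      (Finset.mem_univ d)
  have h' := h.trans ((le_abs_self _).trans hC)
  rw [← sq_abs] at h'
  nlinarith [abs_nonneg (U d i), sq_nonneg (|U d i| - 1)]

/-- The quadratic form of an element of `Φ₂` is nonnegative. -/
lemma Phi2.form_nonneg {K} (hK : K ∈ Phi2 n L) (hM : BddKernel L fun _ s => K.1 s) (hL : 0 ≤ L)
    {v : ℝ → Matrix (Fin n) Unit ℝ} (hv : MSqIntegrable (segMeasure L) v) :
    0 ≤ (mI (segMeasure L) (fun s => (v s)ᵀ * K.1 s * v s)
      + mI (segMeasure L) fun s => mI (segMeasure L) fun θ =>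
        (v s)ᵀ * joinKernel K.2.1 K.2.2 s θ * v θ) () () := by
  obtain ⟨d₁, d₂, Z₁, Z, T, hZ₁, hZ, hT, h₁, h₂, h₃⟩ := hK
  obtain ⟨R, hR⟩ := exists_eq_transpose_mul_self hT
  have hS := mSqIntegrable_splitKernel (d₁ := d₁) hZ
  set Ψ : ℝ → ℝ → Matrix (Fin d₁ ⊕ Fin d₂ ⊕ Fin d₂) (Fin n) ℝ :=
    fun β θ => R * splitKernel d₁ Z β θ with hΨdef
  have hΨ : MSqIntegrable ((segMeasure L).prod (segMeasure L)) fun p => Ψ p.1 p.2 :=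
    hS.mul_left R
  set U : ℝ → Matrix (Fin d₁ ⊕ Fin d₂ ⊕ Fin d₂) (Fin n) ℝ :=
    fun s => R * (emb1 d₁ d₂ * Z₁ s) with hUdef
  have hUU : ∀ s ∈ Icc 0 L, (U s)ᵀ * U s = K.1 s := fun s hs => by
    rw [h₁ s hs, ← transpose_mul_emb (Z₁ s) (Z₁ s) blk1 blk1, hR, hUdef, Matrix.transpose_mul R]
    simp only [Matrix.mul_assoc]
    rfl
  have hU₂ : MSqIntegrable (segMeasure L) U :=
    MSqIntegrable.mul_left R (MSqIntegrable.mul_left _ hZ₁)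
  -- Two square integrable factors alone would not give a square integrable product. But UᵀU is the
  -- multiplier, which is bounded, so the entries of `U` are bounded on `[0, L]`.
  have hUv : MSqIntegrable (segMeasure L) fun s => U s * v s := fun d j => by
    simp only [Matrix.mul_apply]
    refine memLp_finsetSum _ fun i _ => ?_
    obtain ⟨C, hC⟩ := (hM i i).2
    have hb : MemLp (fun s => U s d i) ⊤ (segMeasure L) := by
      refine memLp_top_of_bound (hU₂ d i).1 (C + 1) ?_
      filter_upwards [ae_restrict_mem measurableSet_Icc] with s hs
      refine abs_le_of_transpose_mul_self_le ?_ d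
      rw [hUU s hs]
      exact hC 0 ⟨le_rfl, hL⟩ s hs
    exact (hv i j).mul hb
  have key := mI_sq_add_nonneg hUv hΨ hv
  have e₁ : mI (segMeasure L) (fun s => (U s * v s)ᵀ * (U s * v s))
      = mI (segMeasure L) fun s => (v s)ᵀ * K.1 s * v s := by
    refine mI_congr_ae ?_
    filter_upwards [ae_restrict_mem measurableSet_Icc] with s hs
    rw [← hUU s hs, Matrix.transpose_mul]
    simp only [Matrix.mul_assoc]
  have hI₁ : MIntegrable ((segMeasure L).prod (segMeasure L)) fun p =>
      (U p.1 * v p.1)ᵀ * Ψ p.1 p.2 * v p.2 := hΨ.bilin_mIntegrable hUv hv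
  have hI₂ : MIntegrable ((segMeasure L).prod (segMeasure L)) fun p =>
      (v p.1)ᵀ * (Ψ p.2 p.1)ᵀ * (U p.2 * v p.2) := by
    have h : MSqIntegrable ((segMeasure L).prod (segMeasure L)) fun p => (Ψ p.2 p.1)ᵀ :=
      fun i j => (hΨ j i).comp_measurePreserving Measure.measurePreserving_swap
    exact h.bilin_mIntegrable (Ψ := fun s θ => (Ψ θ s)ᵀ) hv hUv
  have hI₃ := mIntegrable_gram hΨ hv
  have e₂ : mI (segMeasure L) (fun s => (U s * v s)ᵀ * mI (segMeasure L) fun θ => Ψ s θ * v θ)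
      = mI (segMeasure L) fun s => mI (segMeasure L) fun θ =>
        (U s * v s)ᵀ * Ψ s θ * v θ := by
    refine mI_congr_ae ?_
    filter_upwards [MIntegrable.ae_right (F := fun x y => Ψ x y * v y) (hΨ.mul_snd hv)] with s hs
    rw [← mI_mul_left _ hs]
    simp only [Matrix.mul_assoc]
  have e₂' : (mI (segMeasure L) fun s => mI (segMeasure L) fun θ =>
        (U s * v s)ᵀ * Ψ s θ * v θ)
      = mI (segMeasure L) fun s => mI (segMeasure L) fun θ =>
        (v s)ᵀ * (Ψ θ s)ᵀ * (U θ * v θ) := by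
    -- A 1×1 matrix equals its transpose; with Fubini this makes the two cross terms equal.
    have h (A : Matrix Unit Unit ℝ) : A = Aᵀ := rfl
    rw [mI_swap (F := fun s θ => (v s)ᵀ * (Ψ θ s)ᵀ * (U θ * v θ)) hI₂, h (mI _ _), ← mI_transpose]
    congr 1
    funext s
    rw [← mI_transpose]
    simp only [Matrix.transpose_mul, Matrix.transpose_transpose, Matrix.mul_assoc]
  have e₃ : (mI (segMeasure L) fun s => mI (segMeasure L) fun θ =>
        (v s)ᵀ * joinKernel K.2.1 K.2.2 s θ * v θ)
      = (2 : ℝ) • mI (segMeasure L) (fun s => (U s * v s)ᵀ *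
          mI (segMeasure L) fun θ => Ψ s θ * v θ)
        + mI (segMeasure L) fun s => mI (segMeasure L) fun θ =>
          (v s)ᵀ * (mI (segMeasure L) fun x => (Ψ x s)ᵀ * Ψ x θ) * v θ := by
    have hsym (s θ : ℝ) : ((mI (segMeasure L) fun x => (Ψ x s)ᵀ * Ψ x θ))ᵀ
        = mI (segMeasure L) fun x => (Ψ x θ)ᵀ * Ψ x s := by
      rw [← mI_transpose]
      simp only [Matrix.transpose_mul, Matrix.transpose_transpose]
    -- The inequality is strict: Ψ(θ,s) must fall into the third block to reproduce the T₃₁ term,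
    -- and on the diagonal it would fall into the second. The diagonal is a null set.
    have hN (s θ : ℝ) (hs : s ∈ Icc 0 L) (hθ : θ ∈ Icc 0 L) (hlt : θ < s)
        (hs' : MSqIntegrable (segMeasure L) fun β => splitKernel d₁ Z β s)
        (hθ' : MSqIntegrable (segMeasure L) fun β => splitKernel d₁ Z β θ) :
        K.2.1 s θ = (U s)ᵀ * Ψ s θ + (Ψ θ s)ᵀ * U θ
          + mI (segMeasure L) fun x => (Ψ x s)ᵀ * Ψ x θ := by
      rw [mI_transpose_mul_splitKernel hR, splitGram_of_le hs hθ hlt.le hs' hθ',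
        h₂ s θ hθ.1 hlt.le hs.2, ← transpose_mul_emb (Z₁ s) (Z s θ) blk1 blk2,
        ← transpose_mul_emb (Z θ s) (Z₁ θ) blk3 blk1]
      simp only [hΨdef, hUdef, splitKernel_of_le hlt.le, splitKernel_of_lt hlt,
        Matrix.transpose_mul R]
      rw [hR]
      simp only [Matrix.mul_assoc, ← add_assoc]
      rfl
    have hsum : ((2 : ℝ) • mI (segMeasure L) fun s => mI (segMeasure L) fun θ =>
        (U s * v s)ᵀ * Ψ s θ * v θ) = (mI (segMeasure L) fun s => mI (segMeasure L) fun θ =>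
        (U s * v s)ᵀ * Ψ s θ * v θ) + mI (segMeasure L) fun s => mI (segMeasure L) fun θ =>
        (v s)ᵀ * (Ψ θ s)ᵀ * (U θ * v θ) := by
      rw [two_smul]
      congr 1
    have p₁ := mI_prod (F := fun s θ => (U s * v s)ᵀ * Ψ s θ * v θ) hI₁
    have p₂ := mI_prod (F := fun s θ => (v s)ᵀ * (Ψ θ s)ᵀ * (U θ * v θ)) hI₂
    have p₃ := mI_prod (F := fun s θ =>
      (v s)ᵀ * (mI (segMeasure L) fun x => (Ψ x s)ᵀ * Ψ x θ) * v θ) hI₃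
    have p := mI_prod (F := fun s θ => (U s * v s)ᵀ * Ψ s θ * v θ
      + (v s)ᵀ * (Ψ θ s)ᵀ * (U θ * v θ)
      + (v s)ᵀ * (mI (segMeasure L) fun x => (Ψ x s)ᵀ * Ψ x θ) * v θ) ((hI₁.add hI₂).add hI₃)
    rw [e₂, hsum, ← p₁, ← p₂, ← p₃, ← mI_add hI₁ hI₂, ← mI_add (hI₁.add hI₂) hI₃, p]
    refine mI_congr_ae ?_
    filter_upwards [hS.ae_left, ae_restrict_mem measurableSet_Icc] with s hs hsI
    refine mI_congr_ae ?_
    filter_upwards [hS.ae_left, ae_restrict_mem measurableSet_Icc,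
      ae_restrict_of_ae (Measure.ae_ne volume s)] with θ hθ hθI hne
    have e : joinKernel K.2.1 K.2.2 s θ = (U s)ᵀ * Ψ s θ + (Ψ θ s)ᵀ * U θ
          + mI (segMeasure L) fun x => (Ψ x s)ᵀ * Ψ x θ := by
      unfold joinKernel
      split_ifs with h
      · exact hN s θ hsI hθI (lt_of_le_of_ne h hne) hs hθ
      · rw [h₃ s θ hsI.1 (not_le.1 h).le hθI.2, hN θ s hθI hsI (not_le.1 h) hθ hs]
        simp only [Matrix.transpose_add, hsym, Matrix.transpose_mul, Matrix.transpose_transpose]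
        abel
    rw [e]
    simp only [Matrix.transpose_mul, Matrix.mul_add, Matrix.add_mul, Matrix.mul_assoc]
  rw [e₃, ← add_assoc, ← e₁]
  exact key

end Phi

/-! ### Essentially bounded coefficients and the form of `P`. -/

section

variable {ι κ l : Type} {L : ℝ}

/-- Bounded kernels are required to be measurable and bounded pointwise. A coefficient is
essentially bounded only, and under an integral it may be replaced by such a representative. -/
lemma EssBdd.exists_bddKernel {A : ℝ → Matrix ι κ ℝ} (hA : EssBdd L A) :
    ∃ A' : ℝ → Matrix ι κ ℝ, BddKernel L (fun _ η => A' η) ∧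
      ∀ i j, ∀ᵐ s ∂(segMeasure L), A s i j = A' s i j := by
  have h (i : ι) (j : κ) : ∃ f : ℝ → ℝ, Measurable f ∧ (∃ C, ∀ s, |f s| ≤ C) ∧
      ∀ᵐ s ∂(segMeasure L), A s i j = f s := by
    obtain ⟨hm, hC⟩ := hA i j
    set C := (eLpNorm (fun s => A s i j) ⊤ (segMeasure L)).toReal with hCdef
    -- A measurable version is set to zero where it exceeds the essential supremum, which changes it
    -- on a null set only.
    refine ⟨fun s => if |hm.mk _ s| ≤ C then hm.mk _ s else 0, ?_, ⟨C, fun s => ?_⟩, ?_⟩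
    · have := hm.stronglyMeasurable_mk.measurable
      exact this.ite (measurableSet_le (by fun_prop) measurable_const) measurable_const
    · beta_reduce
      split_ifs with h
      · exact h
      · simp [hCdef]
    · have hb := ae_le_eLpNormEssSup (f := fun s => A s i j) (μ := segMeasure L)
      filter_upwards [hm.ae_eq_mk, hb] with s h₁ h₂
      have h₃ : |A s i j| ≤ C := by
        rw [hCdef, eLpNorm_exponent_top] at *
        have := ENNReal.toReal_mono hC.ne h₂
        simpa using this
      rw [← h₁, if_pos h₃]
  choose f hf hC he using h
  exact ⟨fun s => Matrix.of fun i j => f i j s,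
    fun i j => ⟨(hf i j).comp measurable_snd, (hC i j).imp fun C hC _ _ s _ => hC s⟩, he⟩

lemma EssBdd.ae_eq [Countable ι] [Countable κ] {A A' : ℝ → Matrix ι κ ℝ}
    (h : ∀ i j, ∀ᵐ s ∂(segMeasure L), A s i j = A' s i j) : A =ᵐ[segMeasure L] A' := by
  have : ∀ᵐ s ∂(segMeasure L), ∀ i j, A s i j = A' s i j := by simpa only [ae_all_iff] using h
  filter_upwards [this] with s hs
  ext i j
  exact hs i j

lemma EssBdd.mul_mIntegrable [Countable ι] [Fintype κ] {A : ℝ → Matrix ι κ ℝ} (hA : EssBdd L A)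
    (hL : 0 ≤ L) {B : ℝ → Matrix κ l ℝ} (hB : MIntegrable (segMeasure L) B) :
    MIntegrable (segMeasure L) fun s => A s * B s := by
  obtain ⟨A', hA', he⟩ := hA.exists_bddKernel
  refine (hA'.mul_mIntegrable (s := 0) ⟨le_rfl, hL⟩ hB).congr ?_
  filter_upwards [EssBdd.ae_eq he] with s hs
  rw [hs]

lemma joinKernel_neg (N₁ N₂ : ℝ → ℝ → Matrix ι κ ℝ) (s θ : ℝ) :
    joinKernel (-N₁) (-N₂) s θ = -joinKernel N₁ N₂ s θ := by
  unfold joinKernel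
  split_ifs <;> rfl

/-- `⟨X, P F⟩` for the operator `P` with multiplier `M` and kernel `N`. -/
def pForm [Fintype ι] (L : ℝ) (M : ℝ → Matrix ι ι ℝ) (N : ℝ → ℝ → Matrix ι ι ℝ)
    (X F : ℝ → Matrix ι Unit ℝ) : Matrix Unit Unit ℝ :=
  mI (segMeasure L) fun s => (X s)ᵀ * (M s * F s + mI (segMeasure L) fun θ => N s θ * F θ)

end

/-! ### Kernel calculus for the storage form. -/

namespace PDESystem

variable {n m q : ℕ} (S : PDESystem n m q) {M : ℝ → Matrix (Fin n) (Fin n) ℝ}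
  {N₁ N₂ : ℝ → ℝ → Matrix (Fin n) (Fin n) ℝ} {U U' v F : ℝ → Matrix (Fin n) Unit ℝ}
  {W : Matrix (Fin m) Unit ℝ}

/-- Since U = Gv, moving G to the other side gives ⟨Gv, PF⟩ = ⟨v, G*PF⟩, and κ is the kernel of G*P.
-/
lemma pForm_eq (hM : BddKernel S.L fun _ η => M η)
    (hN₁ : BddKernel S.L N₁) (hN₂ : BddKernel S.L N₂) (hv : MIntegrable (segMeasure S.L) v)
    (hF : MIntegrable (segMeasure S.L) F) (hL : 0 ≤ S.L)
    (hU : ∀ s ∈ Icc 0 S.L, U s = mI (segMeasure S.L) fun η => S.G1 s η * v η) :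
    pForm S.L M (joinKernel N₁ N₂) U F = mI (segMeasure S.L) fun s =>
      (v s)ᵀ * mI (segMeasure S.L) fun η => S.kap M N₁ N₂ s η * F η := by
  have hN := hN₁.join hN₂
  set Y : ℝ → Matrix (Fin n) Unit ℝ :=
    fun ζ => M ζ * F ζ + mI (segMeasure S.L) fun η => joinKernel N₁ N₂ ζ η * F η with hYdef
  have hY : MIntegrable (segMeasure S.L) Y :=
    (hM.mul_mIntegrable (s := 0) ⟨le_rfl, hL⟩ hF).add (hN.mul_mIntegrable_prod hF).mI_right
  have hI : MIntegrable ((segMeasure S.L).prod (segMeasure S.L)) fun p =>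
      (v p.1)ᵀ * (S.G1 p.2 p.1)ᵀ * Y p.2 :=
    S.bddKernel_G1.flip.transpose.mul_mul_mIntegrable_prod hv.transpose hY
  have e₁ : mI (segMeasure S.L) (fun s =>
        (v s)ᵀ * mI (segMeasure S.L) fun η => S.kap M N₁ N₂ s η * F η)
      = mI (segMeasure S.L) fun s => mI (segMeasure S.L) fun ζ =>
        (v s)ᵀ * (S.G1 ζ s)ᵀ * Y ζ := by
    refine mI_congr_ae ?_
    filter_upwards [ae_restrict_mem measurableSet_Icc] with s hs
    rw [kap, mI_leftKernel_mul S.bddKernel_G1 hM hN hF hs,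
      ← mI_mul_left _ (S.bddKernel_G1.flip.transpose.mul_mIntegrable hs hY)]
    simp only [Matrix.mul_assoc, hYdef]
  rw [e₁, mI_swap (F := fun s ζ => (v s)ᵀ * (S.G1 ζ s)ᵀ * Y ζ) hI]
  refine mI_congr_ae ?_
  filter_upwards [ae_restrict_mem measurableSet_Icc] with ζ hζ
  have h := (S.bddKernel_G1.mul_mIntegrable hζ hv).transpose
  simp only [Matrix.transpose_mul] at h
  rw [mI_mul_right _ h, hU ζ hζ, ← mI_transpose]
  simp only [Matrix.transpose_mul, hYdef]

/-- Associativity again, κA(Gv) = (κAG)v: a term of the right-hand side in x or x_s becomes one in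
x_ss. -/
lemma mI_kap_mul_mul {A : ℝ → Matrix (Fin n) (Fin n) ℝ} {G : ℝ → ℝ → Matrix (Fin n) (Fin n) ℝ}
    (hk : BddKernel S.L (S.kap M N₁ N₂)) (hA : MIntegrable (segMeasure S.L) A)
    (hG : BddKernel S.L G) (hv : MIntegrable (segMeasure S.L) v)
    (hU : ∀ s ∈ Icc 0 S.L, U s = mI (segMeasure S.L) fun η => G s η * v η)
    {s : ℝ} (hs : s ∈ Icc 0 S.L) :
    mI (segMeasure S.L) (fun η => S.kap M N₁ N₂ s η * (A η * U η))
      = mI (segMeasure S.L) fun θ =>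
        (mI (segMeasure S.L) fun η => S.kap M N₁ N₂ s η * (A η * G η θ)) * v θ := by
  have hI : MIntegrable ((segMeasure S.L).prod (segMeasure S.L)) fun p =>
      S.kap M N₁ N₂ s p.1 * A p.1 * G p.1 p.2 * v p.2 :=
    hG.mul_mul_mIntegrable_prod (hk.mul_mIntegrable hs hA) hv
  have e₁ : mI (segMeasure S.L) (fun η => S.kap M N₁ N₂ s η * (A η * U η))
      = mI (segMeasure S.L) fun η => mI (segMeasure S.L) fun θ =>
        S.kap M N₁ N₂ s η * A η * G η θ * v θ := by
    refine mI_congr_ae ?_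
    filter_upwards [ae_restrict_mem measurableSet_Icc] with η hη
    rw [hU η hη, ← Matrix.mul_assoc, ← mI_mul_left _ (hG.mul_mIntegrable hη hv)]
    simp only [Matrix.mul_assoc]
  rw [e₁, mI_swap (F := fun η θ => S.kap M N₁ N₂ s η * A η * G η θ * v θ) hI]
  refine mI_congr_ae ?_
  filter_upwards [ae_restrict_mem measurableSet_Icc] with θ hθ
  have h := (hG.flip.transpose.mul_mIntegrable hθ (hk.mul_mIntegrable hs hA).transpose).transpose
  simp only [Matrix.transpose_mul, Matrix.transpose_transpose] at h
  rw [mI_mul_right _ h]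
  simp only [Matrix.mul_assoc]

lemma bddKernel_mI_kap {A : ℝ → Matrix (Fin n) (Fin n) ℝ} {G : ℝ → ℝ → Matrix (Fin n) (Fin n) ℝ}
    (hk : BddKernel S.L (S.kap M N₁ N₂)) (hA : EssBdd S.L A) (hG : BddKernel S.L G) :
    BddKernel S.L fun s θ => mI (segMeasure S.L) fun η => S.kap M N₁ N₂ s η * (A η * G η θ) := by
  obtain ⟨A', hA', he⟩ := hA.exists_bddKernel
  have e : (fun s θ => mI (segMeasure S.L) fun η => S.kap M N₁ N₂ s η * (A η * G η θ))
      = fun s θ => mI (segMeasure S.L) fun η => S.kap M N₁ N₂ s η * (A' η * G η θ) := by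
    funext s θ
    refine mI_congr_ae ?_
    filter_upwards [EssBdd.ae_eq he] with η hη
    rw [hη]
  rw [e]
  exact hk.comp (hA'.flip.mul hG)

lemma formKernel_mIntegrable (hA0 : EssBdd S.L S.A0) (hA1 : EssBdd S.L S.A1)
    (hA2 : EssBdd S.L S.A2) (hM : BddKernel S.L fun _ η => M η) (hN₁ : BddKernel S.L N₁)
    (hN₂ : BddKernel S.L N₂) (hL : 0 ≤ S.L) (hv : MIntegrable (segMeasure S.L) v) :
    MIntegrable ((segMeasure S.L).prod (segMeasure S.L)) fun p =>
      (v p.1)ᵀ * S.formKernel M N₁ N₂ p.1 p.2 * v p.2 := by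
  have hk := S.bddKernel_kap hM hN₁ hN₂
  -- In κA₂ the coefficient is not integrated out and is bounded only almost everywhere, so it is
  -- attached to the right-hand vector rather than to the kernel.
  have h₁ := hk.mul_mul_mIntegrable_prod hv.transpose (hA2.mul_mIntegrable hL hv)
  have h₂ := ((S.bddKernel_mI_kap hk hA1 S.bddKernel_G2).add
    (S.bddKernel_mI_kap hk hA0 S.bddKernel_G1)).mul_mul_mIntegrable_prod hv.transpose hv
  refine (h₁.add h₂).congr (.of_forall fun p => ?_)
  simp only [formKernel, Matrix.add_mul, Matrix.mul_add, Matrix.mul_assoc, add_assoc]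

end PDESystem

/-! ### The rate of the storage functional as a form in x_ss and w. -/

namespace PDESystem

variable {n m q : ℕ} (S : PDESystem n m q) {M : ℝ → Matrix (Fin n) (Fin n) ℝ}
  {N₁ N₂ : ℝ → ℝ → Matrix (Fin n) (Fin n) ℝ} {U U' v F : ℝ → Matrix (Fin n) Unit ℝ}
  {W : Matrix (Fin m) Unit ℝ}

/-- The action of `G₁* P` on the right-hand side of the equation. -/
lemma mI_kap_mul_rhs (hA0 : EssBdd S.L S.A0) (hA1 : EssBdd S.L S.A1) (hA2 : EssBdd S.L S.A2)
    (hB1 : EssBdd S.L S.B1) (hM : BddKernel S.L fun _ η => M η) (hN₁ : BddKernel S.L N₁)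
    (hN₂ : BddKernel S.L N₂) (hL : 0 ≤ S.L) (hv : MIntegrable (segMeasure S.L) v)
    (hUi : MIntegrable (segMeasure S.L) U) (hUi' : MIntegrable (segMeasure S.L) U')
    (hU : ∀ s ∈ Icc 0 S.L, U s = mI (segMeasure S.L) fun η => S.G1 s η * v η)
    (hU' : ∀ s ∈ Icc 0 S.L, U' s = mI (segMeasure S.L) fun η => S.G2 s η * v η)
    (hF : F =ᵐ[segMeasure S.L]
      fun s => S.A0 s * U s + S.A1 s * U' s + S.A2 s * v s + S.B1 s * W)
    {s : ℝ} (hs : s ∈ Icc 0 S.L) :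
    mI (segMeasure S.L) (fun η => S.kap M N₁ N₂ s η * F η)
      = mI (segMeasure S.L) (fun θ => S.formKernel M N₁ N₂ s θ * v θ)
        + mI (segMeasure S.L) (fun η => S.V M N₁ N₂ s η) * W := by
  have hk := S.bddKernel_kap hM hN₁ hN₂
  have h₀ := hk.mul_mIntegrable hs (hA0.mul_mIntegrable hL hUi)
  have h₁ := hk.mul_mIntegrable hs (hA1.mul_mIntegrable hL hUi')
  have h₂ := hk.mul_mIntegrable hs (hA2.mul_mIntegrable hL hv)
  have hb := hk.mul_mIntegrable hs hB1.mIntegrable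
  have g₁ := (S.bddKernel_mI_kap hk hA1 S.bddKernel_G2).mul_mIntegrable hs hv
  have g₀ := (S.bddKernel_mI_kap hk hA0 S.bddKernel_G1).mul_mIntegrable hs hv
  have e₁ : mI (segMeasure S.L) (fun η => S.kap M N₁ N₂ s η * F η)
      = mI (segMeasure S.L) fun η => S.kap M N₁ N₂ s η * (S.A2 η * v η)
        + S.kap M N₁ N₂ s η * (S.A1 η * U' η) + S.kap M N₁ N₂ s η * (S.A0 η * U η)
        + S.kap M N₁ N₂ s η * S.B1 η * W := by
    refine mI_congr_ae ?_
    filter_upwards [hF] with η hη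
    rw [hη]
    simp only [Matrix.mul_add, Matrix.mul_assoc]
    abel
  have e₂ : mI (segMeasure S.L) (fun η => S.V M N₁ N₂ s η)
      = mI (segMeasure S.L) fun η => S.kap M N₁ N₂ s η * S.B1 η := by
    refine mI_congr_ae ?_
    filter_upwards [ae_restrict_mem measurableSet_Icc] with η hη
    rw [S.V_eq hN₁ hN₂ hs hη]
  rw [e₁, mI_add ((h₂.add h₁).add h₀) (hb.mul_right W), mI_add (h₂.add h₁) h₀, mI_add h₂ h₁,
    S.mI_kap_mul_mul hk hA1.mIntegrable S.bddKernel_G2 hv hU' hs,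
    S.mI_kap_mul_mul hk hA0.mIntegrable S.bddKernel_G1 hv hU hs, mI_mul_right _ hb, e₂,
    ← mI_add h₂ g₁, ← mI_add (h₂.add g₁) g₀]
  simp only [formKernel, Matrix.add_mul, Matrix.mul_assoc]

lemma mIntegrable_mI_V (hB1 : EssBdd S.L S.B1) (hM : BddKernel S.L fun _ η => M η)
    (hN₁ : BddKernel S.L N₁) (hN₂ : BddKernel S.L N₂) (hv : MIntegrable (segMeasure S.L) v) :
    MIntegrable (segMeasure S.L) fun s =>
      (v s)ᵀ * mI (segMeasure S.L) fun η => S.V M N₁ N₂ s η := by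
  have hk := S.bddKernel_kap hM hN₁ hN₂
  have h := (hk.mul_mul_mIntegrable_prod hv.transpose hB1.mIntegrable).mI_right
    (F := fun s η => (v s)ᵀ * S.kap M N₁ N₂ s η * S.B1 η)
  refine h.congr ?_
  filter_upwards [ae_restrict_mem measurableSet_Icc] with s hs
  rw [← mI_mul_left _ ((hk.mul_mIntegrable hs hB1.mIntegrable).congr ?_)]
  · refine mI_congr_ae ?_
    filter_upwards [ae_restrict_mem measurableSet_Icc] with η hη
    rw [S.V_eq hN₁ hN₂ hs hη, Matrix.mul_assoc]
  · filter_upwards [ae_restrict_mem measurableSet_Icc] with η hη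
    rw [S.V_eq hN₁ hN₂ hs hη]

/-- The derivative of the storage functional along a solution, in terms of `x_ss` and `w`. -/
lemma pForm_rhs (hA0 : EssBdd S.L S.A0) (hA1 : EssBdd S.L S.A1) (hA2 : EssBdd S.L S.A2)
    (hB1 : EssBdd S.L S.B1) (hM : BddKernel S.L fun _ η => M η) (hN₁ : BddKernel S.L N₁)
    (hN₂ : BddKernel S.L N₂) (hL : 0 ≤ S.L) (hv : MIntegrable (segMeasure S.L) v)
    (hUi : MIntegrable (segMeasure S.L) U) (hUi' : MIntegrable (segMeasure S.L) U')
    (hU : ∀ s ∈ Icc 0 S.L, U s = mI (segMeasure S.L) fun η => S.G1 s η * v η)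
    (hU' : ∀ s ∈ Icc 0 S.L, U' s = mI (segMeasure S.L) fun η => S.G2 s η * v η)
    (hFi : MIntegrable (segMeasure S.L) F)
    (hF : F =ᵐ[segMeasure S.L]
      fun s => S.A0 s * U s + S.A1 s * U' s + S.A2 s * v s + S.B1 s * W) :
    pForm S.L M (joinKernel N₁ N₂) U F
      = (mI (segMeasure S.L) fun s => mI (segMeasure S.L) fun θ =>
          (v s)ᵀ * S.formKernel M N₁ N₂ s θ * v θ)
        + (mI (segMeasure S.L) fun s =>
          (v s)ᵀ * mI (segMeasure S.L) fun η => S.V M N₁ N₂ s η) * W := by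
  have hk := S.bddKernel_kap hM hN₁ hN₂
  have h₁ := S.formKernel_mIntegrable hA0 hA1 hA2 hM hN₁ hN₂ hL hv
  have h₂ := S.mIntegrable_mI_V hB1 hM hN₁ hN₂ hv
  rw [S.pForm_eq hM hN₁ hN₂ hv hFi hL hU, ← mI_mul_right _ h₂,
    ← mI_add (h₁.mI_right (F := fun s θ => (v s)ᵀ * S.formKernel M N₁ N₂ s θ * v θ))
      (h₂.mul_right W)]
  refine mI_congr_ae ?_
  filter_upwards [ae_restrict_mem measurableSet_Icc] with s hs
  have hi : MIntegrable (segMeasure S.L) fun θ => S.formKernel M N₁ N₂ s θ * v θ := by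
    have g := ((S.bddKernel_mI_kap hk hA1 S.bddKernel_G2).add
      (S.bddKernel_mI_kap hk hA0 S.bddKernel_G1)).mul_mIntegrable hs hv
    have g' := hk.mul_mIntegrable hs (hA2.mul_mIntegrable hL hv)
    refine (g'.add g).congr (.of_forall fun θ => ?_)
    simp only [formKernel, Matrix.add_mul, Matrix.mul_assoc, add_assoc]
  rw [S.mI_kap_mul_rhs hA0 hA1 hA2 hB1 hM hN₁ hN₂ hL hv hUi hUi' hU hU' hF hs, Matrix.mul_add,
    ← mI_mul_left _ hi]
  simp only [Matrix.mul_assoc]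

/-- The quadratic form of the symmetrized kernel. -/
lemma mI_symm_kernel (hA0 : EssBdd S.L S.A0) (hA1 : EssBdd S.L S.A1) (hA2 : EssBdd S.L S.A2)
    (hM : BddKernel S.L fun _ η => M η) (hN₁ : BddKernel S.L N₁)
    (hN₂ : BddKernel S.L N₂) (hL : 0 ≤ S.L) (hv : MIntegrable (segMeasure S.L) v)
    {r : ℕ} {C : ℝ → Matrix (Fin r) (Fin n) ℝ}
    (hC : MIntegrable (segMeasure S.L) fun s => C s * v s)
    {R₁ R₂ : ℝ → ℝ → Matrix (Fin n) (Fin n) ℝ}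
    (hR₁ : ∀ s θ, R₁ s θ = (S.H M N₁ N₂).1 s θ + ((S.H M N₁ N₂).2 θ s)ᵀ + (C s)ᵀ * C θ)
    (hR₂ : ∀ s θ, R₂ s θ = (R₁ θ s)ᵀ) :
    (mI (segMeasure S.L) fun s => mI (segMeasure S.L) fun θ =>
        (v s)ᵀ * joinKernel R₁ R₂ s θ * v θ)
      = (2 : ℝ) • (mI (segMeasure S.L) fun s => mI (segMeasure S.L) fun θ =>
          (v s)ᵀ * S.formKernel M N₁ N₂ s θ * v θ)
        + (mI (segMeasure S.L) fun s => C s * v s)ᵀ * mI (segMeasure S.L) fun s => C s * v s := by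
  have h₁ := S.formKernel_mIntegrable hA0 hA1 hA2 hM hN₁ hN₂ hL hv
  have h₂ : MIntegrable ((segMeasure S.L).prod (segMeasure S.L)) fun p =>
      (v p.1)ᵀ * (S.formKernel M N₁ N₂ p.2 p.1)ᵀ * v p.2 := fun i j => by
    refine ((h₁ j i).swap).congr (.of_forall fun p => ?_)
    change ((v p.2)ᵀ * S.formKernel M N₁ N₂ p.2 p.1 * v p.1)ᵀ i j = _
    simp only [Matrix.transpose_mul, Matrix.transpose_transpose, Matrix.mul_assoc]
  have h₃ : MIntegrable ((segMeasure S.L).prod (segMeasure S.L)) fun p =>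
      (v p.1)ᵀ * ((C p.1)ᵀ * C p.2) * v p.2 := by
    have := (BddKernel.const (L := S.L) (1 : Matrix (Fin r) (Fin r) ℝ)).mul_mul_mIntegrable_prod
      hC.transpose hC
    simpa only [Matrix.transpose_mul, Matrix.mul_one, Matrix.mul_assoc] using this
  have p₁ := mI_prod (F := fun s θ => (v s)ᵀ * S.formKernel M N₁ N₂ s θ * v θ) h₁
  have p₂ := mI_prod (F := fun s θ => (v s)ᵀ * (S.formKernel M N₁ N₂ θ s)ᵀ * v θ) h₂
  have p₃ := mI_prod (F := fun s θ => (v s)ᵀ * ((C s)ᵀ * C θ) * v θ) h₃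
  have p := mI_prod (F := fun s θ => (v s)ᵀ * S.formKernel M N₁ N₂ s θ * v θ
    + (v s)ᵀ * (S.formKernel M N₁ N₂ θ s)ᵀ * v θ + (v s)ᵀ * ((C s)ᵀ * C θ) * v θ)
    ((h₁.add h₂).add h₃)
  -- A kernel and its adjoint define the same quadratic form; this is the source of the factor 2.
  have e₂ : (mI (segMeasure S.L) fun s => mI (segMeasure S.L) fun θ =>
        (v s)ᵀ * (S.formKernel M N₁ N₂ θ s)ᵀ * v θ)
      = mI (segMeasure S.L) fun s => mI (segMeasure S.L) fun θ =>
        (v s)ᵀ * S.formKernel M N₁ N₂ s θ * v θ := by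
    have h (A : Matrix Unit Unit ℝ) : A = Aᵀ := rfl
    rw [mI_swap (F := fun s θ => (v s)ᵀ * (S.formKernel M N₁ N₂ θ s)ᵀ * v θ) h₂, h (mI _ _),
      ← mI_transpose]
    congr 1
    funext s
    rw [← mI_transpose]
    simp only [Matrix.transpose_mul, Matrix.transpose_transpose, Matrix.mul_assoc]
  have e₃ : (mI (segMeasure S.L) fun s => mI (segMeasure S.L) fun θ =>
        (v s)ᵀ * ((C s)ᵀ * C θ) * v θ)
      = (mI (segMeasure S.L) fun s => C s * v s)ᵀ * mI (segMeasure S.L) fun s => C s * v s := by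
    rw [← mI_transpose, ← mI_mul_right _ hC.transpose]
    congr 1
    funext s
    rw [← mI_mul_left _ hC]
    simp only [Matrix.transpose_mul, Matrix.mul_assoc]
  rw [two_smul, ← e₃]
  nth_rewrite 2 [← e₂]
  rw [← p₁, ← p₂, ← p₃, ← mI_add h₁ h₂, ← mI_add (h₁.add h₂) h₃, p]
  refine mI_congr_ae ?_
  filter_upwards [ae_restrict_mem measurableSet_Icc] with s hs
  refine mI_congr_ae ?_
  filter_upwards [ae_restrict_mem measurableSet_Icc,
    ae_restrict_of_ae (Measure.ae_ne volume s)] with θ hθ hne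
  -- If (s,θ) lies in one open triangle, then (θ,s) lies in the other. So H₁(s,θ) and H₂(θ,s) are
  -- the values of `formKernel` at the two mirror points.
  have e : joinKernel R₁ R₂ s θ = S.formKernel M N₁ N₂ s θ + (S.formKernel M N₁ N₂ θ s)ᵀ
      + (C s)ᵀ * C θ := by
    rw [← S.joinKernel_H hA0 hA1 hM hN₁ hN₂ hs hθ, ← S.joinKernel_H hA0 hA1 hM hN₁ hN₂ hθ hs]
    unfold joinKernel
    rcases lt_or_gt_of_ne hne with h | h
    · rw [if_pos h.le, if_pos h.le, if_neg (not_le.2 h), hR₁]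
    · rw [if_neg (not_le.2 h), if_neg (not_le.2 h), if_pos h.le, hR₂, hR₁]
      simp only [Matrix.transpose_add, Matrix.transpose_mul, Matrix.transpose_transpose]
      abel
  rw [e]
  simp only [Matrix.mul_add, Matrix.add_mul]

end PDESystem

lemma Phi1.form_nonpos {n m : ℕ} {L : ℝ} (hL : 0 ≤ L) {K} (hK : -K ∈ Phi1 n m L)
    (W : Matrix (Fin m) Unit ℝ) {v : ℝ → Matrix (Fin n) Unit ℝ}
    (hv : MSqIntegrable (segMeasure L) v) :
    (L • (Wᵀ * K.1 * W) + (2 : ℝ) • mI (segMeasure L) (fun θ => Wᵀ * K.2.1 θ * v θ)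
      + mI (segMeasure L) fun s => mI (segMeasure L) fun θ =>
        (v s)ᵀ * joinKernel K.2.2.1 K.2.2.2 s θ * v θ) () () ≤ 0 := by
  have h := Phi1.form_nonneg hL hK W hv
  simp only [Prod.fst_neg, Prod.snd_neg, Pi.neg_apply, joinKernel_neg, Matrix.mul_neg,
    Matrix.neg_mul, mI_neg, smul_neg, ← neg_add, Matrix.neg_apply] at h
  linarith

/-! ### The output operator and the dissipation identities. -/

namespace PDESystem

variable {n m q : ℕ} (S : PDESystem n m q) {M : ℝ → Matrix (Fin n) (Fin n) ℝ}
  {N₁ N₂ : ℝ → ℝ → Matrix (Fin n) (Fin n) ℝ} {U U' v F : ℝ → Matrix (Fin n) Unit ℝ}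
  {W : Matrix (Fin m) Unit ℝ}

lemma mI_mul_mI_kernel {C : ℝ → Matrix (Fin q) (Fin n) ℝ} {G : ℝ → ℝ → Matrix (Fin n) (Fin n) ℝ}
    (hC : MIntegrable (segMeasure S.L) C) (hG : BddKernel S.L G)
    (hv : MIntegrable (segMeasure S.L) v)
    (hU : ∀ s ∈ Icc 0 S.L, U s = mI (segMeasure S.L) fun η => G s η * v η) :
    MIntegrable (segMeasure S.L) (fun s => C s * U s) ∧
    MIntegrable (segMeasure S.L) (fun θ => (mI (segMeasure S.L) fun s => C s * G s θ) * v θ) ∧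
    mI (segMeasure S.L) (fun s => C s * U s)
      = mI (segMeasure S.L) fun θ => (mI (segMeasure S.L) fun s => C s * G s θ) * v θ := by
  have hI : MIntegrable ((segMeasure S.L).prod (segMeasure S.L)) fun p =>
      C p.1 * G p.1 p.2 * v p.2 := hG.mul_mul_mIntegrable_prod hC hv
  have e₁ : (fun s => mI (segMeasure S.L) fun θ => C s * G s θ * v θ) =ᵐ[segMeasure S.L]
      fun s => C s * U s := by
    filter_upwards [ae_restrict_mem measurableSet_Icc] with s hs
    rw [hU s hs, ← mI_mul_left _ (hG.mul_mIntegrable hs hv)]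
    simp only [Matrix.mul_assoc]
  have e₂ : (fun θ => mI (segMeasure S.L) fun s => C s * G s θ * v θ) =ᵐ[segMeasure S.L]
      fun θ => (mI (segMeasure S.L) fun s => C s * G s θ) * v θ := by
    filter_upwards [ae_restrict_mem measurableSet_Icc] with θ hθ
    have h := (hG.flip.transpose.mul_mIntegrable hθ hC.transpose).transpose
    simp only [Matrix.transpose_mul, Matrix.transpose_transpose] at h
    rw [mI_mul_right _ h]
  refine ⟨(hI.mI_right (F := fun s θ => C s * G s θ * v θ)).congr e₁,
    (hI.mI_left (F := fun s θ => C s * G s θ * v θ)).congr e₂, ?_⟩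
  rw [← mI_congr_ae e₁, ← mI_congr_ae e₂, mI_swap (F := fun s θ => C s * G s θ * v θ) hI]

lemma C3_mul_eq (hCa : EssBdd S.L S.Ca) (hCb : EssBdd S.L S.Cb) {θ : ℝ} (hθ : θ ∈ Icc 0 S.L) :
    S.C3 θ * v θ = S.C1 * S.bdryLift * (S.Bc θ * v θ)
      + S.C1 * (blockCol n ![0, S.L - θ, 0, 1] * v θ)
      + (mI (segMeasure S.L) fun s => S.Ca s * S.G1 s θ) * v θ
      + (mI (segMeasure S.L) fun s => S.Cb s * S.G2 s θ) * v θ := by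
  have h₁ := (S.bddKernel_G1.flip.transpose.mul_mIntegrable hθ hCa.mIntegrable.transpose).transpose
  have h₂ := (S.bddKernel_G2.flip.transpose.mul_mIntegrable hθ hCb.mIntegrable.transpose).transpose
  simp only [Matrix.transpose_mul, Matrix.transpose_transpose] at h₁ h₂
  rw [C3, mInt_eq_mI (hθ.1.trans hθ.2), mI_add h₁ h₂]
  simp only [Matrix.add_mul, Matrix.mul_add, Matrix.mul_assoc, add_assoc]

lemma mIntegrable_blockCol_mul (hL : 0 ≤ S.L) (hv : MIntegrable (segMeasure S.L) v) :
    MIntegrable (segMeasure S.L) fun θ => blockCol n ![0, S.L - θ, 0, 1] * v θ :=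
  (BddKernel.of_continuous (K := fun _ θ => blockCol n ![0, S.L - θ, 0, 1])
    (continuous_blockCol_sub.comp continuous_snd)).mul_mIntegrable (s := 0) ⟨le_rfl, hL⟩ hv

lemma C3_mul_mIntegrable (hCa : EssBdd S.L S.Ca) (hCb : EssBdd S.L S.Cb) (hL : 0 ≤ S.L)
    (hv : MIntegrable (segMeasure S.L) v) :
    MIntegrable (segMeasure S.L) fun θ => S.C3 θ * v θ := by
  have h₁ := S.mIntegrable_Bc_mul hL hv
  have h₂ := S.mIntegrable_blockCol_mul hL hv
  -- Only the integrability of the composed kernel applied to `v` is wanted, so `U` is taken to be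
  -- the integral itself.
  have h₃ := (S.mI_mul_mI_kernel hCa.mIntegrable S.bddKernel_G1 hv fun _ _ => rfl).2.1
  have h₄ := (S.mI_mul_mI_kernel hCb.mIntegrable S.bddKernel_G2 hv fun _ _ => rfl).2.1
  refine (((h₁.mul_left (S.C1 * S.bdryLift)).add (h₂.mul_left S.C1)).add h₃ |>.add h₄).congr ?_
  filter_upwards [ae_restrict_mem measurableSet_Icc] with θ hθ
  rw [S.C3_mul_eq hCa hCb hθ]

/-- The boundary values, the state and its derivative are all integrals of u_ss, and Fubini collects
their kernels into `C3`. -/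
lemma col_output (hCa : EssBdd S.L S.Ca) (hCb : EssBdd S.L S.Cb) (hL : 0 ≤ S.L)
    (hB : IsUnit S.B2.det) {u u' u'' : ℝ → EuclideanSpace ℝ (Fin n)}
    (h : S.InDomain u u' u'') (w : EuclideanSpace ℝ (Fin m)) :
    col (S.output u u' w)
      = mI (segMeasure S.L) (fun θ => S.C3 θ * col (u'' θ)) + S.D1 * col w := by
  have hv := h.1.mIntegrable
  have h₁ := S.mIntegrable_Bc_mul hL hv
  have h₂ := S.mIntegrable_blockCol_mul hL hv
  obtain ⟨i₃, h₃, e₃⟩ := S.mI_mul_mI_kernel (U := fun s => col (u s)) hCa.mIntegrable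
    S.bddKernel_G1 hv fun s hs => S.col_eq_mI_G1 hB h hs
  obtain ⟨i₄, h₄, e₄⟩ := S.mI_mul_mI_kernel (U := fun s => col (u' s)) hCb.mIntegrable
    S.bddKernel_G2 hv fun s hs => S.col_deriv_eq_mI_G2 hB h hs
  have e : mI (segMeasure S.L) (fun θ => S.C3 θ * col (u'' θ))
      = mI (segMeasure S.L) fun θ => S.C1 * S.bdryLift * (S.Bc θ * col (u'' θ))
      + S.C1 * (blockCol n ![0, S.L - θ, 0, 1] * col (u'' θ))
      + (mI (segMeasure S.L) fun s => S.Ca s * S.G1 s θ) * col (u'' θ)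
      + (mI (segMeasure S.L) fun s => S.Cb s * S.G2 s θ) * col (u'' θ) := by
    refine mI_congr_ae ?_
    filter_upwards [ae_restrict_mem measurableSet_Icc] with θ hθ
    rw [S.C3_mul_eq (v := fun θ => col (u'' θ)) hCa hCb hθ]
  have hint : Integrable (fun s => Matrix.toEuclideanLin (S.Ca s) (u s)
      + Matrix.toEuclideanLin (S.Cb s) (u' s)) (segMeasure S.L) :=
    mIntegrable_col.1 (i₃.add i₄)
  rw [output, col_add, col_add, col_toEuclideanLin, col_toEuclideanLin,
    col_intervalIntegral hint le_rfl hL le_rfl, mInt_eq_mI hL, S.col_boundaryVec hL h.1,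
    S.initCol_eq hB hL h, e, mI_add (((h₁.mul_left _).add (h₂.mul_left _)).add h₃) h₄,
    mI_add ((h₁.mul_left _).add (h₂.mul_left _)) h₃, mI_add (h₁.mul_left _) (h₂.mul_left _),
    mI_mul_left _ h₁, mI_mul_left _ h₂, ← e₃, ← e₄]
  simp only [col_add, col_toEuclideanLin]
  rw [mI_add i₃ i₄]
  simp only [Matrix.mul_add, Matrix.mul_assoc, add_assoc]

/-- The `V` part of Q is the coupling through `B1`. It appears transposed because Q acts from x_ss
to w, and as a scalar it equals its transpose. -/
lemma mI_cross (hB1 : EssBdd S.L S.B1) (hM : BddKernel S.L fun _ η => M η)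
    (hN₁ : BddKernel S.L N₁) (hN₂ : BddKernel S.L N₂) (hL : 0 ≤ S.L)
    (hv : MIntegrable (segMeasure S.L) v) {C : ℝ → Matrix (Fin m) (Fin n) ℝ}
    (hC : MIntegrable (segMeasure S.L) fun θ => C θ * v θ) :
    mI (segMeasure S.L) (fun θ => Wᵀ * (C θ + mInt 0 S.L fun η => (S.V M N₁ N₂ θ η)ᵀ) * v θ)
      = Wᵀ * mI (segMeasure S.L) (fun θ => C θ * v θ)
        + (mI (segMeasure S.L) fun s =>
          (v s)ᵀ * mI (segMeasure S.L) fun η => S.V M N₁ N₂ s η) * W := by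
  have h := S.mIntegrable_mI_V hB1 hM hN₁ hN₂ hv
  have ht (A : Matrix Unit Unit ℝ) : A = Aᵀ := rfl
  rw [ht (mI _ _ * W), Matrix.transpose_mul, ← mI_transpose, ← mI_mul_left _ hC,
    ← mI_mul_left _ h.transpose, ← mI_add (hC.mul_left _) (h.transpose.mul_left _)]
  congr 1
  funext θ
  rw [mInt_eq_mI hL, mI_transpose]
  simp only [Matrix.mul_add, Matrix.add_mul, Matrix.mul_assoc, Matrix.transpose_mul,
    Matrix.transpose_transpose]

/-- The dissipation inequality for the gain bound. -/
lemma calL4_form (hA0 : EssBdd S.L S.A0) (hA1 : EssBdd S.L S.A1) (hA2 : EssBdd S.L S.A2)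
    (hB1 : EssBdd S.L S.B1) (hCa : EssBdd S.L S.Ca) (hCb : EssBdd S.L S.Cb)
    (hM : BddKernel S.L fun _ η => M η) (hN₁ : BddKernel S.L N₁)
    (hN₂ : BddKernel S.L N₂) (hL : 0 < S.L) (hv : MIntegrable (segMeasure S.L) v)
    (γ : ℝ) {K} (hK : S.calL4 M N₁ N₂ γ = K)
    {X : Matrix Unit Unit ℝ} (hX : X = (mI (segMeasure S.L) fun s => mI (segMeasure S.L) fun θ =>
          (v s)ᵀ * S.formKernel M N₁ N₂ s θ * v θ)
        + (mI (segMeasure S.L) fun s =>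
          (v s)ᵀ * mI (segMeasure S.L) fun η => S.V M N₁ N₂ s η) * W)
    {Y : Matrix (Fin q) Unit ℝ}
    (hY : Y = mI (segMeasure S.L) (fun θ => S.C3 θ * v θ) + S.D1 * W) :
    S.L • (Wᵀ * K.1 * W) + (2 : ℝ) • mI (segMeasure S.L) (fun θ => Wᵀ * K.2.1 θ * v θ)
      + (mI (segMeasure S.L) fun s => mI (segMeasure S.L) fun θ =>
        (v s)ᵀ * joinKernel K.2.2.1 K.2.2.2 s θ * v θ)
      = (2 : ℝ) • X + Yᵀ * Y - γ ^ 2 • (Wᵀ * W) := by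
  have hC := S.C3_mul_mIntegrable hCa hCb hL.le hv
  have hDC : MIntegrable (segMeasure S.L) fun θ => S.D1ᵀ * S.C3 θ * v θ := by
    simpa only [Matrix.mul_assoc] using hC.mul_left S.D1ᵀ
  have ht (A : Matrix Unit Unit ℝ) : A = Aᵀ := rfl
  have e : mI (segMeasure S.L) (fun θ => S.D1ᵀ * S.C3 θ * v θ)
      = S.D1ᵀ * mI (segMeasure S.L) fun θ => S.C3 θ * v θ := by
    rw [← mI_mul_left _ hC]
    simp only [Matrix.mul_assoc]
  subst hK
  rw [calL4]
  rw [S.mI_symm_kernel hA0 hA1 hA2 hM hN₁ hN₂ hL.le hv hC (fun _ _ => rfl) fun _ _ => rfl,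
    S.mI_cross hB1 hM hN₁ hN₂ hL.le hv hDC, e, hX, hY]
  set c := mI (segMeasure S.L) fun θ => S.C3 θ * v θ
  -- The factor 1/L in P compensates the length of the interval over which the constant `W` was
  -- integrated.
  have e₁ : S.L • (Wᵀ * ((1 / S.L) • (S.D1ᵀ * S.D1 - γ ^ 2 • (1 : Matrix (Fin m) (Fin m) ℝ))) * W)
      = (S.D1 * W)ᵀ * (S.D1 * W) - γ ^ 2 • (Wᵀ * W) := by
    rw [Matrix.mul_smul, Matrix.smul_mul, smul_smul, mul_one_div_cancel hL.ne', one_smul]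
    simp only [Matrix.mul_sub, Matrix.sub_mul, Matrix.transpose_mul, Matrix.mul_assoc,
      Matrix.mul_smul, Matrix.smul_mul, Matrix.one_mul]
  have e₂ : Wᵀ * (S.D1ᵀ * c) = (S.D1 * W)ᵀ * c := by
    simp only [Matrix.transpose_mul, Matrix.mul_assoc]
  have e₃ : cᵀ * (S.D1 * W) = (S.D1 * W)ᵀ * c := by
    rw [ht (cᵀ * (S.D1 * W)), Matrix.transpose_mul, Matrix.transpose_transpose]
  rw [e₁, e₂, Matrix.transpose_add, Matrix.add_mul, Matrix.mul_add, Matrix.mul_add, e₃]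
  module

/-- The dissipation inequality for passivity. -/
lemma calL5_form (S : PDESystem n m m) (hA0 : EssBdd S.L S.A0) (hA1 : EssBdd S.L S.A1)
    (hA2 : EssBdd S.L S.A2)
    (hB1 : EssBdd S.L S.B1) (hCa : EssBdd S.L S.Ca) (hCb : EssBdd S.L S.Cb)
    (hM : BddKernel S.L fun _ η => M η) (hN₁ : BddKernel S.L N₁)
    (hN₂ : BddKernel S.L N₂) (hL : 0 < S.L) (hv : MIntegrable (segMeasure S.L) v)
    {K} (hK : S.calL5 M N₁ N₂ rfl = K)
    {X : Matrix Unit Unit ℝ} (hX : X = (mI (segMeasure S.L) fun s => mI (segMeasure S.L) fun θ =>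
          (v s)ᵀ * S.formKernel M N₁ N₂ s θ * v θ)
        + (mI (segMeasure S.L) fun s =>
          (v s)ᵀ * mI (segMeasure S.L) fun η => S.V M N₁ N₂ s η) * W)
    {Y : Matrix (Fin m) Unit ℝ}
    (hY : Y = mI (segMeasure S.L) (fun θ => S.C3 θ * v θ) + S.D1 * W) :
    S.L • (Wᵀ * K.1 * W) + (2 : ℝ) • mI (segMeasure S.L) (fun θ => Wᵀ * K.2.1 θ * v θ)
      + (mI (segMeasure S.L) fun s => mI (segMeasure S.L) fun θ =>
        (v s)ᵀ * joinKernel K.2.2.1 K.2.2.2 s θ * v θ)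
      = (2 : ℝ) • X - (2 : ℝ) • (Wᵀ * Y) := by
  have hC := S.C3_mul_mIntegrable hCa hCb hL.le hv
  have hC' : MIntegrable (segMeasure S.L)
      fun θ => -((S.C3 θ).submatrix (Fin.cast rfl) id) * v θ := by
    have := hC.neg
    simp only [← Matrix.neg_mul] at this
    exact this
  have ht (A : Matrix Unit Unit ℝ) : A = Aᵀ := rfl
  have e : mI (segMeasure S.L) (fun θ => -((S.C3 θ).submatrix (Fin.cast rfl) id) * v θ)
      = -mI (segMeasure S.L) fun θ => S.C3 θ * v θ := by
    rw [← mI_neg]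
    simp only [← Matrix.neg_mul]
    rfl
  -- The kernel of 𝓛₅ has no C₃ᵀC₃ term, so the symmetrization is applied with an output kernel that
  -- has no rows.
  have h0 : MIntegrable (segMeasure S.L) fun s => (0 : Matrix (Fin 0) (Fin n) ℝ) * v s := by
    simpa only [Matrix.zero_mul] using MIntegrable.const 0
  subst hK
  rw [calL5]
  rw [S.mI_symm_kernel hA0 hA1 hA2 hM hN₁ hN₂ hL.le hv (C := fun _ => 0) h0
      (fun _ _ => by rw [Matrix.mul_zero, add_zero]) fun _ _ => rfl,
    S.mI_cross hB1 hM hN₁ hN₂ hL.le hv hC', e, hX, hY]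
  set c := mI (segMeasure S.L) fun θ => S.C3 θ * v θ
  have eD : S.D1.submatrix (Fin.cast rfl) id = S.D1 := rfl
  -- D₁ and its transpose have the same quadratic form, so -(D₁ + D₁ᵀ) contributes -2wᵀD₁w.
  have eDt : Wᵀ * (S.D1ᵀ * W) = Wᵀ * (S.D1 * W) := by
    rw [ht (Wᵀ * (S.D1ᵀ * W))]
    simp only [Matrix.transpose_mul, Matrix.transpose_transpose, Matrix.mul_assoc]
  have e₁ : S.L • (Wᵀ * (-((1 / S.L) • (S.D1 + S.D1ᵀ))) * W)
      = -((2 : ℝ) • (Wᵀ * (S.D1 * W))) := by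
    rw [Matrix.mul_neg, Matrix.neg_mul, Matrix.mul_smul, Matrix.smul_mul, smul_neg, smul_smul,
      mul_one_div_cancel hL.ne', one_smul, Matrix.mul_add, Matrix.add_mul, Matrix.mul_assoc,
      Matrix.mul_assoc, eDt, two_smul]
  rw [eD, e₁]
  simp only [Matrix.zero_mul, mI_zero, Matrix.mul_zero, add_zero, Matrix.mul_add, Matrix.mul_neg]
  module

end PDESystem

/-! ### Absolutely continuous curves and quadratic forms -/

section Curve

variable {E : Type*} [NormedAddCommGroup E] [NormedSpace ℝ E] [CompleteSpace E]

/-- The fundamental theorem of calculus for a symmetric bilinear form along a primitive. -/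
lemma bilin_primitive (B : E →L[ℝ] E →L[ℝ] ℝ) (hB : ∀ a b, B a b = B b a) {x x' : ℝ → E} {T : ℝ}
    (hT : 0 ≤ T) (hx' : IntegrableOn x' (Ioc 0 T))
    (hx : ∀ t ∈ Icc 0 T, x t = ∫ τ in Ioc 0 t, x' τ) :
    IntegrableOn (fun τ => B (x τ) (x' τ)) (Ioc 0 T) ∧
      B (x T) (x T) = 2 * ∫ τ in Ioc 0 T, B (x τ) (x' τ) := by
  set ν : Measure ℝ := volume.restrict (Ioc 0 T) with hν
  -- B(x(T), x(T)) is the integral of B(x'(σ), x'(τ)) over the square (0,T]². Each of the two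
  -- triangles contributes ∫ B(x, x'), by Fubini and the symmetry of `B`, so no differentiation of
  -- the storage functional is needed.
  have hI : Integrable (fun p : ℝ × ℝ => B (x' p.1) (x' p.2)) (ν.prod ν) :=
    Integrable.op_fst_snd (op := fun a b => B a b) (by fun_prop) ⟨‖B‖, B.le_opNorm₂⟩ hx' hx'
  have hle : MeasurableSet {p : ℝ × ℝ | p.1 ≤ p.2} := measurableSet_le measurable_fst measurable_snd
  have hlt : MeasurableSet {p : ℝ × ℝ | p.2 < p.1} := measurableSet_lt measurable_snd measurable_fst
  have key (τ : ℝ) (hτ : τ ∈ Ioc 0 T) : ∫ σ in Iic τ, B (x' σ) (x' τ) ∂ν = B (x τ) (x' τ) := by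
    have hs : Iic τ ∩ Ioc 0 T = Ioc 0 τ := by
      ext σ
      simp only [mem_inter_iff, mem_Iic, mem_Ioc]
      exact ⟨fun h => ⟨h.2.1, h.1⟩, fun h => ⟨h.2, h.1, h.2.trans hτ.2⟩⟩
    have hi : IntegrableOn x' (Ioc 0 τ) := IntegrableOn.mono_set hx' (Ioc_subset_Ioc_right hτ.2)
    rw [hν, Measure.restrict_restrict measurableSet_Iic, hs, hx τ ⟨hτ.1.le, hτ.2⟩]
    exact (B.flip (x' τ)).integral_comp_comm hi
  -- The complement of the closed triangle is open, so a strict version is required; it differs by a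
  -- single point.
  have key' (τ : ℝ) (hτ : τ ∈ Ioc 0 T) : ∫ σ in Iio τ, B (x' σ) (x' τ) ∂ν = B (x τ) (x' τ) := by
    rw [← key τ hτ]
    exact setIntegral_congr_set Iio_ae_eq_Iic
  have e₁ : ∫ p in {p : ℝ × ℝ | p.1 ≤ p.2}, B (x' p.1) (x' p.2) ∂(ν.prod ν)
      = ∫ τ, B (x τ) (x' τ) ∂ν := by
    rw [← integral_indicator hle, integral_prod_symm _ (hI.indicator hle)]
    refine setIntegral_congr_fun measurableSet_Ioc fun τ hτ => ?_
    rw [← key τ hτ, ← integral_indicator measurableSet_Iic]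
    rfl
  have e₂ : ∫ p in {p : ℝ × ℝ | p.2 < p.1}, B (x' p.1) (x' p.2) ∂(ν.prod ν)
      = ∫ τ, B (x τ) (x' τ) ∂ν := by
    rw [← integral_indicator hlt, integral_prod _ (hI.indicator hlt)]
    refine setIntegral_congr_fun measurableSet_Ioc fun τ hτ => ?_
    rw [← key' τ hτ, ← integral_indicator measurableSet_Iio]
    refine integral_congr_ae (.of_forall fun σ => ?_)
    by_cases h : σ < τ
    · simp [h, hB (x' τ)]
    · simp [h]
  have hint : Integrable (fun τ => B (x τ) (x' τ)) ν := by
    refine ((hI.indicator hle).integral_prod_right).congr ?_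
    filter_upwards [ae_restrict_mem measurableSet_Ioc] with τ hτ
    rw [← key τ hτ, ← integral_indicator measurableSet_Iic]
    rfl
  refine ⟨hint, ?_⟩
  have e₃ : B (x T) (x T) = ∫ p, B (x' p.1) (x' p.2) ∂(ν.prod ν) := by
    rw [hx T ⟨hT, le_rfl⟩]
    exact (integral_prod_bilin B hx' hx').symm
  have hc : {p : ℝ × ℝ | p.1 ≤ p.2}ᶜ = {p : ℝ × ℝ | p.2 < p.1} := by
    ext p
    simp
  rw [e₃, ← integral_add_compl hle hI, hc, e₁, e₂, two_mul]

end Curve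

/-! ### The storage functional -/

section Storage

variable {n : ℕ} {L : ℝ}

lemma BddKernel.exists_bound {ι κ : Type} [Fintype ι] [Fintype κ] {K : ℝ → ℝ → Matrix ι κ ℝ}
    (hK : BddKernel L K) :
    ∃ C, 0 ≤ C ∧ ∀ s ∈ Icc 0 L, ∀ θ ∈ Icc 0 L, ∀ i j, |K s θ i j| ≤ C := by
  choose C hC using fun i j => (hK i j).2
  refine ⟨∑ i, ∑ j, |C i j|, by positivity, fun s hs θ hθ i j => (hC i j s hs θ hθ).trans ?_⟩
  calc C i j ≤ |C i j| := le_abs_self _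
    _ ≤ ∑ j, |C i j| := Finset.single_le_sum (f := fun j => |C i j|)
        (fun _ _ => abs_nonneg _) (Finset.mem_univ j)
    _ ≤ _ := Finset.single_le_sum (f := fun i => ∑ j, |C i j|)
        (fun _ _ => Finset.sum_nonneg fun _ _ => abs_nonneg _) (Finset.mem_univ i)

/-- The Cauchy–Schwarz inequality for the scalar functions ‖f(·)‖ and ‖g(·)‖, which have the same L₂
norms as f and g. -/
lemma integral_norm_mul_norm_le {α E F : Type*} [MeasurableSpace α] {μ : Measure α}
    [NormedAddCommGroup E] [NormedAddCommGroup F] (f : Lp E 2 μ) (g : Lp F 2 μ) :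
    ∫ s, ‖f s‖ * ‖g s‖ ∂μ ≤ ‖f‖ * ‖g‖ := by
  have hf := (Lp.memLp f).norm
  have hg := (Lp.memLp g).norm
  have h := real_inner_le_norm (hg.toLp _) (hf.toLp _)
  rw [L2.inner_def] at h
  have e : ∫ s, inner ℝ (hg.toLp _ s) (hf.toLp _ s) ∂μ = ∫ s, ‖f s‖ * ‖g s‖ ∂μ := by
    refine integral_congr_ae ?_
    filter_upwards [hf.coeFn_toLp, hg.coeFn_toLp] with s h₁ h₂
    rw [h₁, h₂]
    rfl
  rw [e, Lp.norm_toLp, Lp.norm_toLp, eLpNorm_norm, eLpNorm_norm, ← Lp.norm_def, ← Lp.norm_def] at h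
  linarith

lemma StateSpace.mSqIntegrable (f : StateSpace n L) :
    MSqIntegrable (segMeasure L) fun s => col (f s) := fun i _ => (Lp.memLp f).eval_piLp i

lemma pForm_congr_ae {ι : Type} [Fintype ι] {M : ℝ → Matrix ι ι ℝ} {N : ℝ → ℝ → Matrix ι ι ℝ}
    {X X' F F' : ℝ → Matrix ι Unit ℝ} (hX : X =ᵐ[segMeasure L] X') (hF : F =ᵐ[segMeasure L] F') :
    pForm L M N X F = pForm L M N X' F' := by
  refine mI_congr_ae ?_
  have h (s : ℝ) : (mI (segMeasure L) fun θ => N s θ * F θ)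
      = mI (segMeasure L) fun θ => N s θ * F' θ := mI_congr_ae <| by
    filter_upwards [hF] with θ hθ
    rw [hθ]
  filter_upwards [hX, hF] with s h₁ h₂
  rw [h₁, h₂, h]

variable {M : ℝ → Matrix (Fin n) (Fin n) ℝ} {N : ℝ → ℝ → Matrix (Fin n) (Fin n) ℝ}
  {X Y F G : ℝ → Matrix (Fin n) Unit ℝ}

lemma BddKernel.mul_mSqIntegrable {ι κ l : Type} [Fintype κ] {K : ℝ → ℝ → Matrix ι κ ℝ}
    (hK : BddKernel L K) {s : ℝ} (hs : s ∈ Icc 0 L) {B : ℝ → Matrix κ l ℝ}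
    (hB : MSqIntegrable (segMeasure L) B) :
    MSqIntegrable (segMeasure L) fun θ => K s θ * B θ := fun i j => by
  simp only [Matrix.mul_apply]
  refine memLp_finsetSum _ fun k _ => ?_
  obtain ⟨hm, C, hC⟩ := hK i k
  have hb : MemLp (fun θ => K s θ i k) ⊤ (segMeasure L) := by
    refine memLp_top_of_bound (hm.comp measurable_prodMk_left).aestronglyMeasurable C ?_
    filter_upwards [ae_restrict_mem measurableSet_Icc] with θ hθ using hC s hs θ hθ
  exact (hB k j).mul hb

lemma mSqIntegrable_pOp (hM : BddKernel L fun _ η => M η) (hN : BddKernel L N) (hL : 0 ≤ L)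
    (hF : MSqIntegrable (segMeasure L) F) :
    MSqIntegrable (segMeasure L)
      fun s => M s * F s + mI (segMeasure L) fun θ => N s θ * F θ := by
  refine (hM.mul_mSqIntegrable (s := 0) ⟨le_rfl, hL⟩ hF).add (mSqIntegrable_mI (fun i j => ?_) hF)
  obtain ⟨hm, C, hC⟩ := hN i j
  refine MemLp.of_bound hm.aestronglyMeasurable C ?_
  filter_upwards [ae_prod_mem L] with p hp using hC _ hp.1 _ hp.2

lemma pForm_add_left (hM : BddKernel L fun _ η => M η) (hN : BddKernel L N) (hL : 0 ≤ L)
    (hX : MSqIntegrable (segMeasure L) X) (hY : MSqIntegrable (segMeasure L) Y)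
    (hF : MSqIntegrable (segMeasure L) F) :
    pForm L M N (fun s => X s + Y s) F = pForm L M N X F + pForm L M N Y F := by
  have h := mSqIntegrable_pOp hM hN hL hF
  simp only [pForm, Matrix.transpose_add, Matrix.add_mul]
  exact mI_add (hX.transpose.mul h) (hY.transpose.mul h)

lemma pForm_add_right (hM : BddKernel L fun _ η => M η) (hN : BddKernel L N) (hL : 0 ≤ L)
    (hX : MSqIntegrable (segMeasure L) X) (hF : MSqIntegrable (segMeasure L) F)
    (hG : MSqIntegrable (segMeasure L) G) :
    pForm L M N X (fun s => F s + G s) = pForm L M N X F + pForm L M N X G := by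
  have h₁ := mSqIntegrable_pOp hM hN hL hF
  have h₂ := mSqIntegrable_pOp hM hN hL hG
  rw [pForm, pForm, pForm, ← mI_add (hX.transpose.mul h₁) (hX.transpose.mul h₂)]
  refine mI_congr_ae ?_
  filter_upwards [ae_restrict_mem measurableSet_Icc] with s hs
  have e : (mI (segMeasure L) fun θ => N s θ * (F θ + G θ))
      = (mI (segMeasure L) fun θ => N s θ * F θ) + mI (segMeasure L) fun θ => N s θ * G θ := by
    rw [← mI_add (hN.mul_mIntegrable hs hF.mIntegrable) (hN.mul_mIntegrable hs hG.mIntegrable)]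
    simp only [Matrix.mul_add]
  rw [e, ← Matrix.mul_add, Matrix.mul_add (M s)]
  congr 1
  abel

lemma pForm_smul_left (c : ℝ) : pForm L M N (fun s => c • X s) F = c • pForm L M N X F := by
  simp only [pForm, Matrix.transpose_smul, Matrix.smul_mul, mI_smul]

lemma pForm_smul_right (c : ℝ) : pForm L M N X (fun s => c • F s) = c • pForm L M N X F := by
  simp only [pForm, Matrix.mul_smul, mI_smul, ← smul_add]

lemma pForm_expand (hM : BddKernel L fun _ η => M η) (hN : BddKernel L N) (hL : 0 ≤ L)
    (hX : MSqIntegrable (segMeasure L) X) (hF : MSqIntegrable (segMeasure L) F) :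
    pForm L M N X F = mI (segMeasure L) (fun s => (X s)ᵀ * M s * F s)
      + mI (segMeasure L) fun s => mI (segMeasure L) fun θ => (X s)ᵀ * N s θ * F θ := by
  have h₁ : MIntegrable (segMeasure L) fun s => (X s)ᵀ * M s * F s := by
    simpa only [Matrix.mul_assoc] using
      hX.transpose.mul (hM.mul_mSqIntegrable (s := 0) ⟨le_rfl, hL⟩ hF)
  have h₂ := (hN.mul_mul_mIntegrable_prod hX.transpose.mIntegrable hF.mIntegrable).mI_right
    (F := fun s θ => (X s)ᵀ * N s θ * F θ)
  rw [← mI_add h₁ h₂]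
  refine mI_congr_ae ?_
  filter_upwards [ae_restrict_mem measurableSet_Icc] with s hs
  rw [Matrix.mul_add, ← mI_mul_left _ (hN.mul_mIntegrable hs hF.mIntegrable)]
  simp only [Matrix.mul_assoc]

/-- Symmetry of the form of a self-adjoint operator. -/
lemma pForm_comm (hM : BddKernel L fun _ η => M η) (hN : BddKernel L N) (hL : 0 ≤ L)
    (hMs : ∀ s ∈ Icc 0 L, (M s)ᵀ = M s)
    (hNs : ∀ s ∈ Icc 0 L, ∀ θ ∈ Icc 0 L, s ≠ θ → (N s θ)ᵀ = N θ s)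
    (hX : MSqIntegrable (segMeasure L) X) (hF : MSqIntegrable (segMeasure L) F) :
    pForm L M N X F = pForm L M N F X := by
  have ht (A : Matrix Unit Unit ℝ) : A = Aᵀ := rfl
  rw [pForm_expand hM hN hL hX hF, pForm_expand hM hN hL hF hX]
  congr 1
  · refine mI_congr_ae ?_
    filter_upwards [ae_restrict_mem measurableSet_Icc] with s hs
    rw [ht ((X s)ᵀ * M s * F s)]
    simp only [Matrix.transpose_mul, Matrix.transpose_transpose, hMs s hs, Matrix.mul_assoc]
  · rw [mI_swap (F := fun s θ => (X s)ᵀ * N s θ * F θ)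
      (hN.mul_mul_mIntegrable_prod hX.transpose.mIntegrable hF.mIntegrable)]
    refine mI_congr_ae ?_
    filter_upwards [ae_restrict_mem measurableSet_Icc] with s hs
    refine mI_congr_ae ?_
    filter_upwards [ae_restrict_mem measurableSet_Icc,
      ae_restrict_of_ae (Measure.ae_ne volume s)] with θ hθ hne
    rw [ht ((X θ)ᵀ * N θ s * F s)]
    simp only [Matrix.transpose_mul, Matrix.transpose_transpose, hNs θ hθ s hs hne,
      Matrix.mul_assoc]

/-- The multiplier part is controlled by ∫ ‖f‖‖g‖, the kernel part by ∫ ‖f‖ · ∫ ‖g‖; Cauchy–Schwarz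
bounds both by the L₂ norms. -/
lemma abs_pForm_le (hM : BddKernel L fun _ η => M η) (hN : BddKernel L N) (hL : 0 ≤ L) :
    ∃ C, ∀ f g : StateSpace n L,
      |pForm L M N (fun s => col (f s)) (fun s => col (g s)) () ()| ≤ C * ‖f‖ * ‖g‖ := by
  obtain ⟨C₁, hC₁, hM'⟩ := hM.exists_bound
  obtain ⟨C₂, hC₂, hN'⟩ := hN.exists_bound
  have h0 : (0 : ℝ) ∈ Icc 0 L := ⟨le_rfl, hL⟩
  -- The constant function 1, against which Cauchy–Schwarz bounds the L₁ norm by the L₂ norm.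
  set o : Lp ℝ 2 (segMeasure L) := (memLp_const (1 : ℝ)).toLp _ with ho
  have hnorm (f : StateSpace n L) : ∫ s, ‖f s‖ ∂(segMeasure L) ≤ ‖f‖ * ‖o‖ := by
    refine le_trans (le_of_eq (integral_congr_ae ?_)) (integral_norm_mul_norm_le f o)
    filter_upwards [(memLp_const (1 : ℝ)).coeFn_toLp (μ := segMeasure L) (p := 2)] with s hs
    rw [ho, hs]
    simp
  have hcoord (x : EuclideanSpace ℝ (Fin n)) (i : Fin n) : |x i| ≤ ‖x‖ := PiLp.norm_apply_le x i
  refine ⟨n * (C₁ * n + C₂ * n * (‖o‖ * ‖o‖)), fun f g => ?_⟩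
  have hfi : Integrable (fun s => ‖f s‖) (segMeasure L) :=
    ((Lp.memLp f).integrable one_le_two).norm
  have hgi : Integrable (fun s => ‖g s‖) (segMeasure L) :=
    ((Lp.memLp g).integrable one_le_two).norm
  have hfg : Integrable (fun s => ‖f s‖ * ‖g s‖) (segMeasure L) :=
    (Lp.memLp f).norm.integrable_mul (Lp.memLp g).norm
  set γ := ∫ s, ‖g s‖ ∂(segMeasure L) with hγ
  have hbound : ∀ᵐ s ∂(segMeasure L),
      ‖((col (f s))ᵀ * (M s * col (g s) + mI (segMeasure L) fun θ => N s θ * col (g θ))) () ()‖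
        ≤ n * (C₁ * n) * (‖f s‖ * ‖g s‖) + n * (C₂ * n * γ) * ‖f s‖ := by
    filter_upwards [ae_restrict_mem measurableSet_Icc] with s hs
    have hsum {K : Matrix (Fin n) (Fin n) ℝ} {C : ℝ} (hK : ∀ i j, |K i j| ≤ C) (θ : ℝ) (i : Fin n) :
        |(K * col (g θ)) i ()| ≤ C * n * ‖g θ‖ := by
      rw [Matrix.mul_apply]
      refine (Finset.abs_sum_le_sum_abs _ _).trans ?_
      refine (Finset.sum_le_card_nsmul _ _ (C * ‖g θ‖) fun j _ => ?_).trans (le_of_eq ?_)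
      · rw [abs_mul]
        exact mul_le_mul (hK i j) (hcoord _ _) (abs_nonneg _) ((abs_nonneg _).trans (hK i j))
      · simp
        ring
    have h₂ (i : Fin n) : |(mI (segMeasure L) fun θ => N s θ * col (g θ)) i ()| ≤ C₂ * n * γ := by
      rw [mI_apply, hγ, ← integral_const_mul]
      refine norm_integral_le_of_norm_le (f := fun θ => (N s θ * col (g θ)) i ())
        (hgi.const_mul _) ?_
      filter_upwards [ae_restrict_mem measurableSet_Icc] with θ hθ
      exact hsum (fun i j => hN' s hs θ hθ i j) θ i
    rw [Matrix.mul_apply, Real.norm_eq_abs]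
    refine (Finset.abs_sum_le_sum_abs _ _).trans ?_
    refine (Finset.sum_le_card_nsmul _ _ (‖f s‖ * (C₁ * n * ‖g s‖ + C₂ * n * γ))
      fun i _ => ?_).trans (le_of_eq ?_)
    · rw [abs_mul]
      refine mul_le_mul (hcoord _ _) ?_ (abs_nonneg _) (norm_nonneg _)
      exact (abs_add_le _ _).trans
        (add_le_add (hsum (fun i j => hM' 0 h0 s hs i j) s i) (h₂ i))
    · simp
      ring
  have h := norm_integral_le_of_norm_le
    ((hfg.const_mul (n * (C₁ * n))).add (hfi.const_mul (n * (C₂ * n * γ)))) hbound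
  rw [integral_add' (hfg.const_mul _) (hfi.const_mul _), integral_const_mul,
    integral_const_mul] at h
  refine h.trans ?_
  have a₁ := integral_norm_mul_norm_le f g
  have a₂ := hnorm f
  have a₃ : γ ≤ ‖g‖ * ‖o‖ := hnorm g
  have a₄ : 0 ≤ ∫ s, ‖f s‖ ∂(segMeasure L) := integral_nonneg fun _ => norm_nonneg _
  calc _ ≤ n * (C₁ * n) * (‖f‖ * ‖g‖) + n * (C₂ * n * (‖g‖ * ‖o‖)) * (‖f‖ * ‖o‖) := by
        gcongr
    _ = _ := by ring

/-- The bilinear form of the storage functional as a continuous bilinear map. -/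
lemma exists_storage (hM : BddKernel L fun _ η => M η) (hN : BddKernel L N) (hL : 0 ≤ L) :
    ∃ B : StateSpace n L →L[ℝ] StateSpace n L →L[ℝ] ℝ, ∀ f g,
      B f g = pForm L M N (fun s => col (f s)) (fun s => col (g s)) () () := by
  obtain ⟨C, hC⟩ := abs_pForm_le hM hN hL
  have hadd (f g : StateSpace n L) : (fun s => col ((f + g) s))
      =ᵐ[segMeasure L] fun s => col (f s) + col (g s) := by
    filter_upwards [Lp.coeFn_add f g] with s hs
    rw [hs]
    rfl
  have hsmul (c : ℝ) (f : StateSpace n L) : (fun s => col ((c • f) s))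
      =ᵐ[segMeasure L] fun s => c • col (f s) := by
    filter_upwards [Lp.coeFn_smul c f] with s hs
    rw [hs]
    rfl
  refine ⟨LinearMap.mkContinuous₂ (LinearMap.mk₂ ℝ (fun f g : StateSpace n L =>
    pForm L M N (fun s => col (f s)) (fun s => col (g s)) () ()) ?_ ?_ ?_ ?_) C hC, fun f g => rfl⟩
  · intro f g h
    rw [pForm_congr_ae (hadd f g) .rfl, pForm_add_left hM hN hL f.mSqIntegrable g.mSqIntegrable
      h.mSqIntegrable]
    rfl
  · intro c f g
    rw [pForm_congr_ae (hsmul c f) .rfl, pForm_smul_left]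
    rfl
  · intro f g h
    rw [pForm_congr_ae .rfl (hadd g h), pForm_add_right hM hN hL f.mSqIntegrable g.mSqIntegrable
      h.mSqIntegrable]
    rfl
  · intro c f g
    rw [pForm_congr_ae .rfl (hsmul c g), pForm_smul_right]
    rfl

end Storage

/-! ### Polynomial kernels; symmetry and positivity from `Phi2`. -/

section

variable {n : ℕ} {L : ℝ}

/-- Polynomials enter the argument through continuity, hence boundedness on the compact square. -/
lemma bddKernel_evalM (M : Matrix (Fin n) (Fin n) ℝ[X]) : BddKernel L fun _ s => evalM M s :=
  fun i j => .of_continuous ((M i j).continuous.comp continuous_snd)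

lemma bddKernel_evalN (N : Matrix (Fin n) (Fin n) (MvPolynomial (Fin 2) ℝ)) :
    BddKernel L (evalN N) := fun i j => by
  refine .of_continuous ?_
  have hv : Continuous fun p : ℝ × ℝ => ![p.1, p.2] := continuous_pi fun k => by
    fin_cases k
    · exact continuous_fst
    · exact continuous_snd
  exact (MvPolynomial.continuous_eval (N i j)).comp hv

variable {M : ℝ → Matrix (Fin n) (Fin n) ℝ} {N₁ N₂ : ℝ → ℝ → Matrix (Fin n) (Fin n) ℝ} {ε : ℝ}

lemma Phi2.transpose_eq (hK : (fun s => M s - ε • (1 : Matrix (Fin n) (Fin n) ℝ), N₁, N₂) ∈ Phi2 n L)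
    {s : ℝ} (hs : s ∈ Icc 0 L) : (M s)ᵀ = M s := by
  obtain ⟨d₁, d₂, Z₁, Z, T, -, -, hT, h, -, -⟩ := hK
  have e : M s = (Z₁ s)ᵀ * T.submatrix blk1 blk1 * Z₁ s + ε • 1 := by
    rw [← h s hs]
    simp
  have hTt : Tᵀ = T := hT.1
  rw [e]
  simp only [Matrix.transpose_add, Matrix.transpose_mul, Matrix.transpose_transpose,
    Matrix.transpose_submatrix, hTt, Matrix.transpose_smul, Matrix.transpose_one, Matrix.mul_assoc]

lemma Phi2.joinKernel_transpose {K} (hK : K ∈ Phi2 n L) {s θ : ℝ} (hs : s ∈ Icc 0 L)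
    (hθ : θ ∈ Icc 0 L) (hne : s ≠ θ) :
    (joinKernel K.2.1 K.2.2 s θ)ᵀ = joinKernel K.2.1 K.2.2 θ s := by
  obtain ⟨-, -, -, -, -, -, -, -, -, -, h⟩ := hK
  unfold joinKernel
  rcases lt_or_gt_of_ne hne with hlt | hlt
  · rw [if_neg (not_le.2 hlt), if_pos hlt.le, h s θ hs.1 hlt.le hθ.2, Matrix.transpose_transpose]
  · rw [if_pos hlt.le, if_neg (not_le.2 hlt), h θ s hθ.1 hlt.le hs.2]

/-- The form of `M` is that of `M - ε` plus ε∫|v|², and both are nonnegative. -/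
lemma Phi2.pForm_nonneg (hε : 0 ≤ ε) (hL : 0 ≤ L)
    (hK : (fun s => M s - ε • (1 : Matrix (Fin n) (Fin n) ℝ), N₁, N₂) ∈ Phi2 n L)
    (hM : BddKernel L fun _ s => M s) (hN : BddKernel L (joinKernel N₁ N₂))
    {v : ℝ → Matrix (Fin n) Unit ℝ} (hv : MSqIntegrable (segMeasure L) v) :
    0 ≤ pForm L M (joinKernel N₁ N₂) v v () () := by
  have hM' : BddKernel L fun _ s => M s - ε • (1 : Matrix (Fin n) (Fin n) ℝ) := by
    simpa only [← sub_eq_add_neg] using hM.add (.const (-(ε • (1 : Matrix (Fin n) (Fin n) ℝ))))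
  have h := Phi2.form_nonneg hK hM' hL hv
  have h₁ : MIntegrable (segMeasure L)
      fun s => (v s)ᵀ * (M s - ε • (1 : Matrix (Fin n) (Fin n) ℝ)) * v s := by
    simpa only [Matrix.mul_assoc] using
      hv.transpose.mul (hM'.mul_mSqIntegrable (s := 0) ⟨le_rfl, hL⟩ hv)
  have h₂ := (hv.transpose.mul hv).smul ε
  have e : mI (segMeasure L) (fun s => (v s)ᵀ * M s * v s)
      = mI (segMeasure L) (fun s => (v s)ᵀ * (M s - ε • (1 : Matrix (Fin n) (Fin n) ℝ)) * v s)
        + mI (segMeasure L) fun s => ε • ((v s)ᵀ * v s) := by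
    rw [← mI_add h₁ h₂]
    congr 1
    funext s
    simp [Matrix.mul_sub, Matrix.sub_mul]
  have h₃ : 0 ≤ mI (segMeasure L) (fun s => ε • ((v s)ᵀ * v s)) () () := by
    rw [mI_apply]
    refine integral_nonneg fun s => mul_nonneg hε ?_
    simp only [Matrix.mul_apply, Matrix.transpose_apply]
    exact Finset.sum_nonneg fun i _ => mul_self_nonneg _
  rw [pForm_expand hM hN hL hv hv, e]
  simp only [Matrix.add_apply] at h ⊢
  linarith

end

/-! ### Integration in time and the two conclusions. -/

/-- A nonnegative symmetric storage functional which starts at zero and whose growth rate is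
bounded by the supply rate `g` forces the total supply to be nonnegative. -/
lemma integral_supply_nonneg {E : Type*} [NormedAddCommGroup E] [NormedSpace ℝ E] [CompleteSpace E]
    (B : E →L[ℝ] E →L[ℝ] ℝ) (hB : ∀ a b, B a b = B b a) (hpos : ∀ a, 0 ≤ B a a) {x x' : ℝ → E}
    (hx' : ∀ t, 0 ≤ t → IntervalIntegrable x' volume 0 t)
    (hx : ∀ t, 0 ≤ t → x t = ∫ τ in (0 : ℝ)..t, x' τ) {g : ℝ → ℝ} (hg : IntegrableOn g (Ioi 0))
    (hle : ∀ᵐ t ∂(volume.restrict (Ioi (0 : ℝ))), 2 * B (x t) (x' t) ≤ g t) :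
    0 ≤ ∫ t in Ioi (0 : ℝ), g t := by
  -- The total supply is the limit of the supply over (0,T], which dominates the storage B(x(T),
  -- x(T)) ≥ 0 for every T ≥ 0.
  refine ge_of_tendsto (intervalIntegral_tendsto_integral_Ioi 0 hg Filter.tendsto_id) ?_
  filter_upwards [Filter.eventually_ge_atTop 0] with T hT
  have hxT : ∀ t ∈ Icc 0 T, x t = ∫ τ in Ioc 0 t, x' τ := fun t ht => by
    rw [hx t ht.1, intervalIntegral.integral_of_le ht.1]
  obtain ⟨hi, he⟩ := bilin_primitive B hB hT
    ((intervalIntegrable_iff_integrableOn_Ioc_of_le hT).1 (hx' T hT)) hxT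
  rw [id, intervalIntegral.integral_of_le hT]
  calc 0 ≤ B (x T) (x T) := hpos _
    _ = ∫ τ in Ioc 0 T, 2 * B (x τ) (x' τ) := by rw [he, integral_const_mul]
    _ ≤ ∫ τ in Ioc 0 T, g τ := by
      refine integral_mono_ae (hi.const_mul 2) (hg.mono_set Ioc_subset_Ioi_self) ?_
      exact ae_restrict_of_ae_restrict_of_subset Ioc_subset_Ioi_self hle

lemma col_transpose_mul_col {ι : Type} [Fintype ι] (x y : EuclideanSpace ℝ ι) :
    ((col x)ᵀ * col y) () () = ∑ i, x i * y i := by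
  simp [Matrix.mul_apply, col_apply]

lemma col_transpose_mul_self {ι : Type} [Fintype ι] (x : EuclideanSpace ℝ ι) :
    ((col x)ᵀ * col x) () () = ‖x‖ ^ 2 := by
  rw [col_transpose_mul_col, EuclideanSpace.norm_sq_eq]
  simp [pow_two]

lemma eLpNorm_two_le_of_integral_sq_le {α E F : Type*} [MeasurableSpace α] {μ : Measure α}
    [NormedAddCommGroup E] [NormedAddCommGroup F] {f : α → E} {g : α → F} (hf : MemLp f 2 μ)
    (hg : MemLp g 2 μ) {c : ℝ} (hc : 0 ≤ c)
    (h : ∫ t, ‖f t‖ ^ 2 ∂μ ≤ c ^ 2 * ∫ t, ‖g t‖ ^ 2 ∂μ) :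
    eLpNorm f 2 μ ≤ ENNReal.ofReal c * eLpNorm g 2 μ := by
  rw [hf.eLpNorm_eq_integral_rpow_norm two_ne_zero ENNReal.ofNat_ne_top,
    hg.eLpNorm_eq_integral_rpow_norm two_ne_zero ENNReal.ofNat_ne_top, ← ENNReal.ofReal_mul hc]
  refine ENNReal.ofReal_le_ofReal ?_
  simp only [ENNReal.toReal_ofNat, Real.rpow_ofNat, ← one_div, ← Real.sqrt_eq_rpow]
  rw [← Real.sqrt_sq hc, ← Real.sqrt_mul (sq_nonneg c)]
  exact Real.sqrt_le_sqrt h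

namespace PDESystem

variable {n m q : ℕ} (S : PDESystem n m q) {M : ℝ → Matrix (Fin n) (Fin n) ℝ}
  {N₁ N₂ : ℝ → ℝ → Matrix (Fin n) (Fin n) ℝ}

/-- The rate of change of the storage functional at a time where the equation holds. -/
lemma pForm_solution (hL : 0 ≤ S.L) (hA0 : EssBdd S.L S.A0) (hA1 : EssBdd S.L S.A1)
    (hA2 : EssBdd S.L S.A2) (hB1 : EssBdd S.L S.B1) (hB : IsUnit S.B2.det)
    (hM : BddKernel S.L fun _ η => M η) (hN₁ : BddKernel S.L N₁) (hN₂ : BddKernel S.L N₂)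
    {u u' u'' : ℝ → EuclideanSpace ℝ (Fin n)} (h : S.InDomain u u' u'')
    {w : EuclideanSpace ℝ (Fin m)} {f f' : StateSpace n S.L}
    (hf : f =ᵐ[segMeasure S.L] u) (hf' : f' =ᵐ[segMeasure S.L] S.rhs u u' u'' w) :
    pForm S.L M (joinKernel N₁ N₂) (fun s => col (f s)) (fun s => col (f' s))
      = (mI (segMeasure S.L) fun s => mI (segMeasure S.L) fun θ =>
          (col (u'' s))ᵀ * S.formKernel M N₁ N₂ s θ * col (u'' θ))
        + (mI (segMeasure S.L) fun s =>
          (col (u'' s))ᵀ * mI (segMeasure S.L) fun η => S.V M N₁ N₂ s η) * col w := by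
  have hfu : (fun s => col (f s)) =ᵐ[segMeasure S.L] fun s => col (u s) := by
    filter_upwards [hf] with s hs
    rw [hs]
  rw [pForm_congr_ae hfu .rfl]
  refine S.pForm_rhs (U' := fun s => col (u' s)) hA0 hA1 hA2 hB1 hM hN₁ hN₂ hL h.1.mIntegrable
    (f.mSqIntegrable.mIntegrable.congr hfu) h.1.mIntegrable_deriv
    (fun s hs => S.col_eq_mI_G1 hB h hs) (fun s hs => S.col_deriv_eq_mI_G2 hB h hs)
    f'.mSqIntegrable.mIntegrable ?_
  filter_upwards [hf'] with s hs
  rw [hs]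
  rfl

lemma mSqIntegrable_of_isSobolevTwo {L : ℝ} {u u' u'' : ℝ → EuclideanSpace ℝ (Fin n)}
    (h : IsSobolevTwo L u u' u'') : MSqIntegrable (segMeasure L) fun s => col (u'' s) :=
  fun i _ => h.memLp.eval_piLp i

/-- A bound on the rate of change of the storage functional by a supply rate, valid at all times at
which the equation holds, gives a nonnegative total supply. -/
lemma IsSolution.integral_supply_nonneg {S : PDESystem n m q} (hL : 0 ≤ S.L) {ε : ℝ} (hε : 0 ≤ ε)
    (hM : BddKernel S.L fun _ η => M η) (hN₁ : BddKernel S.L N₁) (hN₂ : BddKernel S.L N₂)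
    (hK : (fun s => M s - ε • (1 : Matrix (Fin n) (Fin n) ℝ), N₁, N₂) ∈ Phi2 n S.L)
    {w : ℝ → EuclideanSpace ℝ (Fin m)} {y : ℝ → EuclideanSpace ℝ (Fin q)}
    {x : ℝ → StateSpace n S.L} (hx : S.IsSolution w y x)
    {g : ℝ → ℝ} (hg : IntegrableOn g (Ioi 0))
    (hle : ∀ t (u u' u'' : ℝ → EuclideanSpace ℝ (Fin n)) (f f' : StateSpace n S.L),
      S.InDomain u u' u'' → f =ᵐ[segMeasure S.L] u → f' =ᵐ[segMeasure S.L] S.rhs u u' u'' (w t) →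
      y t = S.output u u' (w t) →
      2 * pForm S.L M (joinKernel N₁ N₂) (fun s => col (f s)) (fun s => col (f' s)) () () ≤ g t) :
    0 ≤ ∫ t in Ioi (0 : ℝ), g t := by
  obtain ⟨hx0, x', hxi, hxe, hae⟩ := hx
  have hN := hN₁.join hN₂
  obtain ⟨B, hB⟩ := exists_storage hM hN hL
  refine PDEGain.integral_supply_nonneg (x := x) (x' := x') B (fun a b => ?_) (fun a => ?_) hxi
    (fun t ht => by rw [hxe t ht, hx0, zero_add]) hg ?_
  · rw [hB, hB, pForm_comm hM hN hL (fun s hs => Phi2.transpose_eq hK hs)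
      (fun s hs θ hθ hne => Phi2.joinKernel_transpose hK hs hθ hne) a.mSqIntegrable b.mSqIntegrable]
  · rw [hB]
    exact Phi2.pForm_nonneg hε hL hK hM hN a.mSqIntegrable
  · filter_upwards [hae] with t ⟨u, u', u'', h₁, h₂, h₃, h₄⟩
    rw [hB]
    exact hle t u u' u'' _ _ h₁ h₂ h₃ h₄

/-- The supply rate is γ²|w|² - |y|²: by `calL4_form` and `Phi1.form_nonpos`, 2⟨x, P x_t⟩ + |y|² -
γ²|w|² ≤ 0 at almost every time. -/
theorem gain_le (hL : 0 < S.L) (hA0 : EssBdd S.L S.A0) (hA1 : EssBdd S.L S.A1)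
    (hA2 : EssBdd S.L S.A2) (hB1 : EssBdd S.L S.B1) (hCa : EssBdd S.L S.Ca) (hCb : EssBdd S.L S.Cb)
    (hB : IsUnit S.B2.det) {ε γ : ℝ} (hε : 0 ≤ ε) (hγ : 0 ≤ γ)
    (hM : BddKernel S.L fun _ η => M η) (hN₁ : BddKernel S.L N₁) (hN₂ : BddKernel S.L N₂)
    (hK : (fun s => M s - ε • (1 : Matrix (Fin n) (Fin n) ℝ), N₁, N₂) ∈ Phi2 n S.L)
    {w : ℝ → EuclideanSpace ℝ (Fin m)} {y : ℝ → EuclideanSpace ℝ (Fin q)}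
    {x : ℝ → StateSpace n S.L} (hw : MemLp w 2 (volume.restrict (Ioi (0 : ℝ))))
    (hy : MemLp y 2 (volume.restrict (Ioi (0 : ℝ)))) (hx : S.IsSolution w y x)
    (hΦ : -(S.calL4 M N₁ N₂ γ) ∈ Phi1 n m S.L) :
    eLpNorm y 2 (volume.restrict (Ioi (0 : ℝ)))
      ≤ ENNReal.ofReal γ * eLpNorm w 2 (volume.restrict (Ioi (0 : ℝ))) := by
  have hwi : Integrable (fun t => ‖w t‖ ^ 2) (volume.restrict (Ioi (0 : ℝ))) := hw.norm.integrable_sq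
  have hyi : Integrable (fun t => ‖y t‖ ^ 2) (volume.restrict (Ioi (0 : ℝ))) := hy.norm.integrable_sq
  have hgi : IntegrableOn (fun t => γ ^ 2 * ‖w t‖ ^ 2 - ‖y t‖ ^ 2) (Ioi 0) :=
    (hwi.const_mul (γ ^ 2)).sub hyi
  have key := hx.integral_supply_nonneg (g := fun t => γ ^ 2 * ‖w t‖ ^ 2 - ‖y t‖ ^ 2) hL.le hε hM
    hN₁ hN₂ hK hgi fun t u u' u'' f f' h hf hf' hyt => by
      have h₁ := Phi1.form_nonpos hL.le hΦ (col (w t)) (mSqIntegrable_of_isSobolevTwo h.1)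
      rw [S.calL4_form hA0 hA1 hA2 hB1 hCa hCb hM hN₁ hN₂ hL h.1.mIntegrable γ rfl
        (S.pForm_solution hL.le hA0 hA1 hA2 hB1 hB hM hN₁ hN₂ h hf hf')
        (S.col_output hCa hCb hL.le hB h (w t)), ← hyt] at h₁
      simp only [Matrix.sub_apply, Matrix.add_apply, Matrix.smul_apply, smul_eq_mul,
        col_transpose_mul_self] at h₁
      linarith
  rw [integral_sub (hwi.const_mul _) hyi, integral_const_mul] at key
  exact eLpNorm_two_le_of_integral_sq_le hy hw hγ (by linarith)

/-- The supply rate is 2⟨y, w⟩: by `calL5_form` and `Phi1.form_nonpos`, 2⟨x, P x_t⟩ - 2⟨y, w⟩ ≤ 0 at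
almost every time. -/
theorem passive (S : PDESystem n m m) (hL : 0 < S.L) (hA0 : EssBdd S.L S.A0)
    (hA1 : EssBdd S.L S.A1)
    (hA2 : EssBdd S.L S.A2) (hB1 : EssBdd S.L S.B1) (hCa : EssBdd S.L S.Ca) (hCb : EssBdd S.L S.Cb)
    (hB : IsUnit S.B2.det) {ε : ℝ} (hε : 0 ≤ ε)
    (hM : BddKernel S.L fun _ η => M η) (hN₁ : BddKernel S.L N₁) (hN₂ : BddKernel S.L N₂)
    (hK : (fun s => M s - ε • (1 : Matrix (Fin n) (Fin n) ℝ), N₁, N₂) ∈ Phi2 n S.L)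
    {w : ℝ → EuclideanSpace ℝ (Fin m)} {y : ℝ → EuclideanSpace ℝ (Fin m)}
    {x : ℝ → StateSpace n S.L} (hw : MemLp w 2 (volume.restrict (Ioi (0 : ℝ))))
    (hy : MemLp y 2 (volume.restrict (Ioi (0 : ℝ)))) (hx : S.IsSolution w y x)
    (hΦ : -(S.calL5 M N₁ N₂ rfl) ∈ Phi1 n m S.L) :
    0 ≤ ∫ t in Ioi (0 : ℝ), ∑ i, y t i * w t i := by
  have hi : IntegrableOn (fun t => ∑ i, y t i * w t i) (Ioi 0) :=
    integrable_finsetSum _ fun i _ => (hy.eval_piLp i).integrable_mul (hw.eval_piLp i)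
  have key := hx.integral_supply_nonneg (g := fun t => 2 * ∑ i, y t i * w t i) hL.le hε hM
    hN₁ hN₂ hK (hi.const_mul 2) fun t u u' u'' f f' h hf hf' hyt => by
      have h₁ := Phi1.form_nonpos hL.le hΦ (col (w t)) (mSqIntegrable_of_isSobolevTwo h.1)
      rw [S.calL5_form hA0 hA1 hA2 hB1 hCa hCb hM hN₁ hN₂ hL h.1.mIntegrable rfl
        (S.pForm_solution hL.le hA0 hA1 hA2 hB1 hB hM hN₁ hN₂ h hf hf')
        (S.col_output hCa hCb hL.le hB h (w t)), ← hyt] at h₁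
      simp only [Matrix.sub_apply, Matrix.smul_apply, smul_eq_mul, col_transpose_mul_col,
        mul_comm (w t _)] at h₁
      linarith
  rw [integral_const_mul] at key
  linarith

end PDESystem

end PDEGain

end

theorem mainTheorem5 {n m q : ℕ} (S : PDEGain.PDESystem n m q) (hL : 0 < S.L)
    (hA0 : PDEGain.EssBdd S.L S.A0) (hA1 : PDEGain.EssBdd S.L S.A1)
    (hA2 : PDEGain.EssBdd S.L S.A2) (hB1 : PDEGain.EssBdd S.L S.B1)
    (hCa : PDEGain.EssBdd S.L S.Ca) (hCb : PDEGain.EssBdd S.L S.Cb)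
    (hB : IsUnit S.B2.det)
    (ε γ : ℝ) (hε : 0 < ε) (hγ : 0 < γ)
    (M : Matrix (Fin n) (Fin n) (Polynomial ℝ))
    (N₁ N₂ : Matrix (Fin n) (Fin n) (MvPolynomial (Fin 2) ℝ))
    (hΦ₂ : (fun s => PDEGain.evalM M s - ε • (1 : Matrix (Fin n) (Fin n) ℝ),
        PDEGain.evalN N₁, PDEGain.evalN N₂) ∈ PDEGain.Phi2 n S.L)
    (w : ℝ → EuclideanSpace ℝ (Fin m)) (y : ℝ → EuclideanSpace ℝ (Fin q))
    (x : ℝ → PDEGain.StateSpace n S.L)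
    (hw : MeasureTheory.MemLp w 2 (MeasureTheory.volume.restrict (Set.Ioi (0 : ℝ))))
    (hy : MeasureTheory.MemLp y 2 (MeasureTheory.volume.restrict (Set.Ioi (0 : ℝ))))
    (hx : S.IsSolution w y x) :
    (-(S.calL4 (PDEGain.evalM M) (PDEGain.evalN N₁) (PDEGain.evalN N₂) γ)
        ∈ PDEGain.Phi1 n m S.L →
      MeasureTheory.eLpNorm y 2 (MeasureTheory.volume.restrict (Set.Ioi (0 : ℝ)))
        ≤ ENNReal.ofReal γ *
          MeasureTheory.eLpNorm w 2 (MeasureTheory.volume.restrict (Set.Ioi (0 : ℝ)))) ∧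
    (∀ h : m = q,
      -(S.calL5 (PDEGain.evalM M) (PDEGain.evalN N₁) (PDEGain.evalN N₂) h)
        ∈ PDEGain.Phi1 n m S.L →
      0 ≤ ∫ t in Set.Ioi (0 : ℝ), ∑ i : Fin m, y t (Fin.cast h i) * w t i) := by
  have hM := PDEGain.bddKernel_evalM (L := S.L) M
  have hN₁ := PDEGain.bddKernel_evalN (L := S.L) N₁
  have hN₂ := PDEGain.bddKernel_evalN (L := S.L) N₂
  refine ⟨S.gain_le hL hA0 hA1 hA2 hB1 hCa hCb hB hε.le hγ.le hM hN₁ hN₂ hΦ₂ hw hy hx, ?_⟩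
  -- Once the two dimensions are identified, the casts of indices are definitionally trivial.
  rintro rfl hΦ₁
  exact S.passive hL hA0 hA1 hA2 hB1 hCa hCb hB hε.le hM hN₁ hN₂ hΦ₂ hw hy hx hΦ₁
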